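/- Let $\mathfrak g=\mathfrak{sl}(2,\mathbb R)$ be the Lie algebra of trace-zero matrices $Z=\begin{pmatrix}h&x\\y&-h\end{pmatrix}$, with basis $H,X,Y$ dual to the coordinates $h,x,y$, with Lebesgue measure $dZ$, and with $SL(2,\mathbb R)$ acting by conjugation. Let $\mathcal N=\{h^2+xy=0\}$ be the nilpotent cone, $\mathcal N^{+}$ (resp. $\mathcal N^-$) its subset where $x-y>0$ (resp. $x-y<0$), and $\square=\frac12\partial_H^2+2\partial_Y\partial_X$. Let $n\in\mathbb N$ and let $V_n$ be the (finite-dimensional, real) irreducible representation $\rho$ of $\mathfrak g$ with highest weight $n$ (so $\dim V_n=n+1$). For an open set $\mathcal U\subset\mathfrak g$, a $V_n$-valued generalized function on $\mathcal U$ is a continuous linear map from the compactly supported smooth densities on $\mathcal U$ to $V_n$. It is locally invariant if $(\rho(Z)+\mathcal L_Z)\phi=0$ for all $Z\in\mathfrak g$, where $(\mathcal L_Z\phi)(W)=\frac{d}{dt}\phi(W-t[Z,W])|_{t=0}$. Let $\mathcal S_n(\mathcal U)$, $\mathcal S_n^{\pm}(\mathcal U)$, $\mathcal S_n^0(\mathcal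 U)$ be the spaces of locally invariant $V_n$-valued generalized functions on $\mathcal U$ whose restriction to $\mathcal U\setminus\mathcal N$, to $\mathcal U\setminus(\mathcal N^\pm\cup\{0\})$, and to $\mathcal U\setminus\{0\}$, respectively, is zero. Let $V_1=\mathbb R^2$ be the standard representation, $B$ the symplectic form on $V_1$ with $B((1,0),(0,1))=1$, and $\mu_1:V_1\to\mathfrak g$ the map with $\operatorname{tr}(\mu_1(v)Z)=\frac12B(v,Zv)$ for all $Z\in\mathfrak g$. If $n$ is even, $V_n$ is isomorphic to the $\mathfrak g$-submodule of $S^{n/2}(\mathfrak g)$ generated by $X^{n/2}$; fix any such isomorphism as an identification, put $s_n(Z)=Z^{n/2}\in V_n$ for $Z\in\mathcal N$, and let $s_n\delta_{\mathcal N^\pm}$ be the generalized function on $\mathfrak g$ given by $f\,dZ\mapsto\int_{V_1}f(\pm\mu_1(v))\,s_n(\pm\mu_1(v))\,dv$, where $dv$ is twice the Lebesgue measure of $\mathbb R^2$. **Theorem.** Let $\mathcal U$ be an $SL(2,\mathbb R)$-invariant open subset of $\mathfrak{sl}(2,\mathbb R)$. 1. If $0\notin\mathcal U$, then $\mathcal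 S_n^0(\mathcal U)=\{0\}$. If $0\in\mathcal U$, then $\mathcal S_n^0(\mathcal U)\simeq(V_n\otimes S(\mathfrak g))^{\mathfrak g}$; the isomorphism sends $\sum_i v_i\otimes D_i$ to $\sum_i(\partial_{D_i}\delta_0)v_i$, where $\delta_0$ is the Dirac function at $0$ and $D\mapsto\partial_D$ is the algebra morphism from $S(\mathfrak g)$ to the differential operators with constant coefficients that extends $Z\mapsto\partial_Z$. 2. If $n$ is even, then $$\mathcal S_n(\mathcal U)=\mathcal S_n^0(\mathcal U)\oplus\operatorname{Vect}\{\square^k(s_n\delta_{\mathcal N^+})|_{\mathcal U}:k\in\mathbb N\}\oplus\operatorname{Vect}\{\square^k(s_n\delta_{\mathcal N^-})|_{\mathcal U}:k\in\mathbb N\},$$ $$\mathcal S_n^{\pm}(\mathcal U)=\mathcal S_n^0(\mathcal U)\oplus\operatorname{Vect}\{\square^k(s_n\delta_{\mathcal N^\pm})|_{\mathcal U}:k\in\mathbb N\}.$$ 3. If $n$ is odd, then $\mathcal S_n(\mathcal U)=\mathcal S_n^+(\mathcal U)=\mathcal S_n^-(\mathcal U)=\mathcal S_n^0(\mathcal U)$.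 Moreover, the map $\mu_1:V_1\setminus\{0\}\to\mathcal N^+$ has no continuous section. -/

import Mathlib

open TopologicalSpace MeasureTheory
open scoped Distributions LineDeriv TensorProduct

noncomputable section

namespace SlTwo

/-! ### The Lie algebra `𝔰𝔩(2, ℝ)` -/

/-- The Lie algebra `𝔰𝔩(2, ℝ)` of real `2 × 2` matrices of trace zero. -/
abbrev Sl2 : Type := LieAlgebra.SpecialLinear.sl (Fin 2) ℝ

/-- `𝔰𝔩(2, ℝ)` as a space of matrices, forgetting the bracket. -/
def toEntries : Sl2 →ₗ[ℝ] (Fin 2 → Fin 2 → ℝ) where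
  toFun Z := (Z : Matrix (Fin 2) (Fin 2) ℝ)
  map_add' _ _ := rfl
  map_smul' _ _ := rfl

lemma toEntries_injective : Function.Injective toEntries := fun _ _ h => Subtype.ext h

/-- The sup norm of the entries. As the space is finite dimensional, smoothness, test functions
and distributions do not depend on the choice of a norm. -/
instance : NormedAddCommGroup Sl2 :=
  letI aux : NormedAddCommGroup Sl2 :=
    NormedAddCommGroup.induced Sl2 (Fin 2 → Fin 2 → ℝ) toEntries toEntries_injective
  { aux with
    toUniformSpace := inferInstance
    uniformity_dist := aux.uniformity_dist
    toBornology := aux.toBornology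
    cobounded_sets := aux.cobounded_sets }

lemma norm_def (Z : Sl2) : ‖Z‖ = ‖toEntries Z‖ := rfl

instance : NormedSpace ℝ Sl2 where
  norm_smul_le c Z := by rw [norm_def, norm_def, map_smul, norm_smul]

/-- The matrix `(h, x; y, -h)`. -/
def ofCoords (h x y : ℝ) : Sl2 :=
  ⟨!![h, x; y, -h], by
    change Matrix.trace (!![h, x; y, -h] : Matrix (Fin 2) (Fin 2) ℝ) = 0
    simp [Matrix.trace_fin_two]⟩

def H : Sl2 := ofCoords 1 0 0
def X : Sl2 := ofCoords 0 1 0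
def Y : Sl2 := ofCoords 0 0 1

def hCoord (Z : Sl2) : ℝ := (Z : Matrix (Fin 2) (Fin 2) ℝ) 0 0
def xCoord (Z : Sl2) : ℝ := (Z : Matrix (Fin 2) (Fin 2) ℝ) 0 1
def yCoord (Z : Sl2) : ℝ := (Z : Matrix (Fin 2) (Fin 2) ℝ) 1 0

lemma ofCoords_coords (Z : Sl2) : ofCoords (hCoord Z) (xCoord Z) (yCoord Z) = Z := by
  have ht : Matrix.trace (Z : Matrix (Fin 2) (Fin 2) ℝ) = 0 := Z.2
  rw [Matrix.trace_fin_two] at ht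
  apply Subtype.ext
  ext i j
  fin_cases i <;> fin_cases j <;> simp [ofCoords, hCoord, xCoord, yCoord]
  linarith

lemma eq_comb (Z : Sl2) : Z = hCoord Z • H + xCoord Z • X + yCoord Z • Y := by
  conv_lhs => rw [← ofCoords_coords Z]
  apply Subtype.ext
  ext i j
  fin_cases i <;> fin_cases j <;> simp [ofCoords, H, X, Y]

lemma lie_Y_X : ⁅Y, X⁆ = -H := by
  apply Subtype.ext
  rw [LieAlgebra.SpecialLinear.sl_bracket]
  ext i j
  fin_cases i <;> fin_cases j <;> simp [ofCoords, H, X, Y]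

lemma lie_Y_H : ⁅Y, H⁆ = (2 : ℝ) • Y := by
  apply Subtype.ext
  rw [LieAlgebra.SpecialLinear.sl_bracket]
  ext i j
  fin_cases i <;> fin_cases j <;> simp [ofCoords, H, Y]
  norm_num

/-- The adjoint action `Ad(g) Z = g Z g⁻¹` of `SL(2, ℝ)`. -/
def Ad (g : Matrix.SpecialLinearGroup (Fin 2) ℝ) (Z : Sl2) : Sl2 :=
  ⟨(g : Matrix (Fin 2) (Fin 2) ℝ) * (Z : Matrix (Fin 2) (Fin 2) ℝ) * ((g⁻¹ : Matrix.SpecialLinearGroup (Fin 2) ℝ) :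
      Matrix (Fin 2) (Fin 2) ℝ), by
    change Matrix.trace ((g : Matrix (Fin 2) (Fin 2) ℝ) * (Z : Matrix (Fin 2) (Fin 2) ℝ) *
      ((g⁻¹ : Matrix.SpecialLinearGroup (Fin 2) ℝ) : Matrix (Fin 2) (Fin 2) ℝ)) = 0
    rw [Matrix.trace_mul_comm, ← mul_assoc, ← Matrix.SpecialLinearGroup.coe_mul, inv_mul_cancel,
      Matrix.SpecialLinearGroup.coe_one, one_mul]
    exact Z.2⟩

/-- `SL(2, ℝ)`-invariance of a subset of `𝔰𝔩(2, ℝ)`. -/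
def IsAdInvariant (U : Set Sl2) : Prop :=
  ∀ g : Matrix.SpecialLinearGroup (Fin 2) ℝ, ∀ Z ∈ U, Ad g Z ∈ U

/-! ### The nilpotent cone and the moment map -/

/-- The nilpotent cone. -/
def nilCone : Set Sl2 := {Z | IsNilpotent (Z : Matrix (Fin 2) (Fin 2) ℝ)}

/-- The upper half cone `𝒩⁺`: `h² + xy = 0`, `x - y > 0`. -/
def nilConePos : Set Sl2 :=
  {Z | hCoord Z ^ 2 + xCoord Z * yCoord Z = 0 ∧ 0 < xCoord Z - yCoord Z}

/-- The lower half cone `𝒩⁻`: `h² + xy = 0`, `x - y < 0`. -/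
def nilConeNeg : Set Sl2 :=
  {Z | hCoord Z ^ 2 + xCoord Z * yCoord Z = 0 ∧ xCoord Z - yCoord Z < 0}

lemma mem_nilCone_iff (Z : Sl2) :
    Z ∈ nilCone ↔ hCoord Z ^ 2 + xCoord Z * yCoord Z = 0 := by
  have hsq : (Z : Matrix (Fin 2) (Fin 2) ℝ) ^ 2 =
      (hCoord Z ^ 2 + xCoord Z * yCoord Z) • (1 : Matrix (Fin 2) (Fin 2) ℝ) := by
    rw [← ofCoords_coords Z, pow_two]
    ext i j
    fin_cases i <;> fin_cases j <;>
      simp [ofCoords, hCoord, xCoord, yCoord, Matrix.mul_apply, Fin.sum_univ_two] <;> ring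
  constructor
  · intro h
    have h2 : IsNilpotent ((Z : Matrix (Fin 2) (Fin 2) ℝ) ^ 2) := h.pow_of_pos two_ne_zero
    obtain ⟨k, hk⟩ := h2
    rw [hsq, smul_pow, one_pow] at hk
    have := congrFun (congrFun hk 0) 0
    simp at this
    exact this.1
  · intro h
    exact ⟨2, by rw [hsq, h, zero_smul]⟩

/-- The standard representation `V₁ = ℝ²`, on which `𝔰𝔩(2, ℝ)` acts by matrices. -/
abbrev V1 : Type := Fin 2 → ℝ

/-- The symplectic form on `V₁` with `B (e, f) = 1`. -/
def sympl (v w : V1) : ℝ := v 0 * w 1 - v 1 * w 0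

/-- The moment map `μ₁ : V₁ → 𝔰𝔩(2, ℝ)`; it is characterized in `trace_moment_mul`. -/
def moment (v : V1) : Sl2 :=
  ofCoords (-(v 0 * v 1) / 2) (v 0 ^ 2 / 2) (-(v 1 ^ 2) / 2)

lemma trace_moment_mul (v : V1) (Z : Sl2) :
    Matrix.trace ((moment v : Matrix (Fin 2) (Fin 2) ℝ) * (Z : Matrix (Fin 2) (Fin 2) ℝ)) =
      1 / 2 * sympl v ((Z : Matrix (Fin 2) (Fin 2) ℝ).mulVec v) := by
  rw [← ofCoords_coords Z]
  simp [moment, ofCoords, sympl, Matrix.trace_fin_two, Matrix.mul_apply, Matrix.mulVec,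
    dotProduct, Fin.sum_univ_two]
  ring

lemma moment_mem_nilCone (v : V1) : moment v ∈ nilCone := by
  rw [mem_nilCone_iff]
  simp [moment, ofCoords, hCoord, xCoord, yCoord]
  ring

lemma neg_mem_nilCone {Z : Sl2} (hZ : Z ∈ nilCone) : -Z ∈ nilCone := by
  have : IsNilpotent (-(Z : Matrix (Fin 2) (Fin 2) ℝ)) := IsNilpotent.neg hZ
  exact this

/-! ### The symmetric algebra with the adjoint action -/

/-- The symmetric algebra `S(𝔰𝔩(2, ℝ))`. -/
abbrev SymSl2 : Type := SymmetricAlgebra ℝ Sl2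

/-- The inclusion of `𝔰𝔩(2, ℝ)` into its symmetric algebra. -/
abbrev inc : Sl2 →ₗ[ℝ] SymSl2 := SymmetricAlgebra.ι ℝ Sl2

/-- The algebra homomorphism `D ↦ D + ε (ad Z) D` into the dual numbers over `S(𝔰𝔩(2, ℝ))`. -/
def adDual (Z : Sl2) : SymSl2 →ₐ[ℝ] TrivSqZeroExt SymSl2 SymSl2 :=
  SymmetricAlgebra.lift
    { toFun := fun W => TrivSqZeroExt.inl (inc W) + TrivSqZeroExt.inr (inc ⁅Z, W⁆)
      map_add' := fun a b => by
        ext <;> simp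
      map_smul' := fun c a => by
        ext <;> simp }

lemma fst_adDual (Z : Sl2) (D : SymSl2) : (adDual Z D).fst = D := by
  have h : (TrivSqZeroExt.fstHom ℝ SymSl2 SymSl2).comp (adDual Z) = AlgHom.id ℝ SymSl2 := by
    apply SymmetricAlgebra.algHom_ext
    ext W
    simp [adDual]
  exact DFunLike.congr_fun h D

/-- The adjoint action of `Z` on `S(𝔰𝔩(2, ℝ))`: the derivation that extends `W ↦ [Z, W]`
(see `adSym_inc`). -/
def adSym (Z : Sl2) : Derivation ℝ SymSl2 SymSl2 where
  toFun D := (adDual Z D).snd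
  map_add' a b := by simp
  map_smul' c a := by simp
  map_one_eq_zero' := by simp
  leibniz' a b := by
    simp [fst_adDual, mul_comm]

lemma adSym_inc (Z W : Sl2) : adSym Z (inc W) = inc ⁅Z, W⁆ := by
  change (adDual Z (inc W)).snd = _
  simp [adDual]

lemma derivation_ext {D₁ D₂ : Derivation ℝ SymSl2 SymSl2}
    (h : ∀ W : Sl2, D₁ (inc W) = D₂ (inc W)) : D₁ = D₂ := by
  ext a
  induction a using SymmetricAlgebra.induction with
  | algebraMap r => simp
  | ι x => exact h x
  | mul a b ha hb => simp [ha, hb]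
  | add a b ha hb => simp [ha, hb]

instance : LieRingModule Sl2 SymSl2 where
  bracket Z D := adSym Z D
  add_lie Z W D := by
    have : adSym (Z + W) = adSym Z + adSym W := derivation_ext fun T => by simp [adSym_inc]
    change adSym (Z + W) D = _
    rw [this]
    rfl
  lie_add Z D E := (adSym Z).map_add D E
  leibniz_lie Z W D := by
    have : ⁅adSym Z, adSym W⁆ = adSym ⁅Z, W⁆ := derivation_ext fun T => by
      rw [Derivation.commutator_apply]
      simp only [adSym_inc]
      rw [← map_sub, lie_lie]
    change adSym Z (adSym W D) = adSym ⁅Z, W⁆ D + adSym W (adSym Z D)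
    rw [← this, Derivation.commutator_apply]
    simp

instance : LieModule ℝ Sl2 SymSl2 where
  smul_lie c Z D := by
    have : adSym (c • Z) = c • adSym Z := derivation_ext fun T => by simp [adSym_inc]
    change adSym (c • Z) D = _
    rw [this]
    rfl
  lie_smul c Z D := (adSym Z).map_smul c D

lemma lie_sym_def (Z : Sl2) (D : SymSl2) : ⁅Z, D⁆ = adSym Z D := rfl

/-! ### Irreducible representations and the map `s_n` for even `n` -/

/-- `V` is an irreducible representation of `𝔰𝔩(2, ℝ)` with highest weight `n`, for the Cartan
subalgebra `ℝ H` and the positive root vector `X`. -/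
structure IsIrrepOfHighestWeight (n : ℕ) (V : Type*) [AddCommGroup V] [Module ℝ V]
    [LieRingModule Sl2 V] [LieModule ℝ Sl2 V] : Prop where
  irreducible : LieModule.IsIrreducible ℝ Sl2 V
  exists_highest : ∃ v : V, v ≠ 0 ∧ ⁅X, v⁆ = 0 ∧ ⁅H, v⁆ = (n : ℝ) • v

/-- The `𝔰𝔩(2, ℝ)`-submodule of `S(𝔰𝔩(2, ℝ))` generated by `X ^ m`. -/
def powComp (m : ℕ) : LieSubmodule ℝ Sl2 SymSl2 := LieSubmodule.lieSpan ℝ Sl2 {inc X ^ m}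

open Polynomial in
/-- The polynomial `exp (t ad Y) X = X - t H - t² Y` in `t`. -/
def orbitPoly : Polynomial SymSl2 :=
  C (inc X) - C (inc H) * Polynomial.X - C (inc Y) * Polynomial.X ^ 2

lemma orbitPoly_pow_coeff (m k : ℕ) :
    adSym Y ((orbitPoly ^ m).coeff k) = (Polynomial.derivative (orbitPoly ^ m)).coeff k := by
  have hmul : ∀ P Q : Polynomial SymSl2,
      (∀ k, adSym Y (P.coeff k) = (Polynomial.derivative P).coeff k) →
      (∀ k, adSym Y (Q.coeff k) = (Polynomial.derivative Q).coeff k) →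
      ∀ k, adSym Y ((P * Q).coeff k) = (Polynomial.derivative (P * Q)).coeff k := by
    intro P Q hP hQ k
    rw [Polynomial.derivative_mul, Polynomial.coeff_add, Polynomial.coeff_mul,
      Polynomial.coeff_mul, Polynomial.coeff_mul, map_sum, ← Finset.sum_add_distrib]
    refine Finset.sum_congr rfl fun x _ => ?_
    rw [Derivation.leibniz, hP, hQ, smul_eq_mul, smul_eq_mul]
    ring
  induction m generalizing k with
  | zero =>
    rw [pow_zero, Polynomial.derivative_one, Polynomial.coeff_zero, Polynomial.coeff_one]
    split_ifs <;> simp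
  | succ m ih =>
    rw [pow_succ]
    refine hmul _ _ (fun k => ih k) (fun k => ?_) k
    have hX : adSym Y (inc X) = -inc H := by rw [adSym_inc, lie_Y_X, map_neg]
    have hH : adSym Y (inc H) = 2 * inc Y := by
      rw [adSym_inc, lie_Y_H, map_smul, Algebra.smul_def, map_ofNat]
    have hY : adSym Y (inc Y) = 0 := by rw [adSym_inc, lie_self, map_zero]
    rw [Polynomial.coeff_derivative]
    rcases k with _ | _ | _ | k
    · simp [orbitPoly, Polynomial.coeff_X, Polynomial.coeff_C, hX]
    · simp [orbitPoly, Polynomial.coeff_X, Polynomial.coeff_C, hH]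
      ring
    · simp [orbitPoly, Polynomial.coeff_X, Polynomial.coeff_C, hY, Polynomial.coeff_X_pow]
    · simp [orbitPoly, Polynomial.coeff_X, Polynomial.coeff_C, Polynomial.coeff_X_pow]

lemma orbitPoly_pow_coeff_mem (m k : ℕ) : (orbitPoly ^ m).coeff k ∈ powComp m := by
  induction k with
  | zero =>
    have : (orbitPoly ^ m).coeff 0 = inc X ^ m := by
      rw [Polynomial.coeff_zero_eq_eval_zero]
      simp [orbitPoly]
    rw [this]
    exact LieSubmodule.subset_lieSpan rfl
  | succ k ih =>
    have h := orbitPoly_pow_coeff m k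
    rw [Polynomial.coeff_derivative] at h
    have h2 : (orbitPoly ^ m).coeff (k + 1) =
        ((k : ℝ) + 1)⁻¹ • ⁅Y, (orbitPoly ^ m).coeff k⁆ := by
      rw [lie_sym_def, h, eq_inv_smul_iff₀ (by positivity), Algebra.smul_def]
      simp [mul_comm]
    rw [h2]
    exact (powComp m).smul_mem _ ((powComp m).lie_mem ih)

/-- If `Z` is nilpotent, `Z ^ m` lies in the component of `S^m(𝔰𝔩(2, ℝ))` generated by `X ^ m`. -/
lemma pow_mem_powComp {Z : Sl2} (hZ : Z ∈ nilCone) (m : ℕ) : inc Z ^ m ∈ powComp m := by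
  rw [mem_nilCone_iff] at hZ
  by_cases hx : xCoord Z = 0
  · have hh : hCoord Z = 0 := by simpa [hx] using hZ
    have hc : (orbitPoly ^ m).coeff (m * 2) = (-inc Y) ^ m := by
      rw [Polynomial.coeff_pow_of_natDegree_le]
      · simp [orbitPoly, Polynomial.coeff_X, Polynomial.coeff_C]
      · unfold orbitPoly
        compute_degree
    have hZY : inc Z ^ m = (-yCoord Z) ^ m • (orbitPoly ^ m).coeff (m * 2) := by
      conv_lhs => rw [eq_comb Z, hx, hh]
      rw [hc, ← smul_pow]
      simp
    rw [hZY]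
    exact (powComp m).smul_mem _ (orbitPoly_pow_coeff_mem m _)
  · have hP : inc Z = xCoord Z •
        orbitPoly.eval (algebraMap ℝ SymSl2 (-hCoord Z / xCoord Z)) := by
      have hy : yCoord Z = -hCoord Z ^ 2 / xCoord Z := by
        field_simp
        linarith
      have hE : orbitPoly.eval (algebraMap ℝ SymSl2 (-hCoord Z / xCoord Z)) =
          inc (X - (-hCoord Z / xCoord Z) • H - ((-hCoord Z / xCoord Z) ^ 2) • Y) := by
        simp only [orbitPoly, Polynomial.eval_sub, Polynomial.eval_mul, Polynomial.eval_C,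
          Polynomial.eval_X, Polynomial.eval_pow, map_sub, map_smul, Algebra.smul_def, map_pow]
        ring
      rw [hE, ← map_smul]
      congr 1
      conv_lhs => rw [eq_comb Z]
      rw [smul_sub, smul_sub, smul_smul, smul_smul]
      have e1 : xCoord Z * (-hCoord Z / xCoord Z) = -hCoord Z := by field_simp
      have e2 : xCoord Z * (-hCoord Z / xCoord Z) ^ 2 = -yCoord Z := by
        rw [hy]
        field_simp
      rw [e1, e2, neg_smul, neg_smul]
      abel
    rw [hP, smul_pow]
    refine (powComp m).smul_mem _ ?_
    rw [← Polynomial.eval_pow, Polynomial.eval_eq_sum]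
    refine (powComp m).toSubmodule.sum_mem fun k _ => ?_
    change (orbitPoly ^ m).coeff k * algebraMap ℝ SymSl2 (-hCoord Z / xCoord Z) ^ k ∈ powComp m
    rw [← map_pow, mul_comm, ← Algebra.smul_def]
    exact (powComp m).smul_mem _ (orbitPoly_pow_coeff_mem m k)

/-- The invariant map `Z ↦ Z ^ m` from the nilpotent cone to the component of `S^m(𝔰𝔩(2, ℝ))`
generated by `X ^ m`; for `n = 2 m` this is `s_n`. -/
def nilPow (m : ℕ) (Z : nilCone) : powComp m := ⟨inc (Z : Sl2) ^ m, pow_mem_powComp Z.2 m⟩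

/-! ### Generalized functions

A generalized function on an open set `U` with values in `V` is a continuous linear map from the
compactly supported smooth densities on `U` to `V`. Through the Lebesgue measure
`dZ = dx dy dh`, a density `f dZ` is identified with the test function `f`, and
the space of generalized functions is `𝓓'(U, V)`. -/

section Distributions

variable {U : Opens Sl2} {V : Type*} [NormedAddCommGroup V] [NormedSpace ℝ V]

/-- The vector field `ℒ_Z`, given by `(ℒ_Z f)(W) = d/dt f(W - t [Z, W])` at `t = 0`,
on test functions. -/
def lieTest (Z : Sl2) (f : 𝓓(U, ℝ)) : 𝓓(U, ℝ) where
  toFun W := fderiv ℝ f W (-⁅Z, W⁆)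
  contDiff' := by
    have hlin : ContDiff ℝ ((⊤ : ℕ∞) : WithTop ℕ∞) (fun W : Sl2 => -⁅Z, W⁆) :=
      (-(LinearMap.toContinuousLinearMap (LieAlgebra.ad ℝ Sl2 Z : Sl2 →ₗ[ℝ] Sl2))).contDiff
    exact (f.contDiff.fderiv_right (m := ((⊤ : ℕ∞) : WithTop ℕ∞)) (by simp)).clm_apply hlin
  hasCompactSupport' := by
    refine (f.hasCompactSupport.fderiv ℝ).mono ?_
    intro W hW hW'
    exact hW (by simp [hW'])
  tsupport_subset' := by
    refine (closure_mono ?_).trans ((tsupport_fderiv_subset ℝ).trans f.tsupport_subset)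
    intro W hW hW'
    exact hW (by simp [hW'])

/-- Local invariance: `(ρ(Z) + ℒ_Z) φ = 0` for all `Z`. The vector field `ℒ_Z` is divergence free,
so that `ℒ_Z φ` is the generalized function `f ↦ -φ(ℒ_Z f)`. -/
def IsLocallyInvariant [LieRingModule Sl2 V] (φ : 𝓓'(U, V)) : Prop :=
  ∀ (Z : Sl2) (f : 𝓓(U, ℝ)), ⁅Z, φ f⁆ + -φ (lieTest Z f) = 0

variable (U V) in
/-- The locally invariant generalized functions on `U` with values in `V` that vanish on
`U \ C`. -/
def invVanishingOff [LieRingModule Sl2 V] [LieModule ℝ Sl2 V] (C : Set Sl2) :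
    Submodule ℝ 𝓓'(U, V) where
  carrier := {φ | IsLocallyInvariant φ ∧ Distribution.IsVanishingOn φ ((U : Set Sl2) \ C)}
  add_mem' := by
    rintro φ ψ ⟨h1, h2⟩ ⟨h3, h4⟩
    refine ⟨fun Z f => ?_, fun f hf => ?_⟩
    · have := h1 Z f
      have := h3 Z f
      change ⁅Z, φ f + ψ f⁆ + -(φ (lieTest Z f) + ψ (lieTest Z f)) = 0
      rw [lie_add, neg_add, add_add_add_comm, h1 Z f, h3 Z f, add_zero]
    · change φ f + ψ f = 0
      rw [h2 f hf, h4 f hf, add_zero]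
  zero_mem' := by
    refine ⟨fun Z f => ?_, fun f _ => rfl⟩
    change ⁅Z, (0 : V)⁆ + -(0 : V) = 0
    simp
  smul_mem' := by
    rintro c φ ⟨h1, h2⟩
    refine ⟨fun Z f => ?_, fun f hf => ?_⟩
    · change ⁅Z, c • φ f⁆ + -(c • φ (lieTest Z f)) = 0
      rw [lie_smul, ← smul_neg, ← smul_add, h1 Z f, smul_zero]
    · change c • φ f = 0
      rw [h2 f hf, smul_zero]

variable (U V) in
/-- The space `𝒮_n(U)`. -/
def S [LieRingModule Sl2 V] [LieModule ℝ Sl2 V] : Submodule ℝ 𝓓'(U, V) :=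
  invVanishingOff U V nilCone

variable (U V) in
/-- The space `𝒮_n⁺(U)`. -/
def SPos [LieRingModule Sl2 V] [LieModule ℝ Sl2 V] : Submodule ℝ 𝓓'(U, V) :=
  invVanishingOff U V (nilConePos ∪ {0})

variable (U V) in
/-- The space `𝒮_n⁻(U)`. -/
def SNeg [LieRingModule Sl2 V] [LieModule ℝ Sl2 V] : Submodule ℝ 𝓓'(U, V) :=
  invVanishingOff U V (nilConeNeg ∪ {0})

variable (U V) in
/-- The space `𝒮_n⁰(U)`. -/
def SZero [LieRingModule Sl2 V] [LieModule ℝ Sl2 V] : Submodule ℝ 𝓓'(U, V) :=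
  invVanishingOff U V {0}

/-! ### Differential operators with constant coefficients -/

variable (U V) in
/-- The derivative `∂_Z` on generalized functions. -/
def der (Z : Sl2) : Module.End ℝ 𝓓'(U, V) :=
  (Distribution.lineDerivCLM Z : 𝓓'(U, V) →L[ℝ] 𝓓'(U, V)).toLinearMap

lemma der_apply (Z : Sl2) (φ : 𝓓'(U, V)) : der U V Z φ = ∂_{Z} φ := rfl

lemma der_comm (Z W : Sl2) : der U V Z * der U V W = der U V W * der U V Z := by
  have key : ∀ f : 𝓓(U, ℝ), (∂_{Z} (∂_{W} f) : 𝓓(U, ℝ)) = ∂_{W} (∂_{Z} f) := by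
    intro f
    have hd : ∀ (T T' : Sl2) (a : Sl2),
        (∂_{T} (∂_{T'} f) : 𝓓(U, ℝ)) a = fderiv ℝ (fderiv ℝ f) a T T' := by
      intro T T' a
      have h1 : ∀ (g : 𝓓(U, ℝ)) (b : Sl2), (∂_{T} g : 𝓓(U, ℝ)) b = fderiv ℝ g b T := by
        intro g b
        change (TestFunction.lineDerivCLM ℝ T g : 𝓓(U, ℝ)) b = _
        rw [TestFunction.lineDerivCLM_eq_fderivCLM,
          TestFunction.fderivCLM_apply_of_le _ (by simp)]
      have h2 : ((∂_{T'} f : 𝓓(U, ℝ)) : Sl2 → ℝ) = fun b => fderiv ℝ f b T' := by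
        funext b
        change (TestFunction.lineDerivCLM ℝ T' f : 𝓓(U, ℝ)) b = _
        rw [TestFunction.lineDerivCLM_eq_fderivCLM,
          TestFunction.fderivCLM_apply_of_le _ (by simp)]
      rw [h1, h2]
      have hdiff : DifferentiableAt ℝ (fderiv ℝ f) a :=
        ((f.contDiff.fderiv_right (m := 1)
          (WithTop.coe_le_coe.2 le_top)).differentiable (by simp)).differentiableAt
      rw [fderiv_clm_apply hdiff (differentiableAt_const _)]
      simp
    ext a
    rw [hd, hd]
    exact (f.contDiff.contDiffAt.isSymmSndFDerivAt
      (by rw [minSmoothness_of_isRCLikeNormedField]; exact WithTop.coe_le_coe.2 le_top)).eq Z W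
  ext φ f
  change (∂_{Z} (∂_{W} φ) : 𝓓'(U, V)) f = (∂_{W} (∂_{Z} φ) : 𝓓'(U, V)) f
  have h : ∀ (T T' : Sl2),
      (∂_{T} (∂_{T'} φ) : 𝓓'(U, V)) f = φ (∂_{T'} (∂_{T} f : 𝓓(U, ℝ)) : 𝓓(U, ℝ)) := by
    intro T T'
    change - (- φ _) = _
    rw [neg_neg]
    rfl
  rw [h, h, key]

variable (U V) in
/-- The linear map `Z ↦ ∂_Z`. -/
def derLin : Sl2 →ₗ[ℝ] Module.End ℝ 𝓓'(U, V) where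
  toFun Z := der U V Z
  map_add' Z W := LinearMap.ext fun φ =>
    DFunLike.congr_fun (Distribution.lineDerivCLM_add (v₁ := Z) (v₂ := W)) φ
  map_smul' c Z := LinearMap.ext fun φ =>
    DFunLike.congr_fun (Distribution.lineDerivCLM_smul (c := c) (v := Z)) φ

variable (U V) in
/-- The morphism of algebras from `S(𝔰𝔩(2, ℝ))` to the operators on generalized functions that
extends `Z ↦ ∂_Z` (see `symDer_inc`); it exists since the `∂_Z` commute. -/
def symDer : SymSl2 →ₐ[ℝ] Module.End ℝ 𝓓'(U, V) :=
  RingCon.liftₐ (TensorAlgebra.symRingCon ℝ Sl2) (TensorAlgebra.lift ℝ (derLin U V)) <|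
    RingCon.ringConGen_le.2 fun a b h => by
      cases h with
      | mul_comm Z W =>
        rw [RingCon.ker_apply]
        simp
        exact der_comm (U := U) (V := V) Z W

lemma symDer_inc (Z : Sl2) : symDer U V (inc Z) = der U V Z := by
  change TensorAlgebra.lift ℝ (derLin U V) (TensorAlgebra.ι ℝ Z) = der U V Z
  rw [TensorAlgebra.lift_ι_apply]
  rfl

variable (U V) in
/-- The Casimir operator `□ = ½ ∂_H² + 2 ∂_Y ∂_X`. -/
def box : Module.End ℝ 𝓓'(U, V) :=
  (1 / 2 : ℝ) • (der U V H * der U V H) + (2 : ℝ) • (der U V Y * der U V X)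

variable (U V) in
/-- The linear map `∑ v_i ⊗ D_i ↦ ∑ (∂_{D_i} δ₀) v_i` from `V ⊗ S(𝔰𝔩(2, ℝ))` to the generalized
functions on `U`. -/
def diracMap : V ⊗[ℝ] SymSl2 →ₗ[ℝ] 𝓓'(U, V) :=
  TensorProduct.lift <| LinearMap.mk₂ ℝ
    (fun v D => Distribution.mapCLM (ContinuousLinearMap.toSpanSingleton ℝ v)
      (symDer U ℝ D (Distribution.delta (0 : Sl2))))
    (fun v w D => by ext f; simp)
    (fun c v D => by
      ext f
      change (symDer U ℝ D (Distribution.delta 0) f) • (c • v) =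
        c • ((symDer U ℝ D (Distribution.delta 0) f) • v)
      exact smul_comm _ _ _)
    (fun v D E => by simp)
    (fun c v D => by simp)

lemma diracMap_tmul_apply (v : V) (D : SymSl2) (f : 𝓓(U, ℝ)) :
    diracMap U V (v ⊗ₜ[ℝ] D) f = (symDer U ℝ D (Distribution.delta (0 : Sl2)) f) • v := by
  simp [diracMap]

/-! ### The generalized functions `s_n δ_{𝒩^±}` -/

variable (U V) in
/-- The restriction to `U` of a generalized function on `𝔰𝔩(2, ℝ)`. -/
def restr : 𝓓'((⊤ : Opens Sl2), V) →ₗ[ℝ] 𝓓'(U, V) :=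
  ((TestFunction.monoCLM ℝ : 𝓓(U, ℝ) →L[ℝ] 𝓓((⊤ : Opens Sl2), ℝ)).precompCompactConvergenceCLM
    V).toLinearMap

lemma restr_apply (φ : 𝓓'((⊤ : Opens Sl2), V)) (f : 𝓓(U, ℝ)) (g : 𝓓((⊤ : Opens Sl2), ℝ))
    (hfg : (g : Sl2 → ℝ) = f) : restr U V φ f = φ g := by
  change φ _ = φ g
  congr 1
  ext a
  rw [hfg]
  change (TestFunction.monoCLM ℝ f : 𝓓((⊤ : Opens Sl2), ℝ)) a = f a
  rw [TestFunction.monoCLM_apply]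
  simp

/-- For a continuous proper map `μ : V₁ → 𝔰𝔩(2, ℝ)` and a continuous map `s : V₁ → V`, the
generalized function `f ↦ ∫ f(μ(v)) s(v) dv`, where `dv` is twice the Lebesgue measure. -/
def pushforward (μ : V1 → Sl2) (s : V1 → V) (hμ : Continuous μ) (hs : Continuous s)
    (hK : ∀ K : Set Sl2, IsCompact K → IsCompact (μ ⁻¹' K)) : 𝓓'((⊤ : Opens Sl2), V) :=
  TestFunction.limitCLM ℝ (fun f => (2 : ℝ) • ∫ v : V1, f (μ v) • s v)
    (fun K _ =>
      (2 : ℝ) • ((LinearMap.mkContinuous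
        { toFun := fun g : BoundedContinuousFunction Sl2 ℝ =>
            ∫ v in μ ⁻¹' (K : Set Sl2), g (μ v) • s v
          map_add' := fun g g' => by
            have hint : ∀ g : BoundedContinuousFunction Sl2 ℝ,
                IntegrableOn (fun v => g (μ v) • s v) (μ ⁻¹' (K : Set Sl2)) := fun g =>
              ((g.continuous.comp hμ).smul hs).continuousOn.integrableOn_compact
                (hK K K.isCompact)
            rw [← integral_add (hint g) (hint g')]
            simp [add_smul]
          map_smul' := fun c g => by
            rw [RingHom.id_apply, ← integral_smul]
            simp [mul_smul] }
        (∫ v in μ ⁻¹' (K : Set Sl2), ‖s v‖)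
        (fun g => by
          have hsint : IntegrableOn (fun v => ‖s v‖) (μ ⁻¹' (K : Set Sl2)) :=
            hs.norm.continuousOn.integrableOn_compact (hK K K.isCompact)
          rw [mul_comm, ← integral_const_mul]
          refine norm_integral_le_of_norm_le (hsint.const_mul _) (Filter.Eventually.of_forall ?_)
          intro v
          rw [norm_smul]
          exact mul_le_mul_of_nonneg_right (g.norm_coe_le_norm _) (norm_nonneg _))) ∘L
        ContDiffMapSupportedIn.toBoundedContinuousFunctionCLM ℝ))
    (fun K hKU f => by
      change (2 : ℝ) • ∫ v : V1, f (μ v) • s v =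
        (2 : ℝ) • ∫ v in μ ⁻¹' (K : Set Sl2), f (μ v) • s v
      congr 1
      symm
      apply setIntegral_eq_integral_of_forall_compl_eq_zero
      intro v hv
      rw [f.zero_on_compl hv]
      simp)

lemma pushforward_apply (μ : V1 → Sl2) (s : V1 → V) (hμ : Continuous μ) (hs : Continuous s)
    (hK : ∀ K : Set Sl2, IsCompact K → IsCompact (μ ⁻¹' K)) (f : 𝓓((⊤ : Opens Sl2), ℝ)) :
    pushforward μ s hμ hs hK f = (2 : ℝ) • ∫ v : V1, f (μ v) • s v := rfl

lemma continuous_moment : Continuous moment := by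
  refine Continuous.subtype_mk ?_ _
  refine continuous_matrix fun i j => ?_
  fin_cases i <;> fin_cases j <;> simp <;> fun_prop

lemma isCompact_preimage_moment (K : Set Sl2) (hK : IsCompact K) :
    IsCompact (moment ⁻¹' K) := by
  refine Metric.isCompact_of_isClosed_isBounded (hK.isClosed.preimage continuous_moment) ?_
  obtain ⟨C, hC⟩ := hK.isBounded.exists_norm_le
  rw [isBounded_iff_forall_norm_le]
  refine ⟨2 * C + 1, fun v hv => ?_⟩
  have hb := hC _ hv
  have h0 : ∀ i j, |(moment v : Matrix (Fin 2) (Fin 2) ℝ) i j| ≤ C := fun i j =>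
    ((norm_le_pi_norm (toEntries (moment v) i) j).trans (norm_le_pi_norm _ i)).trans hb
  have h1 := h0 0 1
  have h2 := h0 1 0
  simp only [moment, ofCoords, Matrix.of_apply, Matrix.cons_val', Matrix.cons_val_zero,
    Matrix.cons_val_one, Matrix.cons_val_fin_one] at h1 h2
  rw [abs_le] at h1 h2
  have hC0 : 0 ≤ C := (norm_nonneg _).trans hb
  rw [pi_norm_le_iff_of_nonneg (by positivity)]
  intro i
  rw [Real.norm_eq_abs, abs_le]
  fin_cases i <;> constructor <;> simp <;> nlinarith [sq_nonneg (v 0), sq_nonneg (v 1)]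

lemma continuous_apply_inc_pow (m : ℕ) (q : SymSl2 →ₗ[ℝ] V) :
    Continuous fun Z : Sl2 => q (inc Z ^ m) := by
  induction m generalizing q with
  | zero => simpa using continuous_const
  | succ m ih =>
    have h : (fun Z : Sl2 => q (inc Z ^ (m + 1))) = fun Z =>
        hCoord Z • (q ∘ₗ LinearMap.mulLeft ℝ (inc H)) (inc Z ^ m) +
        xCoord Z • (q ∘ₗ LinearMap.mulLeft ℝ (inc X)) (inc Z ^ m) +
        yCoord Z • (q ∘ₗ LinearMap.mulLeft ℝ (inc Y)) (inc Z ^ m) := by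
      funext Z
      simp only [LinearMap.comp_apply, LinearMap.mulLeft_apply, ← map_smul, ← map_add]
      congr 1
      have hZ : inc Z = hCoord Z • inc H + xCoord Z • inc X + yCoord Z • inc Y := by
        conv_lhs => rw [eq_comb Z]
        simp only [map_add, map_smul]
      rw [pow_succ', ← smul_mul_assoc, ← smul_mul_assoc, ← smul_mul_assoc, ← add_mul, ← add_mul,
        ← hZ]
    rw [h]
    have hc : ∀ i j, Continuous fun Z : Sl2 => (Z : Matrix (Fin 2) (Fin 2) ℝ) i j :=
      fun i j => continuous_subtype_val.matrix_elem i j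
    exact (((hc 0 0).smul (ih _)).add ((hc 0 1).smul (ih _))).add ((hc 1 0).smul (ih _))

variable [LieRingModule Sl2 V] [LieModule ℝ Sl2 V]

/-- For an identification `e` of `V = V_n`, `n = 2 m`, with the component of `S^m(𝔰𝔩(2, ℝ))`
generated by `X ^ m`, the invariant map `s_n : 𝒩 → V_n`, `s_n(Z) = Z ^ m`. -/
def sMap {m : ℕ} (e : V ≃ₗ⁅ℝ, Sl2⁆ powComp m) (Z : nilCone) : V := e.symm (nilPow m Z)

lemma continuous_sMap {m : ℕ} (e : V ≃ₗ⁅ℝ, Sl2⁆ powComp m) : Continuous (sMap e) := by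
  obtain ⟨q, hq⟩ := LinearMap.exists_extend
    (p := (powComp m).toSubmodule) (e.symm : powComp m →ₗ[ℝ] V)
  have h : sMap e = fun Z : nilCone => q (inc (Z : Sl2) ^ m) := by
    funext Z
    exact (DFunLike.congr_fun hq (nilPow m Z)).symm
  rw [h]
  exact (continuous_apply_inc_pow m q).comp continuous_subtype_val

/-- `s_n δ_{𝒩⁺}` for `n = 2 m`: the generalized function
`f ↦ ∫ f(μ₁(v)) s_n(μ₁(v)) dv` on `𝔰𝔩(2, ℝ)`. -/
def sDeltaPos {m : ℕ} (e : V ≃ₗ⁅ℝ, Sl2⁆ powComp m) : 𝓓'((⊤ : Opens Sl2), V) :=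
  pushforward moment (fun v => sMap e ⟨moment v, moment_mem_nilCone v⟩) continuous_moment
    ((continuous_sMap e).comp (continuous_moment.subtype_mk _)) isCompact_preimage_moment

/-- `s_n δ_{𝒩⁻}` for `n = 2 m`: the generalized function
`f ↦ ∫ f(-μ₁(v)) s_n(-μ₁(v)) dv` on `𝔰𝔩(2, ℝ)`. -/
def sDeltaNeg {m : ℕ} (e : V ≃ₗ⁅ℝ, Sl2⁆ powComp m) : 𝓓'((⊤ : Opens Sl2), V) :=
  pushforward (fun v => -moment v)
    (fun v => sMap e ⟨-moment v, neg_mem_nilCone (moment_mem_nilCone v)⟩) continuous_moment.neg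
    ((continuous_sMap e).comp (continuous_moment.neg.subtype_mk _))
    (fun K hK => by
      have := isCompact_preimage_moment (-K) hK.neg
      exact this)

lemma sDeltaPos_apply {m : ℕ} (e : V ≃ₗ⁅ℝ, Sl2⁆ powComp m) (f : 𝓓((⊤ : Opens Sl2), ℝ)) :
    sDeltaPos e f =
      (2 : ℝ) • ∫ v : V1, f (moment v) • sMap e ⟨moment v, moment_mem_nilCone v⟩ := rfl

lemma sDeltaNeg_apply {m : ℕ} (e : V ≃ₗ⁅ℝ, Sl2⁆ powComp m) (f : 𝓓((⊤ : Opens Sl2), ℝ)) :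
    sDeltaNeg e f =
      (2 : ℝ) • ∫ v : V1, f (-moment v) •
        sMap e ⟨-moment v, neg_mem_nilCone (moment_mem_nilCone v)⟩ := rfl

variable (U) in
/-- The span of the restrictions `□^k(s_n δ_{𝒩⁺})|_U`, `k ∈ ℕ`. -/
def spanPos {m : ℕ} (e : V ≃ₗ⁅ℝ, Sl2⁆ powComp m) : Submodule ℝ 𝓓'(U, V) :=
  Submodule.span ℝ (Set.range fun k : ℕ => restr U V ((box ⊤ V ^ k) (sDeltaPos e)))

variable (U) in
/-- The span of the restrictions `□^k(s_n δ_{𝒩⁻})|_U`, `k ∈ ℕ`. -/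
def spanNeg {m : ℕ} (e : V ≃ₗ⁅ℝ, Sl2⁆ powComp m) : Submodule ℝ 𝓓'(U, V) :=
  Submodule.span ℝ (Set.range fun k : ℕ => restr U V ((box ⊤ V ^ k) (sDeltaNeg e)))

end Distributions

end SlTwo

end

/-! Pair an invariant φ with the covector `top` dual to the highest weight vector. It kills the
image of Y and has weight n, so ξ = top ∘ φ is a scalar functional with ξ(ℒ_Y f) = 0 and ξ(ℒ_H f) =
n ξ(f). It determines φ, because the covectors top ∘ X^k separate points and invariance moves X^k
onto the test function.

For odd n, exp(π(Y - X)) = -1 acts trivially on 𝔤 and by -1 on V_n, so every invariant φ on an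
invariant open set is zero (`IsInv.eq_zero_of_odd`); all the spaces of the theorem are then zero.

For n = 2m, work on the half spaces σx > 0 with σ = ±1. There q = h² + xy is completed by
coordinates a, b along the orbits of the lower triangular group, with ℒ_Y = ∂_a and ℒ_H = -2∂_b +
2a∂_a. The two equations force ξ to depend on f only through a weighted fibre integral `hat`, a test
function of q alone (`apply_eq_apply_lift_hat`). Support in the cone becomes support at q = 0, so a
power of q kills ξ (`exists_quadT_pow_eq_zero`), and functionals killed by q itself are unique up to
scalars (`apply_eq_mul`): they are multiples of the top component of s_n δ. The commutator [□, q] =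
2E + 3, with E the Euler operator, shows that multiplication by q lowers □^k(s_n δ) to a multiple of
□^(k-1)(s_n δ), the factor k(2k - 1 - 2m) being nonzero by parity (`apply_boxT_pow_quadT`).
Induction on the power of q yields a combination of the □^k(s_n δ) that agrees with φ on the half
space (`exists_mem_span`); the same relation shows that such a combination is determined by its
restriction there (`eq_zero_of_mem_span`).

After both combinations are subtracted, the remainder vanishes where x ≠ 0, then where y ≠ 0 by
conjugation with exp(TX) (`IsInv.isVanishingOn_of_halfSpace`), and off the cone by assumption, hence
off the origin. Finally, generalized functions supported at the origin are sums of derivatives of δ₀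
(`exists_diracMap_eq`), and `diracMap` is injective and equivariant, so the invariant ones
correspond to invariant tensors. -/

set_option linter.unusedSimpArgs false
set_option linter.unusedSectionVars false

noncomputable section

namespace SlTwo

open scoped ContDiff

/-! ### Smooth dependence of interval integrals on parameters. -/

section Parametric

universe u

variable {E : Type u} [NormedAddCommGroup E] [NormedSpace ℝ E] [FiniteDimensional ℝ E]

theorem hasFDerivAt_intervalIntegral {F : Type u} [NormedAddCommGroup F] [NormedSpace ℝ F]
    {f : ℝ × E → F} (hf : ContDiff ℝ 1 f) (a b : ℝ) (x : E) :
    HasFDerivAt (fun x => ∫ t in a..b, f (t, x))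
      (∫ t in a..b, (fderiv ℝ f (t, x)).comp (ContinuousLinearMap.inr ℝ ℝ E)) x := by
  have hc : Continuous fun p : ℝ × E =>
      (fderiv ℝ f p).comp (ContinuousLinearMap.inr ℝ ℝ E) :=
    (hf.continuous_fderiv (by simp)).clm_comp continuous_const
  have hK : IsCompact (Set.uIcc a b ×ˢ Metric.closedBall x 1) :=
    isCompact_uIcc.prod (isCompact_closedBall x 1)
  obtain ⟨C, hC⟩ := hK.exists_bound_of_continuousOn hc.continuousOn
  refine intervalIntegral.hasFDerivAt_integral_of_dominated_of_fderiv_le (s := Metric.ball x 1)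
    (bound := fun _ => C) (F := fun x t => f (t, x))
    (F' := fun x t => (fderiv ℝ f (t, x)).comp (ContinuousLinearMap.inr ℝ ℝ E))
    (Metric.ball_mem_nhds x one_pos) ?_ ?_ ?_ ?_ ?_ ?_
  · refine Filter.Eventually.of_forall fun y => Continuous.aestronglyMeasurable ?_
    exact hf.continuous.comp (by fun_prop)
  · exact (hf.continuous.comp (by fun_prop : Continuous fun t : ℝ => (t, x))).intervalIntegrable _ _
  · exact (hc.comp (by fun_prop : Continuous fun t : ℝ => (t, x))).aestronglyMeasurable
  · refine Filter.Eventually.of_forall fun t ht y hy => hC (t, y) ⟨Set.uIoc_subset_uIcc ht, ?_⟩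
    exact Metric.ball_subset_closedBall hy
  · exact intervalIntegrable_const
  · refine Filter.Eventually.of_forall fun t _ y _ => ?_
    have h1 : HasFDerivAt f (fderiv ℝ f (t, y)) (t, y) :=
      (hf.differentiable (by simp) (t, y)).hasFDerivAt
    exact h1.comp y (hasFDerivAt_prodMk_right t y)

/-- Induction on the order of differentiability: the derivative is again an interval integral, now
of a map with values in `E →L[ℝ] F`. This is why `F` varies in the induction and shares the universe
of `E`. -/
theorem contDiff_intervalIntegral {F : Type u} [NormedAddCommGroup F] [NormedSpace ℝ F]
    {f : ℝ × E → F} (hf : ContDiff ℝ ∞ f) (a b : ℝ) :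
    ContDiff ℝ ∞ (fun x => ∫ t in a..b, f (t, x)) := by
  rw [contDiff_infty]
  intro n
  induction n generalizing F with
  | zero =>
    rw [Nat.cast_zero, contDiff_zero]
    exact intervalIntegral.continuous_parametric_intervalIntegral_of_continuous'
      (f := fun x t => f (t, x)) (by
        exact hf.continuous.comp (by fun_prop : Continuous fun p : E × ℝ => (p.2, p.1))) a b
  | succ n ih =>
    have h1 := hasFDerivAt_intervalIntegral (hf.of_le (by exact_mod_cast le_top)) a b
    rw [Nat.cast_add, Nat.cast_one, contDiff_succ_iff_fderiv]
    refine ⟨fun x => (h1 x).differentiableAt, by simp, ?_⟩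
    rw [funext fun x => (h1 x).fderiv]
    exact ih ((hf.fderiv_right (m := ∞) (by simp)).clm_comp contDiff_const)

end Parametric

/-! ### Division by one variable, and compactly supported primitives in one variable. -/

section Hadamard

variable {E : Type} [NormedAddCommGroup E] [NormedSpace ℝ E] [FiniteDimensional ℝ E]

theorem hasDerivAt_fst {k : ℝ × E → ℝ} (hk : ContDiff ℝ ∞ k) (a : ℝ) (e : E) :
    HasDerivAt (fun t => k (t, e)) (fderiv ℝ k (a, e) (1, 0)) a := by
  have h1 : HasFDerivAt k (fderiv ℝ k (a, e)) (a, e) :=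
    (hk.differentiable (by simp) (a, e)).hasFDerivAt
  exact h1.comp_hasDerivAt a ((hasDerivAt_id a).prodMk (hasDerivAt_const a e))

/-- Hadamard's lemma in the first variable. -/
theorem exists_eq_fst_mul {k : ℝ × E → ℝ} (hk : ContDiff ℝ ∞ k) (h0 : ∀ e, k (0, e) = 0) :
    ∃ g : ℝ × E → ℝ, ContDiff ℝ ∞ g ∧ (∀ z, k z = z.1 * g z) ∧ tsupport g ⊆ tsupport k := by
  have hd : ContDiff ℝ ∞ fun z => fderiv ℝ k z (1, 0) :=
    (hk.fderiv_right (m := ∞) (by simp)).clm_apply contDiff_const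
  have hg : ContDiff ℝ ∞ fun z : ℝ × E => ∫ s in (0 : ℝ)..1, fderiv ℝ k (s * z.1, z.2) (1, 0) :=
    contDiff_intervalIntegral (f := fun p : ℝ × ℝ × E => fderiv ℝ k (p.1 * p.2.1, p.2.2) (1, 0))
      (hd.comp (by fun_prop)) 0 1
  have hmul : ∀ z : ℝ × E, k z = z.1 * ∫ s in (0 : ℝ)..1, fderiv ℝ k (s * z.1, z.2) (1, 0) := by
    rintro ⟨q, e⟩
    have hder : ∀ s ∈ Set.uIcc (0 : ℝ) 1,
        HasDerivAt (fun s => k (s * q, e)) (q * fderiv ℝ k (s * q, e) (1, 0)) s := by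
      intro s _
      have h1 := hasDerivAt_fst hk (s * q) e
      have h2 : HasDerivAt (fun s : ℝ => s * q) q s := by
        simpa using (hasDerivAt_id s).mul_const q
      have h3 := HasDerivAt.comp s h1 h2
      rw [mul_comm] at h3
      exact h3
    have hint := intervalIntegral.integral_eq_sub_of_hasDerivAt hder
      (Continuous.intervalIntegrable (continuous_const.mul
        (hd.continuous.comp (by fun_prop))) _ _)
    rw [intervalIntegral.integral_const_mul] at hint
    rw [hint]
    simp [h0]
  refine ⟨_, hg, hmul, closure_minimal ?_ isClosed_closure⟩
  rintro ⟨q, e⟩ hz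
  rw [Function.mem_support] at hz
  -- On the hyperplane q = 0 the quotient equals the partial derivative of `k`, which vanishes off
  -- the support of `k`; elsewhere it is `k` divided by q.
  by_cases hq : q = 0
  · subst hq
    by_contra hcon
    refine hz ?_
    have hf0 : fderiv ℝ k (0, e) = 0 := image_eq_zero_of_notMem_tsupport fun h =>
      hcon (tsupport_fderiv_subset ℝ h)
    simp [hf0]
  · refine subset_closure ?_
    rw [Function.mem_support, hmul]
    exact mul_ne_zero hq hz

/-- Compactly supported primitives in the first variable. -/
theorem exists_primitive_fst {F : ℝ × E → ℝ} (hF : ContDiff ℝ ∞ F) (hc : HasCompactSupport F)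
    (h0 : ∀ e, ∫ a, F (a, e) = 0) :
    ∃ G : ℝ × E → ℝ, ContDiff ℝ ∞ G ∧ HasCompactSupport G ∧
      (∀ z, fderiv ℝ G z (1, 0) = F z) ∧ tsupport G ⊆ Prod.snd ⁻¹' (Prod.snd '' tsupport F) := by
  obtain ⟨M, hM⟩ : ∃ M : ℝ, ∀ z ∈ tsupport F, |z.1| ≤ M := by
    obtain ⟨C, hC⟩ := hc.isCompact.isBounded.exists_norm_le
    exact ⟨C, fun z hz => (norm_fst_le z).trans (hC z hz)⟩
  have hzero : ∀ a e, M < |a| → F (a, e) = 0 := fun a e h =>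
    image_eq_zero_of_notMem_tsupport fun h' => absurd (hM _ h') (not_le.2 h)
  have hcont : ∀ e, Continuous fun t => F (t, e) := fun e => hF.continuous.comp (by fun_prop)
  set N : ℝ := |M| + 1 with hN
  have hMN : M < N := by rw [hN]; linarith [le_abs_self M]
  have hN0 : 0 < N := by positivity
  set G : ℝ × E → ℝ := fun z => ∫ t in (-N)..z.1, F (t, z.2) with hG
  -- Rescaling to the interval [0, 1] turns the variable endpoint into a parameter of the integrand,
  -- which gives smoothness.
  have hG2 : G = fun z : ℝ × E =>
      (z.1 + N) * ∫ s in (0 : ℝ)..1, F (-N + (z.1 + N) * s, z.2) := by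
    funext z
    have := intervalIntegral.smul_integral_comp_add_mul (a := 0) (b := 1)
      (fun t => F (t, z.2)) (z.1 + N) (-N)
    simp only [mul_zero, add_zero, mul_one, neg_add_cancel_comm, smul_eq_mul] at this
    rw [this, hG]
    simp
  have hsm : ContDiff ℝ ∞ G := by
    rw [hG2]
    refine ContDiff.mul (by fun_prop) ?_
    exact contDiff_intervalIntegral
      (f := fun p : ℝ × ℝ × E => F (-N + (p.2.1 + N) * p.1, p.2.2)) (hF.comp (by fun_prop)) 0 1
  have hder : ∀ z, fderiv ℝ G z (1, 0) = F z := by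
    rintro ⟨a, e⟩
    have h1 := hasDerivAt_fst hsm a e
    have h2 : HasDerivAt (fun u => ∫ t in (-N)..u, F (t, e)) (F (a, e)) a :=
      intervalIntegral.integral_hasDerivAt_right ((hcont e).intervalIntegrable _ _)
        ((hcont e).stronglyMeasurableAtFilter _ _) (hcont e).continuousAt
    exact h1.unique h2
  -- To the right of the support the primitive is the integral over the whole line, which vanishes
  -- by `h0`.
  have hfull : ∀ a e, N ≤ a → G (a, e) = 0 := by
    intro a e ha
    rw [← h0 e]
    refine intervalIntegral.integral_eq_integral_of_support_subset fun t ht => ?_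
    by_contra hcon
    refine ht (hzero t e ?_)
    rw [Set.mem_Ioc, not_and_or, not_lt, not_le] at hcon
    rcases hcon with h | h
    · exact hMN.trans_le (by rw [abs_of_nonpos (by linarith)]; linarith)
    · exact hMN.trans_le ((ha.trans h.le).trans (le_abs_self t))
  have hneg : ∀ a e, a ≤ -N → G (a, e) = 0 := by
    intro a e ha
    refine (intervalIntegral.integral_congr (g := fun _ => (0 : ℝ)) fun t ht => ?_).trans (by simp)
    rw [Set.uIcc_of_ge ha] at ht
    refine hzero t e (hMN.trans_le ?_)
    rw [abs_of_nonpos (by linarith [ht.2])]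
    linarith [ht.2]
  have hout : ∀ a e, e ∉ Prod.snd '' tsupport F → G (a, e) = 0 := by
    intro a e he
    refine (intervalIntegral.integral_congr (g := fun _ => (0 : ℝ)) fun t ht => ?_).trans (by simp)
    exact image_eq_zero_of_notMem_tsupport fun h => he ⟨_, h, rfl⟩
  have hK : IsCompact (Set.Icc (-N) N ×ˢ (Prod.snd '' tsupport F)) :=
    isCompact_Icc.prod (hc.isCompact.image continuous_snd)
  have hsub : tsupport G ⊆ Set.Icc (-N) N ×ˢ (Prod.snd '' tsupport F) := by
    refine closure_minimal ?_ hK.isClosed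
    rintro ⟨a, e⟩ hz
    refine ⟨⟨?_, ?_⟩, ?_⟩
    · by_contra h
      exact hz (hneg a e (not_le.1 h).le)
    · by_contra h
      exact hz (hfull a e (not_le.1 h).le)
    · by_contra h
      exact hz (hout a e h)
  exact ⟨G, hsm, hK.of_isClosed_subset isClosed_closure hsub, hder, fun z hz => (hsub hz).2⟩

end Hadamard

end SlTwo

end

noncomputable section

namespace SlTwo

open scoped ContDiff

open Filter Topology Manifold

/-! ### Cutoff functions, operators on test functions, and finite order. -/

theorem exists_cutoff {E : Type} [NormedAddCommGroup E] [NormedSpace ℝ E] [FiniteDimensional ℝ E]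
    {K O : Set E} (hK : IsCompact K) (hO : IsOpen O) (hKO : K ⊆ O) :
    ∃ χ : E → ℝ, ContDiff ℝ ∞ χ ∧ HasCompactSupport χ ∧ tsupport χ ⊆ O ∧
      (∀ᶠ x in 𝓝ˢ K, χ x = 1) ∧ ∀ x, 0 ≤ χ x := by
  obtain ⟨L, hL, hKL, hLO⟩ := exists_compact_between hK hO hKO
  obtain ⟨f, h1, h0, hf⟩ := exists_contMDiffMap_one_nhds_of_subset_interior 𝓘(ℝ, E) (n := ⊤)
    hK.isClosed hKL
  have hsub : tsupport f ⊆ L := closure_minimal (fun x hx => by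
    by_contra h
    exact hx (h0 x h)) hL.isClosed
  exact ⟨f, contMDiff_iff_contDiff.1 f.contMDiff, hL.of_isClosed_subset isClosed_closure hsub,
    hsub.trans hLO, h1, fun x => (hf x).1⟩

section TestFunctions

variable {U : Opens Sl2} {V : Type*} [NormedAddCommGroup V] [NormedSpace ℝ V]

/-- A smooth function that vanishes off a compact subset of `U`, as a test function. -/
def mkTest (f : Sl2 → ℝ) (hf : ContDiff ℝ ∞ f) {K : Set Sl2} (hK : IsCompact K)
    (hKU : K ⊆ U) (h0 : ∀ x ∉ K, f x = 0) : 𝓓(U, ℝ) :=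
  have hsub : tsupport f ⊆ K := closure_minimal (fun x hx => by
    by_contra h
    exact hx (h0 x h)) hK.isClosed
  ⟨f, hf, hK.of_isClosed_subset isClosed_closure hsub, hsub.trans hKU⟩

theorem contDiff_test (f : 𝓓(U, ℝ)) : ContDiff ℝ ∞ f := f.contDiff

theorem differentiable_test (f : 𝓓(U, ℝ)) : Differentiable ℝ f :=
  (contDiff_test f).differentiable (by simp)

/-- Multiplication of test functions by a smooth function. -/
def mulT (g : Sl2 → ℝ) (hg : ContDiff ℝ ∞ g) : Module.End ℝ 𝓓(U, ℝ) where
  toFun f := ⟨fun x => g x * f x, hg.mul (contDiff_test f), f.hasCompactSupport.mul_left,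
    (tsupport_mul_subset_right).trans f.tsupport_subset⟩
  map_add' f f' := by
    ext x
    exact mul_add _ _ _
  map_smul' c f := by
    ext x
    exact mul_left_comm _ _ _

@[simp]
theorem mulT_apply (g : Sl2 → ℝ) (hg : ContDiff ℝ ∞ g) (f : 𝓓(U, ℝ)) (x : Sl2) :
    mulT g hg f x = g x * f x := rfl

theorem mulT_pow_apply (g : Sl2 → ℝ) (hg : ContDiff ℝ ∞ g) (N : ℕ) (f : 𝓓(U, ℝ)) (x : Sl2) :
    (mulT g hg ^ N) f x = g x ^ N * f x := by
  induction N generalizing f with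
  | zero => simp
  | succ N ih => rw [pow_succ, Module.End.mul_apply, ih, mulT_apply, pow_succ, mul_assoc]

theorem tsupport_mulT_subset (g : Sl2 → ℝ) (hg : ContDiff ℝ ∞ g) (f : 𝓓(U, ℝ)) :
    tsupport (mulT g hg f) ⊆ tsupport f := tsupport_mul_subset_right

theorem tsupport_mulT_pow_subset (g : Sl2 → ℝ) (hg : ContDiff ℝ ∞ g) (N : ℕ) (f : 𝓓(U, ℝ)) :
    tsupport ((mulT g hg ^ N) f) ⊆ tsupport f := by
  induction N generalizing f with
  | zero => exact le_rfl
  | succ N ih =>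
    rw [pow_succ, Module.End.mul_apply]
    exact (ih _).trans (tsupport_mulT_subset g hg f)

/-- The derivative `∂_Z` on test functions. -/
def tder (Z : Sl2) : Module.End ℝ 𝓓(U, ℝ) :=
  (TestFunction.lineDerivCLM ℝ Z : 𝓓(U, ℝ) →L[ℝ] 𝓓(U, ℝ)).toLinearMap

theorem tder_apply (Z : Sl2) (f : 𝓓(U, ℝ)) (x : Sl2) : tder Z f x = fderiv ℝ f x Z := by
  change (TestFunction.lineDerivCLM ℝ Z f : 𝓓(U, ℝ)) x = _
  rw [TestFunction.lineDerivCLM_eq_fderivCLM, TestFunction.fderivCLM_apply_of_le _ (by simp)]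

theorem der_eq (Z : Sl2) (φ : 𝓓'(U, V)) (f : 𝓓(U, ℝ)) : der U V Z φ f = -φ (tder Z f) := rfl

theorem tsupport_tder_subset (Z : Sl2) (f : 𝓓(U, ℝ)) : tsupport (tder Z f) ⊆ tsupport f := by
  have : (tder Z f : Sl2 → ℝ) = fun x => fderiv ℝ f x Z := funext fun x => tder_apply Z f x
  rw [this]
  exact tsupport_fderiv_apply_subset ℝ Z

/-- `ℒ_Z` as a linear operator on test functions. -/
def lieT (Z : Sl2) : Module.End ℝ 𝓓(U, ℝ) where
  toFun f := lieTest Z f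
  map_add' f g := by
    ext x
    change fderiv ℝ (fun y => f y + g y) x _ = fderiv ℝ f x _ + fderiv ℝ g x _
    rw [fderiv_fun_add (differentiable_test f x) (differentiable_test g x)]
    rfl
  map_smul' c f := by
    ext x
    change fderiv ℝ (fun y => c • f y) x _ = c • fderiv ℝ f x _
    rw [fderiv_fun_const_smul (differentiable_test f x)]
    rfl

theorem lieT_apply (Z : Sl2) (f : 𝓓(U, ℝ)) (x : Sl2) : lieT Z f x = fderiv ℝ f x (-⁅Z, x⁆) := rfl

theorem tsupport_lieT_subset (Z : Sl2) (f : 𝓓(U, ℝ)) : tsupport (lieT Z f) ⊆ tsupport f := by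
  refine closure_minimal ?_ isClosed_closure
  intro x hx
  by_contra h
  refine hx ?_
  rw [lieT_apply, image_eq_zero_of_notMem_tsupport (f := fderiv ℝ f) fun h' =>
    h (tsupport_fderiv_subset ℝ h')]
  rfl

/-- A linear map that vanishes on the test functions supported in either of two open sets vanishes
on those supported in the union. -/
theorem isVanishingOn_union {W : Type*} [AddCommGroup W] [Module ℝ W] (φ : 𝓓(U, ℝ) →ₗ[ℝ] W)
    {O₁ O₂ : Set Sl2} (h1o : IsOpen O₁) (h2o : IsOpen O₂)
    (h1 : Distribution.IsVanishingOn φ O₁) (h2 : Distribution.IsVanishingOn φ O₂) :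
    Distribution.IsVanishingOn φ (O₁ ∪ O₂) := by
  intro f hf
  -- The cutoff is 1 near the part of the support not covered by `O₂`; so χf lives in `O₁` and (1 -
  -- χ)f in `O₂`.
  have hK : IsCompact (tsupport f \ O₂) := f.hasCompactSupport.isCompact.diff h2o
  obtain ⟨χ, hχ, -, hsub, hone, -⟩ := exists_cutoff hK h1o fun x hx =>
    (hf hx.1).resolve_right hx.2
  have hf2 : f = mulT χ hχ f + mulT (fun x => 1 - χ x) (contDiff_const.sub hχ) f := by
    ext x
    change f x = χ x * f x + (1 - χ x) * f x
    ring
  rw [hf2, map_add, h1, h2, add_zero]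
  · intro x hx
    have hxf := tsupport_mulT_subset _ _ _ hx
    by_contra hx2
    have := hone.filter_mono (nhds_le_nhdsSet (show x ∈ tsupport f \ O₂ from ⟨hxf, hx2⟩))
    refine absurd hx (notMem_tsupport_iff_eventuallyEq.2 ?_)
    filter_upwards [this] with y hy
    simp [hy]
  · exact (tsupport_mul_subset_left).trans hsub

/-- A distribution has finite order on a compact set. -/
theorem exists_order_bound (φ : 𝓓'(U, V)) {K : Set Sl2} (hK : IsCompact K) (hKU : K ⊆ U) :
    ∃ (N : ℕ) (C : ℝ), 0 ≤ C ∧ ∀ f : 𝓓(U, ℝ), tsupport f ⊆ K → ∀ B : ℝ, 0 ≤ B →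
      (∀ i ≤ N, ∀ x ∈ K, ‖iteratedFDeriv ℝ i f x‖ ≤ B) → ‖φ f‖ ≤ C * B := by
  set K' : Compacts Sl2 := ⟨K, hK⟩ with hK'
  have hsub : (K' : Set Sl2) ⊆ U := hKU
  set ψ : ContDiffMapSupportedIn Sl2 ℝ ⊤ K' →ₗ[ℝ] V :=
    (φ : 𝓓(U, ℝ) →ₗ[ℝ] V) ∘ₗ (TestFunction.ofSupportedInCLM ℝ hsub).toLinearMap with hψ
  have hcont : Continuous ((normSeminorm ℝ V).comp ψ) := by
    have : Continuous ψ := φ.cont.comp (TestFunction.continuous_ofSupportedIn hsub)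
    exact continuous_norm.comp this
  -- Continuity on functions supported in `K'` gives a bound by finitely many seminorms; the highest
  -- order among them serves as `N`.
  obtain ⟨s, C, -, hC⟩ := Seminorm.bound_of_continuous
    (ContDiffMapSupportedIn.withSeminorms ℝ Sl2 ℝ ⊤ K') _ hcont
  refine ⟨s.sup id, C, C.2, fun f hf B hB hbound => ?_⟩
  set f' : ContDiffMapSupportedIn Sl2 ℝ ⊤ K' :=
    ContDiffMapSupportedIn.of_support_subset f.contDiff ((subset_tsupport _).trans hf) with hf'
  have hval : ψ f' = φ f := by
    change φ _ = φ f
    congr 1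
  have h1 := hC f'
  have h2 : s.sup (ContDiffMapSupportedIn.seminorm ℝ Sl2 ℝ ⊤ K') f' ≤ B := by
    refine Seminorm.finset_sup_apply_le hB fun i hi => ?_
    rw [ContDiffMapSupportedIn.seminorm_top_le_iff ℝ hB]
    intro x hx
    exact hbound i (Finset.le_sup (f := id) hi) x hx
  rw [← hval]
  calc ‖ψ f'‖ ≤ C • s.sup (ContDiffMapSupportedIn.seminorm ℝ Sl2 ℝ ⊤ K') f' := h1
    _ ≤ C * B := by
      rw [NNReal.smul_def, smul_eq_mul]
      exact mul_le_mul_of_nonneg_left h2 C.2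

end TestFunctions

end SlTwo

end

noncomputable section

namespace SlTwo

open scoped ContDiff

open Filter Topology

/-! ### Distributions supported on the zero set of a function are killed by its powers. -/

section Order

variable {U : Opens Sl2} {V : Type*} [NormedAddCommGroup V] [NormedSpace ℝ V]

theorem exists_iteratedFDeriv_bound {E : Type} [NormedAddCommGroup E] [NormedSpace ℝ E]
    {f : E → ℝ} (hf : ContDiff ℝ ∞ f) {K : Set E} (hK : IsCompact K) (N : ℕ) :
    ∃ C : ℝ, 1 ≤ C ∧ ∀ i ≤ N, ∀ x ∈ K, ‖iteratedFDeriv ℝ i f x‖ ≤ C := by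
  have h : ∀ i : ℕ, ∃ C : ℝ, ∀ x ∈ K, ‖iteratedFDeriv ℝ i f x‖ ≤ C := fun i =>
    hK.exists_bound_of_continuousOn
      (hf.continuous_iteratedFDeriv (m := i) (by exact_mod_cast le_top)).continuousOn
  choose C hC using h
  refine ⟨1 + ∑ i ∈ Finset.range (N + 1), |C i|, ?_, fun i hi x hx => ?_⟩
  · linarith [Finset.sum_nonneg fun i (_ : i ∈ Finset.range (N + 1)) => abs_nonneg (C i)]
  · have h1 := Finset.single_le_sum (f := fun i => |C i|) (fun i _ => abs_nonneg (C i))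
      (Finset.mem_range.2 (Nat.lt_succ_of_le hi))
    have h2 := (hC i x hx).trans (le_abs_self _)
    linarith

/-- The derivatives of `x ↦ w (s g(x)) f(x)` up to order `N` grow at most like `s ^ N`. -/
theorem exists_iteratedFDeriv_scaled_bound {E : Type} [NormedAddCommGroup E] [NormedSpace ℝ E]
    {f g : E → ℝ} {w : ℝ → ℝ} (hf : ContDiff ℝ ∞ f) (hg : ContDiff ℝ ∞ g) (hw : ContDiff ℝ ∞ w)
    (hwc : HasCompactSupport w) {K : Set E} (hK : IsCompact K) (N : ℕ) :
    ∃ C : ℝ, 0 ≤ C ∧ ∀ s : ℝ, 1 ≤ s → ∀ i ≤ N, ∀ x ∈ K,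
      ‖iteratedFDeriv ℝ i (fun y => w (s * g y) * f y) x‖ ≤ C * s ^ N := by
  obtain ⟨F, hF1, hF⟩ := exists_iteratedFDeriv_bound hf hK N
  obtain ⟨D, hD1, hD⟩ := exists_iteratedFDeriv_bound hg hK N
  obtain ⟨A, hA1, hA⟩ := exists_iteratedFDeriv_bound hw hwc.isCompact N
  have hA' : ∀ i ≤ N, ∀ t, ‖iteratedFDeriv ℝ i w t‖ ≤ A := by
    intro i hi t
    by_cases ht : t ∈ tsupport w
    · exact hA i hi t ht
    · have h0 : iteratedFDeriv ℝ i w t = 0 := by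
        by_contra h
        exact ht (support_iteratedFDeriv_subset i h)
      rw [h0, norm_zero]
      linarith
  refine ⟨2 ^ N * (N.factorial * A * D ^ N * F), by positivity, fun s hs i hi x hx => ?_⟩
  have hsD : 1 ≤ s * D := one_le_mul_of_one_le_of_one_le hs hD1
  have hsg : ContDiff ℝ ∞ fun y => s * g y := contDiff_const.mul hg
  have hcomp : ∀ j ≤ N, ‖iteratedFDeriv ℝ j (fun y => w (s * g y)) x‖ ≤
      N.factorial * A * (s * D) ^ N := by
    intro j hj
    have h1 := norm_iteratedFDeriv_comp_le hw hsg (n := j) (by exact_mod_cast le_top) x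
      (C := A) (D := s * D) (fun i hi => hA' i (hi.trans hj) _) (fun i h1i hi => by
        have h2 : iteratedFDeriv ℝ i (fun y => s * g y) x = s • iteratedFDeriv ℝ i g x := by
          have := iteratedFDeriv_const_smul_apply (𝕜 := ℝ) (i := i) (a := s) (f := g) (x := x)
            (hg.contDiffAt.of_le (by exact_mod_cast le_top))
          exact this
        rw [h2, norm_smul, Real.norm_of_nonneg (by linarith)]
        calc s * ‖iteratedFDeriv ℝ i g x‖ ≤ s * D :=
              mul_le_mul_of_nonneg_left (hD i (hi.trans hj) x hx) (by linarith)
          _ = (s * D) ^ 1 := (pow_one _).symm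
          _ ≤ (s * D) ^ i := pow_le_pow_right₀ hsD h1i)
    refine h1.trans ?_
    gcongr
  have h2 := norm_iteratedFDeriv_mul_le (hw.comp hsg) hf x (n := i) (by exact_mod_cast le_top)
  refine h2.trans ?_
  calc _ ≤ ∑ j ∈ Finset.range (i + 1), (i.choose j : ℝ) *
          (N.factorial * A * (s * D) ^ N) * F := by
        refine Finset.sum_le_sum fun j hj => ?_
        have hj' : j ≤ i := Nat.lt_succ_iff.1 (Finset.mem_range.1 hj)
        refine mul_le_mul (mul_le_mul_of_nonneg_left (hcomp j (hj'.trans hi)) (by positivity))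
          (hF _ ((Nat.sub_le _ _).trans hi) x hx) (norm_nonneg _) (by positivity)
    _ = 2 ^ i * (N.factorial * A * (s * D) ^ N * F) := by
        rw [← Finset.sum_mul, ← Finset.sum_mul]
        have : ∑ j ∈ Finset.range (i + 1), (i.choose j : ℝ) = 2 ^ i := by
          exact_mod_cast Nat.sum_range_choose i
        rw [this]
        ring
    _ ≤ 2 ^ N * (N.factorial * A * (s * D) ^ N * F) := by
        gcongr
        norm_num
    _ = 2 ^ N * (N.factorial * A * D ^ N * F) * s ^ N := by
        rw [mul_pow]
        ring

/-- A distribution supported in the zero set of a smooth function `g` is locally killed by a power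
of `g`. -/
theorem exists_pow_mul_eq_zero (φ : 𝓓'(U, V)) {g : Sl2 → ℝ} (hg : ContDiff ℝ ∞ g)
    (hvan : ∀ f : 𝓓(U, ℝ), (∀ x ∈ tsupport f, g x ≠ 0) → φ f = 0)
    {K : Set Sl2} (hK : IsCompact K) (hKU : K ⊆ U) :
    ∃ N : ℕ, ∀ f : 𝓓(U, ℝ), tsupport f ⊆ K → φ ((mulT g hg ^ N) f) = 0 := by
  obtain ⟨N, C, hC0, hC⟩ := exists_order_bound φ hK hKU
  refine ⟨N + 1, fun f hf => ?_⟩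
  obtain ⟨θ, hθ, hθc, -, hθ1, -⟩ := exists_cutoff (E := ℝ) (K := {0}) (O := Set.univ)
    isCompact_singleton isOpen_univ (Set.subset_univ _)
  rw [nhdsSet_singleton] at hθ1
  -- Write g^(N+1) f as s^(-N-1) w(sg) f plus a remainder that vanishes near the zero set of g and
  -- is therefore killed. Derivatives of w(sg) f up to the order N of the distribution are O(s^N),
  -- so the value is O(1/s) for every s ≥ 1. The exponent N + 1, one more than the order, is what
  -- leaves a decaying factor.
  set w : ℝ → ℝ := fun t => t ^ (N + 1) * θ t with hw
  have hws : ContDiff ℝ ∞ w := (contDiff_id.pow _).mul hθ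
  have hwc : HasCompactSupport w := hθc.mul_left
  obtain ⟨B, hB0, hB⟩ := exists_iteratedFDeriv_scaled_bound (contDiff_test f) hg hws hwc hK N
  have key : ∀ s : ℝ, 1 ≤ s → ‖φ ((mulT g hg ^ (N + 1)) f)‖ ≤ C * B * s⁻¹ := by
    intro s hs
    have hs0 : 0 < s := by linarith
    have hsm : ContDiff ℝ ∞ fun x => w (s * g x) := hws.comp (contDiff_const.mul hg)
    have hrem : ContDiff ℝ ∞ fun x => g x ^ (N + 1) * (1 - θ (s * g x)) :=
      (hg.pow _).mul (contDiff_const.sub (hθ.comp (contDiff_const.mul hg)))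
    have hsplit : (mulT g hg ^ (N + 1)) f =
        (s⁻¹ ^ (N + 1)) • mulT _ hsm f + mulT _ hrem f := by
      ext x
      rw [mulT_pow_apply]
      change _ = s⁻¹ ^ (N + 1) * ((s * g x) ^ (N + 1) * θ (s * g x) * f x) +
        g x ^ (N + 1) * (1 - θ (s * g x)) * f x
      have : s⁻¹ ^ (N + 1) * s ^ (N + 1) = 1 := by
        rw [← mul_pow, inv_mul_cancel₀ hs0.ne', one_pow]
      rw [mul_pow]
      linear_combination (-(g x ^ (N + 1) * θ (s * g x) * f x)) * this
    rw [hsplit, map_add, hvan (mulT _ hrem f), add_zero, map_smul, norm_smul]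
    · have h1 := hC (mulT _ hsm f) ((tsupport_mulT_subset _ _ _).trans hf) (B * s ^ N)
        (by positivity) (fun i hi x hx => hB s hs i hi x hx)
      rw [Real.norm_of_nonneg (by positivity)]
      calc s⁻¹ ^ (N + 1) * ‖φ (mulT _ hsm f)‖ ≤ s⁻¹ ^ (N + 1) * (C * (B * s ^ N)) := by gcongr
        _ = C * B * s⁻¹ * (s⁻¹ * s) ^ N := by rw [mul_pow]; ring
        _ = C * B * s⁻¹ := by rw [inv_mul_cancel₀ hs0.ne', one_pow, mul_one]
    · intro x hx hgx
      refine absurd hx (notMem_tsupport_iff_eventuallyEq.2 ?_)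
      have ht : Tendsto (fun y => s * g y) (𝓝 x) (𝓝 0) := by
        have := (hg.continuous.tendsto x).const_mul s
        rwa [hgx, mul_zero] at this
      filter_upwards [ht.eventually hθ1] with y hy
      simp [hy]
  rw [← norm_le_zero_iff]
  have hlim : Tendsto (fun s : ℝ => C * B * s⁻¹) atTop (𝓝 (C * B * 0)) :=
    tendsto_inv_atTop_zero.const_mul _
  rw [mul_zero] at hlim
  exact ge_of_tendsto hlim (eventually_atTop.2 ⟨1, key⟩)

end Order

/-! ### Inner flows and averages of test functions along them. -/

section Flow

variable {U : Opens Sl2}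

/-- A one-parameter group of inner automorphisms `A t` with generator `ad Z`. -/
structure IsAdFlow (Z : Sl2) (A : ℝ → Sl2 →ₗ[ℝ] Sl2) : Prop where
  contDiff : ContDiff ℝ ∞ fun p : ℝ × Sl2 => A p.1 p.2
  hasDerivAt : ∀ t W, HasDerivAt (fun t => A t W) (A t ⁅Z, W⁆) t
  inner : ∀ t, ∃ g, ∀ W, A t W = Ad g W
  apply_neg : ∀ t W, A t (A (-t) W) = W
  zero : ∀ W, A 0 W = W

variable {Z : Sl2} {A : ℝ → Sl2 →ₗ[ℝ] Sl2}

theorem IsAdFlow.neg_apply (hA : IsAdFlow Z A) (t : ℝ) (W : Sl2) : A (-t) (A t W) = W := by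
  simpa using hA.apply_neg (-t) W

theorem IsAdFlow.mem (hA : IsAdFlow Z A) (hU : IsAdInvariant (U : Set Sl2)) (t : ℝ) {W : Sl2}
    (hW : W ∈ U) : A t W ∈ U := by
  obtain ⟨g, hg⟩ := hA.inner t
  rw [hg]
  exact hU g W hW

theorem IsAdFlow.isCompact_image (hA : IsAdFlow Z A) (T : ℝ) (f : 𝓓(U, ℝ)) :
    IsCompact ((fun p : ℝ × Sl2 => A (-p.1) p.2) '' (Set.uIcc 0 T ×ˢ tsupport f)) :=
  (isCompact_uIcc.prod f.hasCompactSupport).image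
    (hA.contDiff.continuous.comp (by fun_prop : Continuous fun p : ℝ × Sl2 => (-p.1, p.2)))

/-- The weighted average `∫₀ᵀ c(t) f(A_t W) dt` along a flow. -/
def flowAvg (hA : IsAdFlow Z A) (hU : IsAdInvariant (U : Set Sl2)) (T : ℝ) (c : ℝ → ℝ)
    (hc : ContDiff ℝ ∞ c) (f : 𝓓(U, ℝ)) : 𝓓(U, ℝ) :=
  mkTest (fun W => ∫ t in (0 : ℝ)..T, c t * f (A t W))
    (contDiff_intervalIntegral (f := fun p : ℝ × Sl2 => c p.1 * f (A p.1 p.2))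
      ((hc.comp contDiff_fst).mul ((contDiff_test f).comp hA.contDiff)) 0 T)
    (hA.isCompact_image T f)
    (by
      rintro _ ⟨p, hp, rfl⟩
      exact hA.mem hU _ (f.tsupport_subset hp.2))
    (fun W hW => by
      refine (intervalIntegral.integral_congr (g := fun _ => (0 : ℝ)) fun t ht => ?_).trans
        (by simp)
      have : f (A t W) = 0 := image_eq_zero_of_notMem_tsupport fun h =>
        hW ⟨(t, A t W), ⟨ht, h⟩, hA.neg_apply t W⟩
      simp [this])

theorem flowAvg_apply (hA : IsAdFlow Z A) (hU : IsAdInvariant (U : Set Sl2)) (T : ℝ) (c : ℝ → ℝ)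
    (hc : ContDiff ℝ ∞ c) (f : 𝓓(U, ℝ)) (W : Sl2) :
    flowAvg hA hU T c hc f W = ∫ t in (0 : ℝ)..T, c t * f (A t W) := rfl

/-- The translate of a test function along a flow. -/
def flowComp (hA : IsAdFlow Z A) (hU : IsAdInvariant (U : Set Sl2)) (T : ℝ) (f : 𝓓(U, ℝ)) :
    𝓓(U, ℝ) :=
  mkTest (fun W => f (A T W))
    ((contDiff_test f).comp (hA.contDiff.comp (contDiff_const.prodMk contDiff_id)))
    (hA.isCompact_image T f)
    (by
      rintro _ ⟨p, hp, rfl⟩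
      exact hA.mem hU _ (f.tsupport_subset hp.2))
    (fun W hW => image_eq_zero_of_notMem_tsupport fun h =>
        hW ⟨(T, A T W), ⟨Set.right_mem_uIcc, h⟩, hA.neg_apply T W⟩)

theorem flowComp_apply (hA : IsAdFlow Z A) (hU : IsAdInvariant (U : Set Sl2)) (T : ℝ)
    (f : 𝓓(U, ℝ)) (W : Sl2) : flowComp hA hU T f W = f (A T W) := rfl

/-- Integration by parts in t: applying ℒ_Z to f ∘ A_t gives minus its t-derivative. Through this
identity an invariant map is compared with its conjugates by group elements, using only the Lie
algebra action on V. -/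
theorem lieT_flowAvg (hA : IsAdFlow Z A) (hU : IsAdInvariant (U : Set Sl2)) (T : ℝ) (c : ℝ → ℝ)
    (hc : ContDiff ℝ ∞ c) (hc' : ContDiff ℝ ∞ (deriv c)) (f : 𝓓(U, ℝ)) :
    lieT Z (flowAvg hA hU T c hc f) =
      c 0 • f - c T • flowComp hA hU T f + flowAvg hA hU T (deriv c) hc' f := by
  ext W
  have hsm : ContDiff ℝ ∞ fun p : ℝ × Sl2 => c p.1 * f (A p.1 p.2) :=
    (hc.comp contDiff_fst).mul ((contDiff_test f).comp hA.contDiff)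
  have hcW : Continuous fun t => A t W :=
    hA.contDiff.continuous.comp (by fun_prop : Continuous fun t : ℝ => (t, W))
  have hcd : Continuous fun t : ℝ => A t ⁅Z, W⁆ :=
    hA.contDiff.continuous.comp (by fun_prop : Continuous fun t : ℝ => (t, ⁅Z, W⁆))
  have hdA : ∀ t (W : Sl2), HasFDerivAt (fun y => A t y) ((A t).toContinuousLinearMap) W :=
    fun t W => (A t).toContinuousLinearMap.hasFDerivAt
  have hpart : ∀ t, (fderiv ℝ (fun p : ℝ × Sl2 => c p.1 * f (A p.1 p.2)) (t, W)).comp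
      (ContinuousLinearMap.inr ℝ ℝ Sl2) =
      c t • (fderiv ℝ f (A t W)).comp (A t).toContinuousLinearMap := by
    intro t
    have h1 := ((hsm.differentiable (by simp) (t, W)).hasFDerivAt).comp W
      (hasFDerivAt_prodMk_right t W)
    have h2 := (((differentiable_test f (A t W)).hasFDerivAt).comp W (hdA t W)).const_mul (c t)
    exact h1.unique h2
  have h1 := (hasFDerivAt_intervalIntegral (hsm.of_le (by exact_mod_cast le_top)) 0 T W).fderiv
  have hF : Continuous fun t => c t • (fderiv ℝ f (A t W)).comp (A t).toContinuousLinearMap := by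
    rw [← funext hpart]
    have := (hsm.continuous_fderiv (by simp)).comp (by fun_prop : Continuous fun t : ℝ => (t, W))
    exact this.clm_comp continuous_const
  have hder : ∀ t, HasDerivAt (fun t => f (A t W)) (fderiv ℝ f (A t W) (A t ⁅Z, W⁆)) t :=
    fun t => (differentiable_test f (A t W)).hasFDerivAt.comp_hasDerivAt t (hA.hasDerivAt t W)
  have hder2 : ∀ t, HasDerivAt (fun t => c t * f (A t W))
      (deriv c t * f (A t W) + c t * fderiv ℝ f (A t W) (A t ⁅Z, W⁆)) t :=
    fun t => ((hc.differentiable (by simp) t).hasDerivAt).mul (hder t)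
  have hi1 : Continuous fun t => deriv c t * f (A t W) :=
    hc'.continuous.mul (f.continuous.comp hcW)
  have hi2 : Continuous fun t => c t * fderiv ℝ f (A t W) (A t ⁅Z, W⁆) := by
    have := ((contDiff_test f).continuous_fderiv (by simp)).comp hcW
    exact hc.continuous.mul (this.clm_apply hcd)
  have hftc := intervalIntegral.integral_eq_sub_of_hasDerivAt (a := 0) (b := T)
    (fun t _ => hder2 t) ((hi1.add hi2).intervalIntegrable _ _)
  rw [intervalIntegral.integral_add (hi1.intervalIntegrable _ _) (hi2.intervalIntegrable _ _),
    hA.zero] at hftc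
  rw [lieT_apply]
  change fderiv ℝ (fun W => ∫ t in (0 : ℝ)..T, c t * f (A t W)) W (-⁅Z, W⁆) =
    c 0 * f W - c T * f (A T W) + ∫ t in (0 : ℝ)..T, deriv c t * f (A t W)
  rw [h1]
  simp only [hpart]
  rw [ContinuousLinearMap.intervalIntegral_apply (hF.intervalIntegrable _ _)]
  have h3 : ∀ t, (c t • (fderiv ℝ f (A t W)).comp (A t).toContinuousLinearMap) (-⁅Z, W⁆) =
      -(c t * fderiv ℝ f (A t W) (A t ⁅Z, W⁆)) := by
    intro t
    rw [map_neg]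
    rfl
  simp only [h3, intervalIntegral.integral_neg]
  linarith

end Flow

end SlTwo

end

noncomputable section

namespace SlTwo

open scoped ContDiff

/-! ### Highest weight representations, their bases and their extremal covectors. -/

section Representation

theorem lie_H_X : ⁅H, X⁆ = (2 : ℝ) • X := by
  apply Subtype.ext
  rw [LieAlgebra.SpecialLinear.sl_bracket]
  ext i j
  fin_cases i <;> fin_cases j <;> simp [ofCoords, H, X]
  norm_num

theorem lie_X_Y : ⁅X, Y⁆ = H := by
  rw [← lie_skew, lie_Y_X, neg_neg]

theorem lie_H_Y : ⁅H, Y⁆ = -((2 : ℝ) • Y) := by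
  rw [← lie_skew, lie_Y_H]

theorem H_ne_zero : H ≠ 0 := by
  intro h
  have := congrArg hCoord h
  simp [H, hCoord, ofCoords] at this

theorem isSl2Triple : IsSl2Triple H X Y where
  h_ne_zero := H_ne_zero
  lie_e_f := lie_X_Y
  lie_h_e_nsmul := by rw [lie_H_X, two_smul, two_nsmul]
  lie_h_f_nsmul := by rw [lie_H_Y, two_smul, two_nsmul]

variable {M : Type*} [AddCommGroup M] [Module ℝ M] [LieRingModule Sl2 M] [LieModule ℝ Sl2 M]

theorem lie_eq_comb (Z : Sl2) (w : M) :
    ⁅Z, w⁆ = hCoord Z • ⁅H, w⁆ + xCoord Z • ⁅X, w⁆ + yCoord Z • ⁅Y, w⁆ := by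
  conv_lhs => rw [eq_comb Z]
  simp only [add_lie, smul_lie]

theorem lie_lie_X_Y (w : M) : ⁅X, ⁅Y, w⁆⁆ = ⁅Y, ⁅X, w⁆⁆ + ⁅H, w⁆ := by
  rw [leibniz_lie X, lie_X_Y, add_comm]

theorem lie_lie_X_H (w : M) : ⁅X, ⁅H, w⁆⁆ = ⁅H, ⁅X, w⁆⁆ - (2 : ℝ) • ⁅X, w⁆ := by
  rw [leibniz_lie H, lie_H_X, smul_lie]
  abel

/-- `v` generates `M` as a representation of `𝔰𝔩(2, ℝ)` of highest weight `n`. -/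
structure IsHighestWeightGenerator (n : ℕ) (v : M) : Prop where
  ne_zero : v ≠ 0
  lie_X : ⁅X, v⁆ = 0
  lie_H : ⁅H, v⁆ = (n : ℝ) • v
  pow_eq_zero : (LieModule.toEnd ℝ Sl2 M Y ^ (n + 1)) v = 0
  eq_top : ∀ N : LieSubmodule ℝ Sl2 M, v ∈ N → N = ⊤

namespace IsHighestWeightGenerator

variable {n : ℕ} {v : M} (hv : IsHighestWeightGenerator n v)

include hv

theorem primitive : IsSl2Triple.HasPrimitiveVectorWith isSl2Triple v (n : ℝ) :=
  ⟨hv.ne_zero, hv.lie_H, hv.lie_X⟩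

theorem pow_ne_zero {k : ℕ} (hk : k ≤ n) : (LieModule.toEnd ℝ Sl2 M Y ^ k) v ≠ 0 :=
  hv.primitive.pow_toEnd_f_ne_zero_of_eq_nat rfl hk

theorem pow_eq_zero_of_lt {k : ℕ} (hk : n < k) : (LieModule.toEnd ℝ Sl2 M Y ^ k) v = 0 := by
  obtain ⟨j, rfl⟩ := Nat.exists_eq_add_of_lt hk
  rw [show n + j + 1 = j + (n + 1) by ring, pow_add, Module.End.mul_apply, hv.pow_eq_zero, map_zero]

/-- The vectors Y^k v with k ≤ n are nonzero eigenvectors of H for the distinct eigenvalues n - 2k.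
-/
theorem linearIndependent :
    LinearIndependent ℝ fun k : Fin (n + 1) => (LieModule.toEnd ℝ Sl2 M Y ^ (k : ℕ)) v := by
  refine Module.End.eigenvectors_linearIndependent' (LieModule.toEnd ℝ Sl2 M H)
    (fun k : Fin (n + 1) => (n : ℝ) - 2 * (k : ℕ)) (fun a b hab => ?_) _ fun k => ?_
  · have : ((a : ℕ) : ℝ) = (b : ℕ) := by
      simp only at hab
      linarith
    exact Fin.ext (by exact_mod_cast this)
  · rw [Module.End.hasEigenvector_iff, Module.End.mem_eigenspace_iff]
    exact ⟨hv.primitive.lie_h_pow_toEnd_f k, hv.pow_ne_zero (Nat.lt_succ_iff.1 k.2)⟩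

/-- The relations of the triple make this span a subrepresentation, and it contains the generator.
-/
theorem span_eq_top :
    Submodule.span ℝ (Set.range fun k : Fin (n + 1) => (LieModule.toEnd ℝ Sl2 M Y ^ (k : ℕ)) v) =
      ⊤ := by
  set S := Submodule.span ℝ
    (Set.range fun k : Fin (n + 1) => (LieModule.toEnd ℝ Sl2 M Y ^ (k : ℕ)) v) with hS
  have hmem : ∀ k : ℕ, (LieModule.toEnd ℝ Sl2 M Y ^ k) v ∈ S := by
    intro k
    by_cases hk : k ≤ n
    · exact Submodule.subset_span ⟨⟨k, Nat.lt_succ_of_le hk⟩, rfl⟩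
    · rw [hv.pow_eq_zero_of_lt (not_le.1 hk)]
      exact S.zero_mem
  have hlie : ∀ (Z : Sl2), ∀ w ∈ S, ⁅Z, w⁆ ∈ S := by
    intro Z w hw
    induction hw using Submodule.span_induction with
    | mem w hw =>
      obtain ⟨k, rfl⟩ := hw
      rw [lie_eq_comb]
      simp only
      refine S.add_mem (S.add_mem (S.smul_mem _ ?_) (S.smul_mem _ ?_)) (S.smul_mem _ ?_)
      · rw [hv.primitive.lie_h_pow_toEnd_f]
        exact S.smul_mem _ (hmem _)
      · obtain ⟨_ | j, hj⟩ := k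
        · rw [pow_zero, Module.End.one_apply, hv.lie_X]
          exact S.zero_mem
        · rw [hv.primitive.lie_e_pow_succ_toEnd_f]
          exact S.smul_mem _ (hmem _)
      · rw [hv.primitive.lie_f_pow_toEnd_f]
        exact hmem _
    | zero => simp
    | add a b _ _ ha hb =>
      rw [lie_add]
      exact S.add_mem ha hb
    | smul c a _ ha =>
      rw [lie_smul]
      exact S.smul_mem _ ha
  have h := hv.eq_top { S with lie_mem := fun {x m} hm => hlie x m hm } (hmem 0)
  exact congrArg LieSubmodule.toSubmodule h

/-- The basis `v, Y v, …, Yⁿ v`. -/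
def basis : Module.Basis (Fin (n + 1)) ℝ M :=
  Module.Basis.mk hv.linearIndependent hv.span_eq_top.ge

theorem basis_apply (k : Fin (n + 1)) :
    hv.basis k = (LieModule.toEnd ℝ Sl2 M Y ^ (k : ℕ)) v := by
  simp [basis]

theorem lie_Y_pow (k : ℕ) : ⁅Y, (LieModule.toEnd ℝ Sl2 M Y ^ k) v⁆ =
    (LieModule.toEnd ℝ Sl2 M Y ^ (k + 1)) v := by
  rw [pow_succ', Module.End.mul_apply, LieModule.toEnd_apply_apply]

/-- Iterates X Y^(i+1) v = (i+1)(n-i) Y^i v, whose coefficient is nonzero while i < n. -/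
theorem X_pow_Y_pow {k j : ℕ} (hk : k ≤ j) (hj : j ≤ n) :
    ∃ c : ℝ, c ≠ 0 ∧ (LieModule.toEnd ℝ Sl2 M X ^ k) ((LieModule.toEnd ℝ Sl2 M Y ^ j) v) =
      c • (LieModule.toEnd ℝ Sl2 M Y ^ (j - k)) v := by
  induction k with
  | zero => exact ⟨1, one_ne_zero, by simp⟩
  | succ k ih =>
    obtain ⟨c, hc, h⟩ := ih (by omega)
    obtain ⟨i, hi⟩ : ∃ i, j - k = i + 1 := ⟨j - k - 1, by omega⟩
    refine ⟨c * (((i : ℝ) + 1) * (n - i)), ?_, ?_⟩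
    · refine mul_ne_zero hc (mul_ne_zero (by positivity) (sub_ne_zero.2 ?_))
      have : n ≠ i := by omega
      exact_mod_cast this
    · rw [pow_succ', Module.End.mul_apply, h, map_smul, hi, LieModule.toEnd_apply_apply,
        hv.primitive.lie_e_pow_succ_toEnd_f, smul_smul, show j - (k + 1) = i by omega]

theorem X_pow_Y_pow_of_lt {k j : ℕ} (hk : j < k) (hj : j ≤ n) :
    (LieModule.toEnd ℝ Sl2 M X ^ k) ((LieModule.toEnd ℝ Sl2 M Y ^ j) v) = 0 := by
  obtain ⟨i, rfl⟩ := Nat.exists_eq_add_of_lt hk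
  obtain ⟨c, -, hc⟩ := hv.X_pow_Y_pow le_rfl hj
  rw [show j + i + 1 = i + 1 + j by ring, pow_add, Module.End.mul_apply, hc, Nat.sub_self, pow_zero,
    Module.End.one_apply, pow_succ, Module.End.mul_apply, map_smul, LieModule.toEnd_apply_apply,
    hv.lie_X, smul_zero, map_zero]

/-- The covector dual to the highest weight vector. -/
def top : M →ₗ[ℝ] ℝ := hv.basis.coord 0

/-- The covector dual to the lowest weight vector. -/
def bot : M →ₗ[ℝ] ℝ := hv.basis.coord (Fin.last n)

theorem top_pow (k : ℕ) : hv.top ((LieModule.toEnd ℝ Sl2 M Y ^ k) v) = if k = 0 then 1 else 0 := by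
  by_cases hk : k ≤ n
  · have := hv.basis_apply ⟨k, Nat.lt_succ_of_le hk⟩
    simp only at this
    rw [← this, top, Module.Basis.coord_apply, Module.Basis.repr_self, Finsupp.single_apply]
    simp [Fin.ext_iff]
  · rw [hv.pow_eq_zero_of_lt (not_le.1 hk), map_zero, if_neg (by omega)]

theorem bot_pow (k : ℕ) : hv.bot ((LieModule.toEnd ℝ Sl2 M Y ^ k) v) = if k = n then 1 else 0 := by
  by_cases hk : k ≤ n
  · have := hv.basis_apply ⟨k, Nat.lt_succ_of_le hk⟩
    simp only at this
    rw [← this, bot, Module.Basis.coord_apply, Module.Basis.repr_self, Finsupp.single_apply]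
    simp [Fin.ext_iff]
  · rw [hv.pow_eq_zero_of_lt (not_le.1 hk), map_zero, if_neg (by omega)]

theorem top_self : hv.top v = 1 := by simpa using hv.top_pow 0

theorem top_lie_Y (w : M) : hv.top ⁅Y, w⁆ = 0 := by
  have : hv.top ∘ₗ LieModule.toEnd ℝ Sl2 M Y = 0 := by
    refine hv.basis.ext fun k => ?_
    rw [LinearMap.comp_apply, basis_apply, LieModule.toEnd_apply_apply, hv.lie_Y_pow, top_pow]
    simp
  exact DFunLike.congr_fun this w

theorem top_lie_H (w : M) : hv.top ⁅H, w⁆ = n * hv.top w := by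
  have : hv.top ∘ₗ LieModule.toEnd ℝ Sl2 M H = (n : ℝ) • hv.top := by
    refine hv.basis.ext fun k => ?_
    rw [LinearMap.comp_apply, basis_apply, LieModule.toEnd_apply_apply,
      hv.primitive.lie_h_pow_toEnd_f, LinearMap.smul_apply, map_smul, top_pow]
    split_ifs with h <;> simp [h]
  exact DFunLike.congr_fun this w

theorem bot_lie_X (w : M) : hv.bot ⁅X, w⁆ = 0 := by
  have : hv.bot ∘ₗ LieModule.toEnd ℝ Sl2 M X = 0 := by
    refine hv.basis.ext fun k => ?_
    rw [LinearMap.comp_apply, basis_apply, LieModule.toEnd_apply_apply]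
    obtain ⟨k, hk⟩ := k
    rcases k with _ | k
    · simp [hv.lie_X]
    · simp only
      rw [hv.primitive.lie_e_pow_succ_toEnd_f, map_smul, bot_pow, if_neg (by omega)]
      simp
  exact DFunLike.congr_fun this w

theorem top_pow_lie_H (k : ℕ) (w : M) :
    hv.top ((LieModule.toEnd ℝ Sl2 M X ^ k) ⁅H, w⁆) =
      (n - 2 * k) * hv.top ((LieModule.toEnd ℝ Sl2 M X ^ k) w) := by
  induction k generalizing w with
  | zero => simp [hv.top_lie_H]
  | succ k ih =>
    rw [pow_succ, Module.End.mul_apply, Module.End.mul_apply, LieModule.toEnd_apply_apply,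
      LieModule.toEnd_apply_apply, lie_lie_X_H, map_sub, map_sub, ih, map_smul, map_smul,
      smul_eq_mul]
    push_cast
    ring

/-- Describes the action of Y on the covectors top ∘ X^k. Together with the evident action of X, it
gives the matrix of Y - X on the dual representation, which is needed for the rotation argument in
odd weight. -/
theorem top_pow_lie_Y (k : ℕ) (w : M) :
    hv.top ((LieModule.toEnd ℝ Sl2 M X ^ (k + 1)) ⁅Y, w⁆) =
      (k + 1) * (n - k) * hv.top ((LieModule.toEnd ℝ Sl2 M X ^ k) w) := by
  induction k generalizing w with
  | zero =>
    simp [lie_lie_X_Y, hv.top_lie_Y, hv.top_lie_H]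
  | succ k ih =>
    rw [pow_succ, Module.End.mul_apply, LieModule.toEnd_apply_apply, lie_lie_X_Y, map_add, map_add,
      ih, hv.top_pow_lie_H, pow_succ, Module.End.mul_apply, LieModule.toEnd_apply_apply]
    push_cast
    ring

theorem top_pow_succ (w : M) : hv.top ((LieModule.toEnd ℝ Sl2 M X ^ (n + 1)) w) = 0 := by
  have : hv.top ∘ₗ (LieModule.toEnd ℝ Sl2 M X ^ (n + 1)) = 0 := by
    refine hv.basis.ext fun k => ?_
    rw [LinearMap.comp_apply, basis_apply,
      hv.X_pow_Y_pow_of_lt k.2 (Nat.lt_succ_iff.1 k.2), map_zero]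
    rfl
  exact DFunLike.congr_fun this w

/-- The matrix of the covectors top ∘ X^k on the basis Y^j v is diagonal with nonzero entries: for j
< k the power of X kills, and for j > k a positive power of Y remains, which `top` kills. -/
theorem eq_zero_of_top_pow {w : M}
    (h : ∀ k, hv.top ((LieModule.toEnd ℝ Sl2 M X ^ k) w) = 0) : w = 0 := by
  refine hv.basis.ext_elem fun k => ?_
  have hk := h k
  rw [← hv.basis.sum_repr w, map_sum, map_sum, Finset.sum_eq_single k] at hk
  · obtain ⟨c, hc, hX⟩ := hv.X_pow_Y_pow le_rfl (Nat.lt_succ_iff.1 k.2)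
    rw [map_smul, basis_apply, hX, Nat.sub_self, pow_zero, Module.End.one_apply, map_smul, map_smul,
      hv.top_self, smul_eq_mul, smul_eq_mul, mul_one] at hk
    rw [(mul_eq_zero.1 hk).resolve_right hc]
    simp
  · intro j _ hjk
    rw [map_smul, basis_apply, map_smul]
    rcases lt_or_gt_of_ne hjk with hlt | hlt
    · rw [hv.X_pow_Y_pow_of_lt hlt (Nat.lt_succ_iff.1 j.2), map_zero, smul_zero]
    · obtain ⟨c, hc, hX⟩ := hv.X_pow_Y_pow hlt.le (Nat.lt_succ_iff.1 j.2)
      have hlt' : (k : ℕ) < j := hlt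
      rw [hX, map_smul, top_pow, if_neg (by omega), smul_zero, smul_zero]
  · simp

/-- Here bot(Y^k Y^j v) is 1 exactly when k + j = n, so the matrix is antidiagonal. -/
theorem eq_zero_of_bot_pow {w : M}
    (h : ∀ k, hv.bot ((LieModule.toEnd ℝ Sl2 M Y ^ k) w) = 0) : w = 0 := by
  refine hv.basis.ext_elem fun k => ?_
  have hk := h (n - k)
  have hkn : (k : ℕ) ≤ n := Nat.lt_succ_iff.1 k.2
  rw [← hv.basis.sum_repr w, map_sum, map_sum, Finset.sum_eq_single k] at hk
  · rw [map_smul, basis_apply, ← Module.End.mul_apply, ← pow_add, map_smul, bot_pow,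
      if_pos (by omega), smul_eq_mul, mul_one] at hk
    rw [hk]
    simp
  · intro j _ hjk
    have : (j : ℕ) ≠ k := fun h => hjk (Fin.ext h)
    rw [map_smul, basis_apply, ← Module.End.mul_apply, ← pow_add, map_smul, bot_pow,
      if_neg (by omega), smul_zero]
  · simp

/-- Matching the bases Y^k v is equivariant because the structure constants depend only on n. -/
theorem exists_lieEquiv {M' : Type*} [AddCommGroup M'] [Module ℝ M'] [LieRingModule Sl2 M']
    [LieModule ℝ Sl2 M'] {v' : M'} (hv' : IsHighestWeightGenerator n v') :
    Nonempty (M ≃ₗ⁅ℝ, Sl2⁆ M') := by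
  set e : M ≃ₗ[ℝ] M' := hv.basis.equiv hv'.basis (Equiv.refl _) with he
  have heb : ∀ k : ℕ, e ((LieModule.toEnd ℝ Sl2 M Y ^ k) v) =
      (LieModule.toEnd ℝ Sl2 M' Y ^ k) v' := by
    intro k
    by_cases hk : k ≤ n
    · have h1 := hv.basis_apply ⟨k, Nat.lt_succ_of_le hk⟩
      have h2 := hv'.basis_apply ⟨k, Nat.lt_succ_of_le hk⟩
      simp only at h1 h2
      rw [← h1, ← h2, he, Module.Basis.equiv_apply]
      rfl
    · rw [hv.pow_eq_zero_of_lt (not_le.1 hk), hv'.pow_eq_zero_of_lt (not_le.1 hk), map_zero]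
  have hlie : ∀ (Z : Sl2) (w : M), e ⁅Z, w⁆ = ⁅Z, e w⁆ := by
    intro Z w
    have : e.toLinearMap ∘ₗ LieModule.toEnd ℝ Sl2 M Z =
        LieModule.toEnd ℝ Sl2 M' Z ∘ₗ e.toLinearMap := by
      refine hv.basis.ext fun k => ?_
      simp only [LinearMap.comp_apply, LinearEquiv.coe_coe, basis_apply,
        LieModule.toEnd_apply_apply, heb]
      rw [lie_eq_comb, lie_eq_comb Z ((LieModule.toEnd ℝ Sl2 M' Y ^ (k : ℕ)) v')]
      simp only [map_add, map_smul]
      congr 1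
      · congr 1
        · rw [hv.primitive.lie_h_pow_toEnd_f, hv'.primitive.lie_h_pow_toEnd_f, map_smul, heb]
        · rcases (k : ℕ) with _ | j
          · simp [hv.lie_X, hv'.lie_X]
          · rw [hv.primitive.lie_e_pow_succ_toEnd_f, hv'.primitive.lie_e_pow_succ_toEnd_f, map_smul,
              heb]
      · rw [hv.lie_Y_pow, hv'.lie_Y_pow, heb]
    exact DFunLike.congr_fun this w
  exact ⟨{ e with map_lie' := fun {Z w} => hlie Z w }⟩

end IsHighestWeightGenerator

theorem IsIrrepOfHighestWeight.exists_generator {n : ℕ} {V : Type*} [AddCommGroup V] [Module ℝ V]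
    [FiniteDimensional ℝ V] [LieRingModule Sl2 V] [LieModule ℝ Sl2 V]
    (hV : IsIrrepOfHighestWeight n V) : ∃ v : V, IsHighestWeightGenerator n v := by
  obtain ⟨v, h0, hX, hH⟩ := hV.exists_highest
  have hp : IsSl2Triple.HasPrimitiveVectorWith isSl2Triple v (n : ℝ) := ⟨h0, hH, hX⟩
  refine ⟨v, h0, hX, hH, hp.pow_toEnd_f_eq_zero_of_eq_nat rfl, fun N hN => ?_⟩
  have := hV.irreducible
  refine (eq_bot_or_eq_top N).resolve_left fun h => h0 ?_
  rw [h] at hN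
  simpa using hN

/-- The coefficients of `exp(t ad Y) X ^ m`, as elements of the component generated by `X ^ m`. -/
def orbitCoeff (m k : ℕ) : powComp m := ⟨(orbitPoly ^ m).coeff k, orbitPoly_pow_coeff_mem m k⟩

theorem orbitPoly_pow_coeff_zero (m : ℕ) : (orbitPoly ^ m).coeff 0 = inc X ^ m := by
  rw [Polynomial.coeff_zero_eq_eval_zero]
  simp [orbitPoly]

theorem lie_Y_orbitCoeff (m k : ℕ) :
    ⁅Y, orbitCoeff m k⁆ = ((k : ℝ) + 1) • orbitCoeff m (k + 1) := by
  apply Subtype.ext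
  change adSym Y ((orbitPoly ^ m).coeff k) = ((k : ℝ) + 1) • (orbitPoly ^ m).coeff (k + 1)
  rw [orbitPoly_pow_coeff, Polynomial.coeff_derivative, Algebra.smul_def]
  simp [mul_comm]

/-- The coefficients are Taylor coefficients of exp(t ad Y) X^m, whence the factorial. -/
theorem Y_pow_orbitCoeff (m k : ℕ) :
    (LieModule.toEnd ℝ Sl2 (powComp m) Y ^ k) (orbitCoeff m 0) =
      (k.factorial : ℝ) • orbitCoeff m k := by
  induction k with
  | zero => simp
  | succ k ih =>
    rw [pow_succ', Module.End.mul_apply, ih, map_smul, LieModule.toEnd_apply_apply,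
      lie_Y_orbitCoeff, smul_smul, Nat.factorial_succ]
    push_cast
    rw [mul_comm]

theorem inc_X_ne_zero : inc X ≠ 0 := by
  intro h
  set ℓ : Sl2 →ₗ[ℝ] ℝ :=
    { toFun := xCoord
      map_add' := fun _ _ => rfl
      map_smul' := fun _ _ => rfl } with hℓ
  have h1 := congrArg (SymmetricAlgebra.lift ℓ) h
  rw [SymmetricAlgebra.lift_ι_apply, map_zero] at h1
  change xCoord X = 0 at h1
  simp [xCoord, X, ofCoords] at h1

/-- X has weight 2, so X^m has weight 2m; and Y^(2m+1) kills it because `orbitPoly ^ m` has degree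
at most 2m in t. -/
theorem isHighestWeightGenerator_powComp (m : ℕ) :
    IsHighestWeightGenerator (2 * m) (orbitCoeff m 0) where
  ne_zero := by
    intro h
    have := congrArg (Subtype.val : powComp m → SymSl2) h
    change (orbitPoly ^ m).coeff 0 = 0 at this
    rw [orbitPoly_pow_coeff_zero] at this
    exact inc_X_ne_zero (eq_zero_of_pow_eq_zero this)
  lie_X := by
    apply Subtype.ext
    change adSym X ((orbitPoly ^ m).coeff 0) = 0
    rw [orbitPoly_pow_coeff_zero, Derivation.leibniz_pow, adSym_inc, lie_self]
    simp
  lie_H := by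
    apply Subtype.ext
    change adSym H ((orbitPoly ^ m).coeff 0) = ((2 * m : ℕ) : ℝ) • (orbitPoly ^ m).coeff 0
    rw [orbitPoly_pow_coeff_zero, Derivation.leibniz_pow, adSym_inc, lie_H_X]
    rcases m with _ | m
    · simp
    · rw [Nat.add_sub_cancel, map_smul, smul_eq_mul, mul_smul_comm, ← pow_succ,
        ← Nat.cast_smul_eq_nsmul ℝ, smul_smul]
      push_cast
      rw [mul_comm]
  pow_eq_zero := by
    rw [Y_pow_orbitCoeff]
    have : orbitCoeff m (2 * m + 1) = 0 := by
      apply Subtype.ext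
      change (orbitPoly ^ m).coeff (2 * m + 1) = 0
      refine Polynomial.coeff_eq_zero_of_natDegree_lt ?_
      have h2 : orbitPoly.natDegree ≤ 2 := by
        unfold orbitPoly
        compute_degree
      have := Polynomial.natDegree_pow_le_of_le m h2
      omega
    rw [this, smul_zero]
  eq_top := by
    intro N hN
    rw [eq_top_iff]
    have h1 : powComp m ≤ N.map (powComp m).incl := by
      refine LieSubmodule.lieSpan_le.2 ?_
      rintro _ rfl
      refine (LieSubmodule.mem_map _).2 ⟨_, hN, ?_⟩
      exact orbitPoly_pow_coeff_zero m
    intro w _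
    obtain ⟨w', hw', h⟩ := (LieSubmodule.mem_map _).1 (h1 w.2)
    have : w' = w := Subtype.ext h
    rwa [← this]

end Representation

end SlTwo

end

noncomputable section

namespace SlTwo

open scoped ContDiff

open Filter Topology

/-! ### Linear coordinates, conjugation in coordinates, and one-parameter subgroups. -/

section Coordinates

/-- The coordinate `h` as a continuous linear form. -/
def hL : Sl2 →L[ℝ] ℝ :=
  LinearMap.toContinuousLinearMap
    { toFun := hCoord, map_add' := fun _ _ => rfl, map_smul' := fun _ _ => rfl }

/-- The coordinate `x` as a continuous linear form. -/
def xL : Sl2 →L[ℝ] ℝ :=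
  LinearMap.toContinuousLinearMap
    { toFun := xCoord, map_add' := fun _ _ => rfl, map_smul' := fun _ _ => rfl }

/-- The coordinate `y` as a continuous linear form. -/
def yL : Sl2 →L[ℝ] ℝ :=
  LinearMap.toContinuousLinearMap
    { toFun := yCoord, map_add' := fun _ _ => rfl, map_smul' := fun _ _ => rfl }

theorem hL_apply (Z : Sl2) : hL Z = hCoord Z := rfl
theorem xL_apply (Z : Sl2) : xL Z = xCoord Z := rfl
theorem yL_apply (Z : Sl2) : yL Z = yCoord Z := rfl

@[simp] theorem hL_ofCoords (h x y : ℝ) : hL (ofCoords h x y) = h := rfl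
@[simp] theorem xL_ofCoords (h x y : ℝ) : xL (ofCoords h x y) = x := rfl
@[simp] theorem yL_ofCoords (h x y : ℝ) : yL (ofCoords h x y) = y := rfl

theorem eq_comb_L (Z : Sl2) : Z = hL Z • H + xL Z • X + yL Z • Y := eq_comb Z

theorem ext_L {Z W : Sl2} (h : hL Z = hL W) (x : xL Z = xL W) (y : yL Z = yL W) : Z = W := by
  rw [eq_comb_L Z, eq_comb_L W, h, x, y]

theorem ofCoords_eq (h x y : ℝ) : ofCoords h x y = h • H + x • X + y • Y := eq_comb_L _

theorem hL_lie (Z W : Sl2) : hL ⁅Z, W⁆ = xL Z * yL W - yL Z * xL W := by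
  rw [← ofCoords_coords Z, ← ofCoords_coords W, hL_apply, hCoord,
    LieAlgebra.SpecialLinear.sl_bracket]
  simp [ofCoords, Matrix.mul_apply, Fin.sum_univ_two, xL_apply, yL_apply, xCoord, yCoord]
  ring

theorem xL_lie (Z W : Sl2) : xL ⁅Z, W⁆ = 2 * (hL Z * xL W - xL Z * hL W) := by
  rw [← ofCoords_coords Z, ← ofCoords_coords W, xL_apply, xCoord,
    LieAlgebra.SpecialLinear.sl_bracket]
  simp [ofCoords, Matrix.mul_apply, Fin.sum_univ_two, xL_apply, hL_apply, xCoord, hCoord]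
  ring

theorem yL_lie (Z W : Sl2) : yL ⁅Z, W⁆ = 2 * (yL Z * hL W - hL Z * yL W) := by
  rw [← ofCoords_coords Z, ← ofCoords_coords W, yL_apply, yCoord,
    LieAlgebra.SpecialLinear.sl_bracket]
  simp [ofCoords, Matrix.mul_apply, Fin.sum_univ_two, yL_apply, hL_apply, yCoord, hCoord]
  ring

@[simp] theorem hL_H : hL H = 1 := rfl
@[simp] theorem xL_H : xL H = 0 := rfl
@[simp] theorem yL_H : yL H = 0 := rfl
@[simp] theorem hL_X : hL X = 0 := rfl
@[simp] theorem xL_X : xL X = 1 := rfl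
@[simp] theorem yL_X : yL X = 0 := rfl
@[simp] theorem hL_Y : hL Y = 0 := rfl
@[simp] theorem xL_Y : xL Y = 0 := rfl
@[simp] theorem yL_Y : yL Y = 1 := rfl

/-- The matrix `(a, b; c, d)` of determinant one. -/
def sl (a b c d : ℝ) (h : a * d - b * c = 1) : Matrix.SpecialLinearGroup (Fin 2) ℝ :=
  ⟨!![a, b; c, d], by rw [Matrix.det_fin_two_of, h]⟩

theorem coe_inv_sl (a b c d : ℝ) (hdet : a * d - b * c = 1) :
    ((sl a b c d hdet)⁻¹ : Matrix.SpecialLinearGroup (Fin 2) ℝ).1 = !![d, -b; -c, a] := by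
  rw [Matrix.SpecialLinearGroup.coe_inv, sl, Matrix.adjugate_fin_two]
  rfl

theorem Ad_sl (a b c d : ℝ) (hdet : a * d - b * c = 1) (W : Sl2) :
    Ad (sl a b c d hdet) W = ofCoords
      (a * d * hL W + b * d * yL W - a * c * xL W + b * c * hL W)
      (a ^ 2 * xL W - 2 * a * b * hL W - b ^ 2 * yL W)
      (2 * c * d * hL W + d ^ 2 * yL W - c ^ 2 * xL W) := by
  conv_lhs => rw [← ofCoords_coords W]
  apply Subtype.ext
  simp only [Ad]
  rw [coe_inv_sl]
  ext i j
  fin_cases i <;> fin_cases j <;>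
    simp [sl, ofCoords, Matrix.mul_apply, Fin.sum_univ_two, hL_apply, xL_apply, yL_apply] <;> ring

/-- Conjugation by `(a, b; c, d)` as a linear map. -/
def conj (a b c d : ℝ) : Sl2 →ₗ[ℝ] Sl2 where
  toFun W := ofCoords
      (a * d * hL W + b * d * yL W - a * c * xL W + b * c * hL W)
      (a ^ 2 * xL W - 2 * a * b * hL W - b ^ 2 * yL W)
      (2 * c * d * hL W + d ^ 2 * yL W - c ^ 2 * xL W)
  map_add' Z W := by
    apply ext_L <;> simp <;> ring
  map_smul' r W := by
    apply ext_L <;> simp <;> ring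

theorem conj_apply (a b c d : ℝ) (W : Sl2) : conj a b c d W = ofCoords
      (a * d * hL W + b * d * yL W - a * c * xL W + b * c * hL W)
      (a ^ 2 * xL W - 2 * a * b * hL W - b ^ 2 * yL W)
      (2 * c * d * hL W + d ^ 2 * yL W - c ^ 2 * xL W) := rfl

/-- A one-parameter subgroup of `SL(2, ℝ)` acts by an inner flow. -/
theorem isAdFlow_conj {Z : Sl2} {a b c d : ℝ → ℝ} (hdet : ∀ t, a t * d t - b t * c t = 1)
    (ha : ∀ t, HasDerivAt a (a t * hL Z + b t * yL Z) t)
    (hb : ∀ t, HasDerivAt b (a t * xL Z - b t * hL Z) t)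
    (hc : ∀ t, HasDerivAt c (c t * hL Z + d t * yL Z) t)
    (hd : ∀ t, HasDerivAt d (c t * xL Z - d t * hL Z) t)
    (has : ContDiff ℝ ∞ a) (hbs : ContDiff ℝ ∞ b) (hcs : ContDiff ℝ ∞ c) (hds : ContDiff ℝ ∞ d)
    (han : ∀ t, a (-t) = d t) (hbn : ∀ t, b (-t) = -b t) (hcn : ∀ t, c (-t) = -c t)
    (hdn : ∀ t, d (-t) = a t) (ha0 : a 0 = 1) (hb0 : b 0 = 0) (hc0 : c 0 = 0) (hd0 : d 0 = 1) :
    IsAdFlow Z fun t => conj (a t) (b t) (c t) (d t) where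
  contDiff := by
    simp only [conj_apply, ofCoords_eq]
    fun_prop
  -- The hypotheses `ha`, `hb`, `hc`, `hd` say that g = (a, b; c, d) satisfies g' = gZ, so g W g⁻¹
  -- has derivative g [Z, W] g⁻¹.
  hasDerivAt t W := by
    have h1 : HasDerivAt (fun t => a t * d t * hL W + b t * d t * yL W - a t * c t * xL W +
        b t * c t * hL W) _ t :=
      ((((((ha t).mul (hd t)).mul_const (hL W))).add (((hb t).mul (hd t)).mul_const (yL W))).sub
        (((ha t).mul (hc t)).mul_const (xL W))).add (((hb t).mul (hc t)).mul_const (hL W))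
    have h2 : HasDerivAt (fun t => a t ^ 2 * xL W - 2 * a t * b t * hL W - b t ^ 2 * yL W) _ t :=
      ((((ha t).pow 2).mul_const (xL W)).sub
        ((((ha t).const_mul 2).mul (hb t)).mul_const (hL W))).sub
        (((hb t).pow 2).mul_const (yL W))
    have h3 : HasDerivAt (fun t => 2 * c t * d t * hL W + d t ^ 2 * yL W - c t ^ 2 * xL W) _ t :=
      (((((hc t).const_mul 2).mul (hd t)).mul_const (hL W)).add
        (((hd t).pow 2).mul_const (yL W))).sub (((hc t).pow 2).mul_const (xL W))
    have h := ((h1.smul_const H).add (h2.smul_const X)).add (h3.smul_const Y)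
    simp only [conj_apply, ofCoords_eq]
    refine h.congr_deriv ?_
    rw [hL_lie, xL_lie, yL_lie]
    congr 1
    · congr 1
      · congr 1
        ring
      · congr 1
        simp
        ring
    · congr 1
      simp
      ring
  inner t := ⟨sl _ _ _ _ (hdet t), fun W => by rw [Ad_sl, conj_apply]⟩
  apply_neg t W := by
    have h := hdet t
    apply ext_L <;> simp only [conj_apply, hL_ofCoords, xL_ofCoords, yL_ofCoords, han, hbn, hcn, hdn]
    -- Composing with the adjugate multiplies each coordinate by det², and det² - 1 = (det - 1)(det
    -- + 1).
    · linear_combination (hL W * (a t * d t - b t * c t + 1)) * h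
    · linear_combination (xL W * (a t * d t - b t * c t + 1)) * h
    · linear_combination (yL W * (a t * d t - b t * c t + 1)) * h
  zero W := by
    apply ext_L <;> simp [conj_apply, ha0, hb0, hc0, hd0]

theorem isAdFlow_X : IsAdFlow X fun t => conj 1 t 0 1 :=
  isAdFlow_conj (a := fun _ => 1) (b := fun t => t) (c := fun _ => 0) (d := fun _ => 1)
    (by simp) (fun t => by simpa using hasDerivAt_const t (1 : ℝ))
    (fun t => by simpa using hasDerivAt_id' t) (fun t => by simpa using hasDerivAt_const t (0 : ℝ))
    (fun t => by simpa using hasDerivAt_const t (1 : ℝ)) contDiff_const contDiff_id contDiff_const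
    contDiff_const (by simp) (by simp) (by simp) (by simp) rfl rfl rfl rfl

theorem isAdFlow_rotation :
    IsAdFlow (Y - X) fun t => conj (Real.cos t) (-Real.sin t) (Real.sin t) (Real.cos t) :=
  isAdFlow_conj (a := Real.cos) (b := fun t => -Real.sin t) (c := Real.sin) (d := Real.cos)
    (fun t => by linear_combination Real.cos_sq_add_sin_sq t)
    (fun t => by simpa using Real.hasDerivAt_cos t)
    (fun t => by simpa using (Real.hasDerivAt_sin t).fun_neg)
    (fun t => by simpa using Real.hasDerivAt_sin t)
    (fun t => by simpa using Real.hasDerivAt_cos t) Real.contDiff_cos Real.contDiff_sin.neg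
    Real.contDiff_sin Real.contDiff_cos (by simp) (by simp) (by simp) (by simp) (by simp) (by simp)
    (by simp) (by simp)

end Coordinates

theorem flowAvg_eq_sub {U : Opens Sl2} {Z : Sl2} {A : ℝ → Sl2 →ₗ[ℝ] Sl2} (hA : IsAdFlow Z A)
    (hU : IsAdInvariant (U : Set Sl2)) {T : ℝ} {c c₁ c₂ : ℝ → ℝ} (hc : ContDiff ℝ ∞ c)
    (hc₁ : ContDiff ℝ ∞ c₁) (hc₂ : ContDiff ℝ ∞ c₂) {r₁ r₂ : ℝ}
    (h : ∀ t, c t = r₁ * c₁ t - r₂ * c₂ t) {f : 𝓓(U, ℝ)} :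
    flowAvg hA hU T c hc f = r₁ • flowAvg hA hU T c₁ hc₁ f - r₂ • flowAvg hA hU T c₂ hc₂ f := by
  ext W
  have hcW : Continuous fun t => f (A t W) := f.continuous.comp
    (hA.contDiff.continuous.comp (by fun_prop : Continuous fun t : ℝ => (t, W)))
  change ∫ t in (0 : ℝ)..T, c t * f (A t W) =
    r₁ * (∫ t in (0 : ℝ)..T, c₁ t * f (A t W)) - r₂ * ∫ t in (0 : ℝ)..T, c₂ t * f (A t W)
  rw [← intervalIntegral.integral_const_mul, ← intervalIntegral.integral_const_mul,
    ← intervalIntegral.integral_sub]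
  · refine intervalIntegral.integral_congr fun t _ => ?_
    simp only [h]
    ring
  · exact (continuous_const.mul (hc₁.continuous.mul hcW)).intervalIntegrable _ _
  · exact (continuous_const.mul (hc₂.continuous.mul hcW)).intervalIntegrable _ _

/-! ### Invariant maps, their extremal components, and the odd case. -/

section Invariant

variable {U : Opens Sl2} {V : Type*} [AddCommGroup V] [Module ℝ V] [LieRingModule Sl2 V]
  [LieModule ℝ Sl2 V]

/-- Local invariance of a linear map on test functions. -/
def IsInv (φ : 𝓓(U, ℝ) →ₗ[ℝ] V) : Prop := ∀ Z f, φ (lieT Z f) = ⁅Z, φ f⁆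

theorem IsInv.pow {φ : 𝓓(U, ℝ) →ₗ[ℝ] V} (hφ : IsInv φ) (Z : Sl2) (k : ℕ) (f : 𝓓(U, ℝ)) :
    φ ((lieT Z ^ k) f) = (LieModule.toEnd ℝ Sl2 V Z ^ k) (φ f) := by
  induction k with
  | zero => rfl
  | succ k ih =>
    rw [pow_succ', pow_succ', Module.End.mul_apply, hφ, ih, Module.End.mul_apply,
      LieModule.toEnd_apply_apply]

theorem tsupport_lieT_pow_subset (Z : Sl2) (k : ℕ) (f : 𝓓(U, ℝ)) :
    tsupport ((lieT Z ^ k) f) ⊆ tsupport f := by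
  induction k with
  | zero => exact le_rfl
  | succ k ih =>
    rw [pow_succ', Module.End.mul_apply]
    exact (tsupport_lieT_subset _ _).trans ih

variable {n : ℕ} {v : V}

/-- An invariant map vanishes where its component along the highest weight vector vanishes. -/
theorem IsInv.isVanishingOn_of_top {φ : 𝓓(U, ℝ) →ₗ[ℝ] V} (hφ : IsInv φ)
    (hv : IsHighestWeightGenerator n v) {O : Set Sl2}
    (h : Distribution.IsVanishingOn (hv.top ∘ₗ φ) O) : Distribution.IsVanishingOn φ O := by
  intro f hf
  refine hv.eq_zero_of_top_pow fun k => ?_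
  -- Invariance moves X^k onto the test function, and ℒ_X does not enlarge supports.
  rw [← hφ.pow]
  exact h _ ((tsupport_lieT_pow_subset _ _ _).trans hf)

theorem IsInv.isVanishingOn_of_bot {φ : 𝓓(U, ℝ) →ₗ[ℝ] V} (hφ : IsInv φ)
    (hv : IsHighestWeightGenerator n v) {O : Set Sl2}
    (h : Distribution.IsVanishingOn (hv.bot ∘ₗ φ) O) : Distribution.IsVanishingOn φ O := by
  intro f hf
  refine hv.eq_zero_of_bot_pow fun k => ?_
  rw [← hφ.pow]
  exact h _ ((tsupport_lieT_pow_subset _ _ _).trans hf)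

/-- The coefficients of the curve of highest weight covectors along the rotation group. -/
def rotCoeff (n k : ℕ) (t : ℝ) : ℝ :=
  (-1) ^ k * (Real.cos t ^ (n - k) * Real.sin t ^ k) / k.factorial

theorem contDiff_rotCoeff (n k : ℕ) : ContDiff ℝ ∞ (rotCoeff n k) := by
  unfold rotCoeff
  fun_prop

theorem deriv_rotCoeff_zero (n : ℕ) (t : ℝ) :
    deriv (rotCoeff n 0) t = n * rotCoeff n 1 t := by
  have h : rotCoeff n 0 = Real.cos ^ n := by
    funext s
    simp [rotCoeff]
  rw [h, ((Real.hasDerivAt_cos t).pow n).deriv]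
  simp [rotCoeff]
  ring

/-- With `deriv_rotCoeff_zero`, this says that λ(t) = ∑ rotCoeff n k t · (top ∘ X^k) solves λ' = λ ∘
(Y - X); thus λ(t) plays the role of top ∘ exp(t(Y - X)). -/
theorem deriv_rotCoeff_succ {n k : ℕ} (hk : k + 1 ≤ n) (t : ℝ) :
    deriv (rotCoeff n (k + 1)) t =
      ((k : ℝ) + 1 + 1) * (n - (k + 1)) * rotCoeff n (k + 2) t - rotCoeff n k t := by
  have h : HasDerivAt (rotCoeff n (k + 1)) _ t :=
    ((((Real.hasDerivAt_cos t).pow (n - (k + 1))).mul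
      ((Real.hasDerivAt_sin t).pow (k + 1))).const_mul ((-1) ^ (k + 1))).div_const
        (((k + 1).factorial : ℕ) : ℝ)
  rw [h.deriv]
  obtain ⟨j, rfl⟩ : ∃ j, n = k + 1 + j := ⟨n - (k + 1), by omega⟩
  have e1 : k + 1 + j - (k + 1) = j := by omega
  -- For j = 0 the subtraction truncates, but then the term carries the factor n - (k + 1) = 0.
  have e2 : k + 1 + j - (k + 2) = j - 1 := by omega
  have e3 : k + 1 + j - k = j + 1 := by omega
  have hf : ((k.factorial : ℕ) : ℝ) ≠ 0 := by positivity
  simp only [rotCoeff, e1, e2, e3, Nat.add_sub_cancel, Nat.factorial_succ, Nat.cast_mul,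
    Nat.cast_add, Nat.cast_one, Pi.pow_apply, Nat.cast_ofNat]
  have h1 : (k : ℝ) + 1 ≠ 0 := by positivity
  have h2 : (k : ℝ) + 2 ≠ 0 := by positivity
  have h3 : (k : ℝ) + 1 + 1 ≠ 0 := by positivity
  field_simp
  ring

/-- For odd highest weight every invariant map on an invariant open set vanishes. -/
theorem IsInv.eq_zero_of_odd {φ : 𝓓(U, ℝ) →ₗ[ℝ] V} (hφ : IsInv φ)
    (hv : IsHighestWeightGenerator n v) (hn : Odd n) (hU : IsAdInvariant (U : Set Sl2)) :
    φ = 0 := by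
  have hd : ∀ k, ContDiff ℝ ∞ (deriv (rotCoeff n k)) := fun k =>
    ((contDiff_infty_iff_deriv).1 (contDiff_rotCoeff n k)).2
  set ξ : ℕ → V →ₗ[ℝ] ℝ := fun k => hv.top ∘ₗ (LieModule.toEnd ℝ Sl2 V X ^ k) with hξ
  have hX : ∀ k w, ξ k ⁅X, w⁆ = ξ (k + 1) w := by
    intro k w
    simp only [hξ, LinearMap.comp_apply, pow_succ, Module.End.mul_apply,
      LieModule.toEnd_apply_apply]
  have hY0 : ∀ w, ξ 0 ⁅Y, w⁆ = 0 := fun w => hv.top_lie_Y w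
  have hY : ∀ k w, ξ (k + 1) ⁅Y, w⁆ = (k + 1) * (n - k) * ξ k w := fun k w => hv.top_pow_lie_Y k w
  have hlast : ∀ w, ξ (n + 1) w = 0 := fun w => hv.top_pow_succ w
  have main : ∀ f, ξ 0 (φ f) = 0 := by
    intro f
    set F : ℕ → 𝓓(U, ℝ) := fun k =>
      flowAvg isAdFlow_rotation hU Real.pi (rotCoeff n k) (contDiff_rotCoeff n k) f with hF
    set D : ℕ → 𝓓(U, ℝ) := fun k =>
      flowAvg isAdFlow_rotation hU Real.pi (deriv (rotCoeff n k)) (hd k) f with hD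
    have hD0 : D 0 = (n : ℝ) • F 1 - (0 : ℝ) • F 0 :=
      flowAvg_eq_sub _ hU _ _ _ fun t => by rw [deriv_rotCoeff_zero, zero_mul, sub_zero]
    have hDs : ∀ k, k + 1 ≤ n → D (k + 1) =
        (((k : ℝ) + 1 + 1) * (n - (k + 1))) • F (k + 2) - (1 : ℝ) • F k := fun k hk =>
      flowAvg_eq_sub _ hU _ _ _ fun t => by rw [deriv_rotCoeff_succ hk, one_mul]
    rw [zero_smul, sub_zero] at hD0
    simp only [one_smul] at hDs
    -- Rotation by π is the matrix -1, whose conjugation is trivial.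
    have hcomp : flowComp isAdFlow_rotation hU Real.pi f = f := by
      ext W
      rw [flowComp_apply]
      congr 1
      apply ext_L <;> simp [conj_apply]
    have key : ∀ k, ⁅Y, φ (F k)⁆ - ⁅X, φ (F k)⁆ =
        (rotCoeff n k 0 - rotCoeff n k Real.pi) • φ f + φ (D k) := by
      intro k
      rw [← sub_lie, ← hφ, lieT_flowAvg isAdFlow_rotation hU Real.pi _ (contDiff_rotCoeff n k)
        (hd k), hcomp, map_add, map_sub, map_smul, map_smul, sub_smul]
    have hsum : ∑ k ∈ Finset.range (n + 1), (ξ k ⁅Y, φ (F k)⁆ - ξ k ⁅X, φ (F k)⁆) =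
        ∑ k ∈ Finset.range (n + 1), ((rotCoeff n k 0 - rotCoeff n k Real.pi) * ξ k (φ f) +
          ξ k (φ (D k))) := by
      refine Finset.sum_congr rfl fun k _ => ?_
      rw [← map_sub, key, map_add, map_smul, smul_eq_mul]
    rw [Finset.sum_add_distrib, Finset.sum_range_succ' (fun k => (_ - _) * _)] at hsum
    have hb : ∀ k ∈ Finset.range n, (rotCoeff n (k + 1) 0 - rotCoeff n (k + 1) Real.pi) *
        ξ (k + 1) (φ f) = 0 := by
      intro k _
      simp [rotCoeff]
    -- This boundary value is 1 - (-1)^n, the only place where parity enters; the other coefficients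
    -- vanish at both ends because of the sine.
    have hb0 : rotCoeff n 0 0 - rotCoeff n 0 Real.pi = 2 := by
      simp [rotCoeff, hn.neg_one_pow]
      norm_num
    rw [Finset.sum_eq_zero hb, zero_add, hb0] at hsum
    -- Pairing with Y - X and differentiating the coefficients produce the same sum after
    -- reindexing, by the differential equation of the curve of covectors. Only the boundary term 2
    -- ξ₀(φ f) is left, so it is zero.
    have hL : ∑ k ∈ Finset.range (n + 1), (ξ k ⁅Y, φ (F k)⁆ - ξ k ⁅X, φ (F k)⁆) =
        ∑ k ∈ Finset.range n, (((k : ℝ) + 1) * (n - k) * ξ k (φ (F (k + 1))) -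
          ξ (k + 1) (φ (F k))) := by
      rw [Finset.sum_sub_distrib, Finset.sum_range_succ' (fun k => ξ k ⁅Y, φ (F k)⁆),
        Finset.sum_range_succ (fun k => ξ k ⁅X, φ (F k)⁆), hY0, add_zero, hX n, hlast, add_zero,
        Finset.sum_sub_distrib]
      simp only [hY, hX]
    have hR : ∑ k ∈ Finset.range (n + 1), ξ k (φ (D k)) =
        ∑ k ∈ Finset.range n, (((k : ℝ) + 1) * (n - k) * ξ k (φ (F (k + 1))) -
          ξ (k + 1) (φ (F k))) := by
      rw [Finset.sum_range_succ', hD0, Finset.sum_sub_distrib]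
      have h1 : ∀ k ∈ Finset.range n, ξ (k + 1) (φ (D (k + 1))) =
          ((k : ℝ) + 1 + 1) * (n - (k + 1)) * ξ (k + 1) (φ (F (k + 2))) -
            ξ (k + 1) (φ (F k)) := by
        intro k hk
        rw [hDs k (Finset.mem_range.1 hk), map_sub, map_sub, map_smul, map_smul, smul_eq_mul]
      rw [Finset.sum_congr rfl h1, Finset.sum_sub_distrib]
      have h2 := Finset.sum_range_succ'
        (fun k : ℕ => ((k : ℝ) + 1) * (n - k) * ξ k (φ (F (k + 1)))) n
      rw [Finset.sum_range_succ] at h2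
      simp only [Nat.cast_add, Nat.cast_one, Nat.cast_zero, sub_self, mul_zero, zero_mul, add_zero,
        zero_add, one_mul, sub_zero] at h2
      rw [h2, map_smul, map_smul, smul_eq_mul]
      ring
    rw [hL, hR] at hsum
    linarith
  ext f
  exact hφ.isVanishingOn_of_top hv (O := Set.univ) (fun f _ => main f) f (Set.subset_univ _)

end Invariant

/-- Over the circle of v(t) = (cos t, sin t), a section must be ±v(t). The sign ε(t), computed as
the scalar product with v(t), is continuous with square 1; but v(π) = -v(0) has the same image as
v(0), so ε changes sign and would vanish somewhere. -/
theorem not_exists_moment_section :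
    ¬ ∃ s : nilConePos → V1, Continuous s ∧ ∀ Z : nilConePos, moment (s Z) = Z := by
  rintro ⟨s, hs, hsec⟩
  have hmem : ∀ t : ℝ, moment ![Real.cos t, Real.sin t] ∈ nilConePos := by
    intro t
    refine ⟨?_, ?_⟩
    · simp [moment, ofCoords, hCoord, xCoord, yCoord]
      ring
    · have := Real.cos_sq_add_sin_sq t
      simp [moment, ofCoords, xCoord, yCoord]
      linarith
  set γ : ℝ → nilConePos := fun t => ⟨moment ![Real.cos t, Real.sin t], hmem t⟩ with hγ
  have hγc : Continuous γ := by
    refine Continuous.subtype_mk (continuous_moment.comp ?_) _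
    refine continuous_pi fun i => ?_
    fin_cases i
    · exact Real.continuous_cos
    · exact Real.continuous_sin
  set ε : ℝ → ℝ := fun t => s (γ t) 0 * Real.cos t + s (γ t) 1 * Real.sin t with hε
  have hεc : Continuous ε := by
    have h := hs.comp hγc
    exact (((continuous_apply 0).comp h).mul Real.continuous_cos).add
      (((continuous_apply 1).comp h).mul Real.continuous_sin)
  have hsq : ∀ t, ε t ^ 2 = 1 := by
    intro t
    have h : moment (s (γ t)) = moment ![Real.cos t, Real.sin t] := hsec (γ t)
    simp only [hε]
    generalize s (γ t) = w at h
    have h1 := congrArg hL h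
    have h2 := congrArg xL h
    have h3 := congrArg yL h
    simp only [moment, hL_ofCoords, xL_ofCoords, yL_ofCoords, Matrix.cons_val_zero,
      Matrix.cons_val_one, Matrix.cons_val_fin_one] at h1 h2 h3
    have h4 := Real.cos_sq_add_sin_sq t
    -- The three coordinates give w₀² = cos², w₁² = sin² and w₀w₁ = cos sin, whence ε² = (cos² +
    -- sin²)².
    linear_combination (2 * Real.cos t ^ 2) * h2 - (2 * Real.sin t ^ 2) * h3 -
      (4 * Real.cos t * Real.sin t) * h1 + (Real.cos t ^ 2 + Real.sin t ^ 2 + 1) * h4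
  have hγπ : γ Real.pi = γ 0 := by
    apply Subtype.ext
    apply ext_L <;> simp [hγ, moment]
  have hπ : ε Real.pi = -ε 0 := by
    simp only [hε, hγπ]
    simp
  obtain ⟨t, ht⟩ : ∃ t, ε t = 0 := by
    rcases le_total (ε 0) 0 with h | h
    · exact mem_range_of_exists_le_of_exists_ge hεc ⟨0, h⟩ ⟨Real.pi, by linarith⟩
    · exact mem_range_of_exists_le_of_exists_ge hεc ⟨Real.pi, by linarith⟩ ⟨0, h⟩
  have := hsq t
  rw [ht] at this
  norm_num at this

end SlTwo

end

noncomputable section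

namespace SlTwo

open scoped ContDiff

open Filter Topology

/-! ### Commutators and transposes of constant coefficient operators. -/

section Commutators

variable {U : Opens Sl2}

theorem fderiv_tder (Z W : Sl2) (f : 𝓓(U, ℝ)) (x : Sl2) :
    fderiv ℝ (tder Z f) x W = fderiv ℝ (fderiv ℝ f) x W Z := by
  have h : (tder Z f : Sl2 → ℝ) = fun x => fderiv ℝ f x Z := funext fun x => tder_apply Z f x
  have hd : DifferentiableAt ℝ (fderiv ℝ f) x :=
    ((contDiff_test f).fderiv_right (m := ∞) (by simp)).differentiable (by simp) x
  rw [h, fderiv_clm_apply hd (differentiableAt_const _)]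
  simp

theorem second_fderiv_comm (f : 𝓓(U, ℝ)) (x Z W : Sl2) :
    fderiv ℝ (fderiv ℝ f) x Z W = fderiv ℝ (fderiv ℝ f) x W Z :=
  ((contDiff_test f).contDiffAt.isSymmSndFDerivAt
    (by rw [minSmoothness_of_isRCLikeNormedField]; exact WithTop.coe_le_coe.2 le_top)).eq Z W

theorem tder_comm (Z W : Sl2) (f : 𝓓(U, ℝ)) : tder Z (tder W f) = tder W (tder Z f) := by
  ext x
  rw [tder_apply, tder_apply, fderiv_tder, fderiv_tder, second_fderiv_comm]

theorem tder_add (Z W : Sl2) (f : 𝓓(U, ℝ)) : tder (Z + W) f = tder Z f + tder W f := by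
  ext x
  change tder (Z + W) f x = tder Z f x + tder W f x
  simp only [tder_apply, map_add]

theorem tder_smul (c : ℝ) (Z : Sl2) (f : 𝓓(U, ℝ)) : tder (c • Z) f = c • tder Z f := by
  ext x
  change tder (c • Z) f x = c * tder Z f x
  simp only [tder_apply, map_smul, smul_eq_mul]

theorem lieT_tder (Z W : Sl2) (f : 𝓓(U, ℝ)) :
    lieT Z (tder W f) = tder W (lieT Z f) + tder ⁅Z, W⁆ f := by
  ext x
  change lieT Z (tder W f) x = tder W (lieT Z f) x + tder ⁅Z, W⁆ f x
  rw [lieT_apply, fderiv_tder, tder_apply, tder_apply]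
  have h : (lieT Z f : Sl2 → ℝ) = fun x => fderiv ℝ f x (-⁅Z, x⁆) := rfl
  have hd : DifferentiableAt ℝ (fderiv ℝ f) x :=
    ((contDiff_test f).fderiv_right (m := ∞) (by simp)).differentiable (by simp) x
  have hlin : HasFDerivAt (fun W : Sl2 => -⁅Z, W⁆)
      (-(LinearMap.toContinuousLinearMap (LieAlgebra.ad ℝ Sl2 Z : Sl2 →ₗ[ℝ] Sl2))) x :=
    (-(LinearMap.toContinuousLinearMap (LieAlgebra.ad ℝ Sl2 Z : Sl2 →ₗ[ℝ] Sl2))).hasFDerivAt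
  rw [h, (hd.hasFDerivAt.clm_apply hlin).fderiv]
  change _ = (fderiv ℝ f x (-⁅Z, W⁆) + fderiv ℝ (fderiv ℝ f) x W (-⁅Z, x⁆)) + fderiv ℝ f x ⁅Z, W⁆
  rw [second_fderiv_comm, map_neg (fderiv ℝ f x)]
  ring

/-- The transpose of a constant coefficient operator on test functions, together with the
transpose of its bracket with a linear vector field. -/
theorem exists_transpose (Z : Sl2) (D : SymSl2) : ∃ P Q : Module.End ℝ 𝓓(U, ℝ),
    (∀ (T : 𝓓'(U, ℝ)) f, symDer U ℝ D T f = T (P f)) ∧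
    (∀ (T : 𝓓'(U, ℝ)) f, symDer U ℝ (adSym Z D) T f = T (Q f)) ∧
    ∀ f, lieT Z (P f) = P (lieT Z f) + Q f := by
  induction D using SymmetricAlgebra.induction with
  | algebraMap r =>
    refine ⟨r • 1, 0, fun T f => ?_, fun T f => ?_, fun f => ?_⟩
    · rw [AlgHom.commutes]
      simp [Algebra.algebraMap_eq_smul_one]
    · simp
    · simp
  | ι W =>
    refine ⟨-tder W, -tder ⁅Z, W⁆, fun T f => ?_, fun T f => ?_, fun f => ?_⟩
    · rw [symDer_inc, der_eq]
      simp
    · rw [adSym_inc, symDer_inc, der_eq]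
      simp
    · simp only [LinearMap.neg_apply, map_neg, lieT_tder]
      abel
  | mul a b ha hb =>
    obtain ⟨Pa, Qa, h1, h2, h3⟩ := ha
    obtain ⟨Pb, Qb, k1, k2, k3⟩ := hb
    -- Transposition reverses products.
    refine ⟨Pb * Pa, Qb * Pa + Pb * Qa, fun T f => ?_, fun T f => ?_, fun f => ?_⟩
    · rw [map_mul, Module.End.mul_apply, h1, k1]
      rfl
    · rw [Derivation.leibniz, smul_eq_mul, smul_eq_mul, map_add, mul_comm b, map_mul, map_mul,
        LinearMap.add_apply, Module.End.mul_apply, Module.End.mul_apply, LinearMap.add_apply,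
        map_add]
      change symDer U ℝ a (symDer U ℝ (adSym Z b) T) f +
        symDer U ℝ (adSym Z a) (symDer U ℝ b T) f = _
      rw [h1, k2, h2, k1]
      rfl
    · simp only [Module.End.mul_apply, LinearMap.add_apply]
      rw [k3, h3, map_add]
      abel
  | add a b ha hb =>
    obtain ⟨Pa, Qa, h1, h2, h3⟩ := ha
    obtain ⟨Pb, Qb, k1, k2, k3⟩ := hb
    refine ⟨Pa + Pb, Qa + Qb, fun T f => ?_, fun T f => ?_, fun f => ?_⟩
    · rw [map_add, LinearMap.add_apply, LinearMap.add_apply, map_add]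
      change symDer U ℝ a T f + symDer U ℝ b T f = _
      rw [h1, k1]
    · rw [map_add, map_add, LinearMap.add_apply, LinearMap.add_apply, map_add]
      change symDer U ℝ (adSym Z a) T f + symDer U ℝ (adSym Z b) T f = _
      rw [h2, k2]
    · simp only [LinearMap.add_apply, map_add]
      rw [h3, k3]
      abel

end Commutators

/-! ### Monomials at the origin. -/

section PointSupport

variable {U : Opens Sl2}

/-- The coordinate forms `h, x, y`. -/
def coord : Fin 3 → Sl2 →L[ℝ] ℝ := ![hL, xL, yL]

/-- The basis `H, X, Y`. -/
def bas : Fin 3 → Sl2 := ![H, X, Y]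

theorem coord_bas (i j : Fin 3) : coord i (bas j) = if i = j then 1 else 0 := by
  fin_cases i <;> fin_cases j <;> simp [coord, bas]

theorem eq_sum_coord (Z : Sl2) : Z = ∑ i, coord i Z • bas i := by
  rw [Fin.sum_univ_three]
  exact eq_comb_L Z

/-- The basis `H, X, Y` of `𝔰𝔩(2, ℝ)`. -/
def sl2Basis : Module.Basis (Fin 3) ℝ Sl2 :=
  Module.Basis.ofEquivFun
    { toFun := fun Z i => coord i Z
      map_add' := fun Z W => by
        ext i
        simp
      map_smul' := fun c Z => by
        ext i
        simp
      invFun := fun c => ∑ i, c i • bas i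
      left_inv := fun Z => (eq_sum_coord Z).symm
      right_inv := fun c => by
        ext i
        simp [coord_bas] }

theorem sl2Basis_apply (i : Fin 3) : sl2Basis i = bas i := by
  rw [sl2Basis, Module.Basis.coe_ofEquivFun]
  simp [Function.update_apply]

/-- Multiplication of test functions by a coordinate. -/
def coordT (i : Fin 3) : Module.End ℝ 𝓓(U, ℝ) := mulT (coord i) (coord i).contDiff

theorem coordT_pow_apply (i : Fin 3) (k : ℕ) (f : 𝓓(U, ℝ)) (Z : Sl2) :
    (coordT i ^ k) f Z = coord i Z ^ k * f Z := mulT_pow_apply _ _ _ _ _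

theorem contDiff_monomial (α : Fin 3 → ℕ) :
    ContDiff ℝ ∞ fun Z : Sl2 => ∏ i, coord i Z ^ α i :=
  contDiff_prod fun i _ => (coord i).contDiff.pow _

/-- Multiplication of test functions by a monomial in the coordinates. -/
def monoT (α : Fin 3 → ℕ) : Module.End ℝ 𝓓(U, ℝ) := mulT _ (contDiff_monomial α)

theorem monoT_apply (α : Fin 3 → ℕ) (f : 𝓓(U, ℝ)) (Z : Sl2) :
    monoT α f Z = (∏ i, coord i Z ^ α i) * f Z := rfl

/-- Hadamard's lemma at the origin. -/
theorem exists_hadamard {f : Sl2 → ℝ} (hf : ContDiff ℝ ∞ f) :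
    ∃ g : Fin 3 → Sl2 → ℝ, (∀ i, ContDiff ℝ ∞ (g i)) ∧
      ∀ Z, f Z = f 0 + ∑ i, coord i Z * g i Z := by
  have hd : ContDiff ℝ ∞ (fderiv ℝ f) := hf.fderiv_right (m := ∞) (by simp)
  refine ⟨fun i Z => ∫ s in (0 : ℝ)..1, fderiv ℝ f (s • Z) (bas i), fun i => ?_, fun Z => ?_⟩
  · exact contDiff_intervalIntegral (f := fun p : ℝ × Sl2 => fderiv ℝ f (p.1 • p.2) (bas i))
      ((hd.comp (contDiff_fst.smul contDiff_snd)).clm_apply contDiff_const) 0 1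
  · have hcont : ∀ W : Sl2, Continuous fun s : ℝ => fderiv ℝ f (s • Z) W := fun W =>
      (hd.continuous.comp (by fun_prop)).clm_apply continuous_const
    have hder : ∀ s ∈ Set.uIcc (0 : ℝ) 1, HasDerivAt (fun s : ℝ => f (s • Z))
        (fderiv ℝ f (s • Z) Z) s := by
      intro s _
      have h1 : HasDerivAt (fun s : ℝ => s • Z) Z s := by
        simpa using (hasDerivAt_id' s).smul_const Z
      exact ((hf.differentiable (by simp) (s • Z)).hasFDerivAt).comp_hasDerivAt s h1
    have h := intervalIntegral.integral_eq_sub_of_hasDerivAt hder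
      ((hcont Z).intervalIntegrable _ _)
    have hsum : ∀ s : ℝ, fderiv ℝ f (s • Z) Z =
        ∑ i, coord i Z * fderiv ℝ f (s • Z) (bas i) := by
      intro s
      generalize fderiv ℝ f (s • Z) = L
      conv_lhs => rw [eq_sum_coord Z, map_sum]
      simp
    simp only [hsum] at h
    rw [intervalIntegral.integral_finsetSum fun i _ =>
      ((hcont (bas i)).const_mul _).intervalIntegrable _ _] at h
    simp only [intervalIntegral.integral_const_mul] at h
    rw [h]
    simp

variable {V : Type*} [AddCommGroup V] [Module ℝ V]

/-- A linear map on test functions that vanishes away from the origin and is killed by high powers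
of the coordinates is determined by its values on monomials. -/
theorem eq_zero_of_monoT {φ : 𝓓(U, ℝ) →ₗ[ℝ] V} (hφ : ∀ f : 𝓓(U, ℝ), 0 ∉ tsupport f → φ f = 0)
    {K : ℕ} (hK : ∀ i f, φ ((coordT i ^ K) f) = 0) {χ : 𝓓(U, ℝ)} (hχ : ∀ᶠ Z in 𝓝 0, χ Z = 1)
    (h0 : ∀ α : Fin 3 → ℕ, (∀ i, α i < K) → φ (monoT α χ) = 0) : φ = 0 := by
  have hbig : ∀ (α : Fin 3 → ℕ) (f : 𝓓(U, ℝ)) (i : Fin 3), K ≤ α i → φ (monoT α f) = 0 := by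
    intro α f i hi
    have : monoT α f = (coordT i ^ K) (monoT (Function.update α i (α i - K)) f) := by
      ext Z
      rw [coordT_pow_apply, monoT_apply, monoT_apply, ← mul_assoc]
      congr 1
      rw [← Finset.mul_prod_erase _ _ (Finset.mem_univ i),
        ← Finset.mul_prod_erase (Finset.univ) (fun j => coord j Z ^ Function.update α i (α i - K) j)
          (Finset.mem_univ i), Function.update_self, ← mul_assoc, ← pow_add,
        Nat.add_sub_cancel' hi]
      congr 1
      refine Finset.prod_congr rfl fun j hj => ?_
      rw [Function.update_of_ne (Finset.ne_of_mem_erase hj)]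
    rw [this, hK]
  -- Descending induction on the degree of the monomial, with `N` bounding the distance to 3K. Near
  -- 0, f is f(0)χ plus coordinate multiples of test functions, which raise the degree; at degree 3K
  -- some exponent reaches K.
  have main : ∀ (N : ℕ) (α : Fin 3 → ℕ), 3 * K ≤ (∑ i, α i) + N → ∀ f, φ (monoT α f) = 0 := by
    intro N
    induction N with
    | zero =>
      intro α hα f
      obtain ⟨i, hi⟩ : ∃ i, K ≤ α i := by
        by_contra hcon
        push Not at hcon
        have h1 := hcon 0
        have h2 := hcon 1
        have h3 := hcon 2
        rw [Fin.sum_univ_three] at hα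
        omega
      exact hbig α f i hi
    | succ N ih =>
      intro α hα f
      have hχα : φ (monoT α χ) = 0 := by
        by_cases h : ∀ i, α i < K
        · exact h0 α h
        · push Not at h
          obtain ⟨i, hi⟩ := h
          exact hbig α χ i hi
      obtain ⟨g, hg, hfg⟩ := exists_hadamard (contDiff_test f)
      set r : 𝓓(U, ℝ) := f - f 0 • χ - ∑ i, coordT i (mulT (g i) (hg i) χ) with hr
      have hf : f = f 0 • χ + ∑ i, coordT i (mulT (g i) (hg i) χ) + r := by
        rw [hr]
        abel
      have hr0 : ∀ᶠ Z in 𝓝 (0 : Sl2), r Z = 0 := by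
        filter_upwards [hχ] with Z hZ
        have e1 : r Z = f Z - f 0 * χ Z - ∑ i, coord i Z * (g i Z * χ Z) := by
          rw [hr, Fin.sum_univ_three, Fin.sum_univ_three]
          rfl
        rw [e1, hZ, hfg Z]
        simp
      have e2 : ∀ i, φ (monoT α (coordT i (mulT (g i) (hg i) χ))) = 0 := by
        intro i
        have : monoT α (coordT i (mulT (g i) (hg i) χ)) =
            monoT (Function.update α i (α i + 1)) (mulT (g i) (hg i) χ) := by
          ext Z
          change (∏ j, coord j Z ^ α j) * (coord i Z * _) =
            (∏ j, coord j Z ^ Function.update α i (α i + 1) j) * _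
          rw [← mul_assoc]
          congr 1
          rw [← Finset.mul_prod_erase _ _ (Finset.mem_univ i),
            ← Finset.mul_prod_erase (Finset.univ)
              (fun j => coord j Z ^ Function.update α i (α i + 1) j) (Finset.mem_univ i),
            Function.update_self, pow_succ]
          have : ∏ j ∈ Finset.univ.erase i, coord j Z ^ α j =
              ∏ j ∈ Finset.univ.erase i, coord j Z ^ Function.update α i (α i + 1) j :=
            Finset.prod_congr rfl fun j hj => by
              rw [Function.update_of_ne (Finset.ne_of_mem_erase hj)]
          rw [this]
          ring
        rw [this]
        refine ih _ ?_ _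
        rw [Finset.sum_update_of_mem (Finset.mem_univ i)]
        have := Finset.add_sum_erase Finset.univ α (Finset.mem_univ i)
        rw [Finset.sdiff_singleton_eq_erase]
        omega
      have e3 : φ (monoT α r) = 0 := by
        refine hφ _ (notMem_tsupport_iff_eventuallyEq.2 ?_)
        filter_upwards [hr0] with Z hZ
        rw [monoT_apply, hZ, mul_zero]
        rfl
      rw [hf, map_add, map_add, map_add, map_add, map_smul, map_smul, hχα, smul_zero, zero_add, e3,
        add_zero, map_sum, map_sum]
      exact Finset.sum_eq_zero fun i _ => e2 i
  ext f
  have := main (3 * K) 0 (by simp) f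
  have h1 : monoT (0 : Fin 3 → ℕ) f = f := by
    ext Z
    simp [monoT_apply]
  rwa [h1] at this

end PointSupport

end SlTwo

end

noncomputable section

namespace SlTwo

open scoped ContDiff

open Filter Topology

/-! ### The map from tensors to derivatives of the Dirac function: injectivity and equivariance. -/

section Dirac

variable {U : Opens Sl2}

/-- Exponentials are eigenfunctions of constant coefficient operators; the sign of ζ comes from
transposing derivatives. The lemma is stated for any T that acts on exponential germs by a scalar τ,
so that in the product case it applies to the functional produced by the other factor. -/
theorem symDer_apply_of_eventuallyEq_exp (ζ : Sl2 →L[ℝ] ℝ) (D : SymSl2) :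
    ∀ (T : 𝓓'(U, ℝ)) (τ : ℝ),
      (∀ (c : ℝ) (f : 𝓓(U, ℝ)), (f : Sl2 → ℝ) =ᶠ[𝓝 0] (fun Z => c * Real.exp (ζ Z)) →
        T f = c * τ) →
      ∀ (c : ℝ) (f : 𝓓(U, ℝ)), (f : Sl2 → ℝ) =ᶠ[𝓝 0] (fun Z => c * Real.exp (ζ Z)) →
        symDer U ℝ D T f = c * (SymmetricAlgebra.lift (-(ζ : Sl2 →ₗ[ℝ] ℝ)) D * τ) := by
  induction D using SymmetricAlgebra.induction with
  | algebraMap r =>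
    intro T τ hT c f hf
    rw [AlgHom.commutes, AlgHom.commutes]
    change r * T f = c * (r * τ)
    rw [hT c f hf]
    ring
  | ι W =>
    intro T τ hT c f hf
    rw [symDer_inc, der_eq, SymmetricAlgebra.lift_ι_apply, hT (c * ζ W)]
    · simp
      ring
    · filter_upwards [hf.eventuallyEq_nhds] with Z hZ
      rw [tder_apply, hZ.fderiv_eq]
      have h : HasFDerivAt (fun Z : Sl2 => c * Real.exp (ζ Z)) (c • Real.exp (ζ Z) • ζ) Z :=
        (ζ.hasFDerivAt.exp).const_mul c
      rw [h.fderiv]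
      simp
      ring
  | mul a b ha hb =>
    intro T τ hT c f hf
    rw [map_mul, Module.End.mul_apply, ha _ _ (hb T τ hT) c f hf, map_mul]
    ring
  | add a b ha hb =>
    intro T τ hT c f hf
    rw [map_add, LinearMap.add_apply]
    change symDer U ℝ a T f + symDer U ℝ b T f = _
    rw [ha T τ hT c f hf, hb T τ hT c f hf, map_add]
    ring

theorem symDer_delta_apply_of_eventuallyEq_exp (ζ : Sl2 →L[ℝ] ℝ) (D : SymSl2) (c : ℝ)
    (f : 𝓓(U, ℝ)) (hf : (f : Sl2 → ℝ) =ᶠ[𝓝 0] (fun Z => c * Real.exp (ζ Z))) :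
    symDer U ℝ D (Distribution.delta 0) f =
      c * SymmetricAlgebra.lift (-(ζ : Sl2 →ₗ[ℝ] ℝ)) D := by
  rw [symDer_apply_of_eventuallyEq_exp ζ D _ 1 (fun c f hf => ?_) c f hf, mul_one]
  have := hf.eq_of_nhds
  simp at this
  simpa using this

/-- A germ vanishing at 0 is the exponential germ with constant c = 0. -/
theorem symDer_delta_eq_zero (D : SymSl2) (f : 𝓓(U, ℝ)) (hf : 0 ∉ tsupport f) :
    symDer U ℝ D (Distribution.delta 0) f = 0 := by
  rw [symDer_delta_apply_of_eventuallyEq_exp 0 D 0 f, zero_mul]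
  filter_upwards [notMem_tsupport_iff_eventuallyEq.1 hf] with Z hZ
  rw [hZ, zero_mul]
  rfl

theorem exists_test_eventuallyEq (h0 : (0 : Sl2) ∈ U) {g : Sl2 → ℝ} (hg : ContDiff ℝ ∞ g) :
    ∃ f : 𝓓(U, ℝ), (f : Sl2 → ℝ) =ᶠ[𝓝 0] g := by
  obtain ⟨χ, hχ, hχc, hsub, h1, -⟩ := exists_cutoff (isCompact_singleton (x := (0 : Sl2))) U.isOpen
    (Set.singleton_subset_iff.2 h0)
  refine ⟨mkTest (fun Z => χ Z * g Z) (hχ.mul hg) hχc hsub fun x hx => by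
    rw [image_eq_zero_of_notMem_tsupport hx, zero_mul], ?_⟩
  rw [nhdsSet_singleton] at h1
  filter_upwards [h1] with Z hZ
  change χ Z * g Z = g Z
  rw [hZ, one_mul]

/-- Elements of the symmetric algebra are determined by their values as polynomials. -/
theorem sym_eq_zero_of_lift {D : SymSl2} (h : ∀ ζ : Sl2 →ₗ[ℝ] ℝ, SymmetricAlgebra.lift ζ D = 0) :
    D = 0 := by
  apply (SymmetricAlgebra.equivMvPolynomial sl2Basis).injective
  rw [map_zero]
  refine MvPolynomial.funext fun c => ?_
  have key : (MvPolynomial.aeval c).comp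
      (SymmetricAlgebra.equivMvPolynomial sl2Basis : SymSl2 →ₐ[ℝ] MvPolynomial (Fin 3) ℝ) =
      SymmetricAlgebra.lift (sl2Basis.constr ℝ c) := by
    apply SymmetricAlgebra.algHom_ext
    refine sl2Basis.ext fun i => ?_
    simp
  have := DFunLike.congr_fun key D
  rw [h] at this
  rw [map_zero]
  exact this

variable {V : Type*} [NormedAddCommGroup V] [NormedSpace ℝ V]

theorem diracMap_apply_of_eventuallyEq_exp (ζ : Sl2 →L[ℝ] ℝ) (ξ : V →ₗ[ℝ] ℝ) (t : V ⊗[ℝ] SymSl2)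
    (f : 𝓓(U, ℝ)) (hf : (f : Sl2 → ℝ) =ᶠ[𝓝 0] (fun Z => Real.exp (ζ Z))) :
    ξ (diracMap U V t f) = SymmetricAlgebra.lift (-(ζ : Sl2 →ₗ[ℝ] ℝ))
      (TensorProduct.lid ℝ SymSl2 (ξ.rTensor SymSl2 t)) := by
  induction t with
  | zero =>
    simp only [map_zero]
    exact map_zero ξ
  | tmul v D =>
    rw [diracMap_tmul_apply, symDer_delta_apply_of_eventuallyEq_exp ζ D 1 f (by simpa using hf)]
    simp
    ring
  | add a b ha hb =>
    simp only [map_add] at *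
    rw [← ha, ← hb]
    exact map_add ξ _ _

/-- Testing on exp(-ζ) near 0 evaluates each contraction of the tensor with a covector of V, as a
polynomial, at ζ; an element of the symmetric algebra is determined by these values. -/
theorem diracMap_injective [FiniteDimensional ℝ V] (h0 : (0 : Sl2) ∈ U) :
    Function.Injective (diracMap U V) := by
  rw [injective_iff_map_eq_zero]
  intro t ht
  have key : ∀ ξ : V →ₗ[ℝ] ℝ, TensorProduct.lid ℝ SymSl2 (ξ.rTensor SymSl2 t) = 0 := by
    intro ξ
    refine sym_eq_zero_of_lift fun ζ => ?_
    obtain ⟨f, hf⟩ := exists_test_eventuallyEq h0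
      (g := fun Z => Real.exp (-(LinearMap.toContinuousLinearMap ζ) Z))
      (by fun_prop)
    have := diracMap_apply_of_eventuallyEq_exp (-(LinearMap.toContinuousLinearMap ζ)) ξ t f hf
    rw [ht] at this
    have h2 : (-((-(LinearMap.toContinuousLinearMap ζ) : Sl2 →L[ℝ] ℝ) : Sl2 →ₗ[ℝ] ℝ)) = ζ := by
      ext Z
      simp
    rw [h2] at this
    rw [← this]
    exact map_zero ξ
  let b := Module.finBasis ℝ V
  apply (TensorProduct.equivFinsuppOfBasisLeft (N := SymSl2) b).injective
  rw [map_zero]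
  ext i
  rw [TensorProduct.equivFinsuppOfBasisLeft_apply]
  exact key (b.coord i)

theorem diracMap_eq_zero_of_notMem (t : V ⊗[ℝ] SymSl2) (f : 𝓓(U, ℝ)) (hf : 0 ∉ tsupport f) :
    diracMap U V t f = 0 := by
  induction t with
  | zero =>
    rw [map_zero]
    rfl
  | tmul v D => rw [diracMap_tmul_apply, symDer_delta_eq_zero D f hf, zero_smul]
  | add a b ha hb =>
    rw [map_add]
    change diracMap U V a f + diracMap U V b f = 0
    rw [ha, hb, add_zero]

/-- The vector field ℒ_Z vanishes at the origin, so δ₀ kills ℒ_Z(Pf); the commutator of ℒ_Z with the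
transpose P of D then produces ad Z applied to D. -/
theorem diracMap_lie [LieRingModule Sl2 V] [LieModule ℝ Sl2 V] (Z : Sl2) (t : V ⊗[ℝ] SymSl2)
    (f : 𝓓(U, ℝ)) :
    diracMap U V ⁅Z, t⁆ f = ⁅Z, diracMap U V t f⁆ - diracMap U V t (lieT Z f) := by
  induction t with
  | zero =>
    rw [lie_zero, map_zero]
    change (0 : V) = ⁅Z, (0 : V)⁆ - 0
    simp
  | tmul v D =>
    obtain ⟨P, Q, hP, hQ, hPQ⟩ := exists_transpose (U := U) Z D
    rw [TensorProduct.LieModule.lie_tmul_right, map_add]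
    change diracMap U V _ f + diracMap U V _ f = _
    simp only [diracMap_tmul_apply, lie_sym_def, hP, hQ]
    have h1 : (Distribution.delta (0 : Sl2) : 𝓓'(U, ℝ)) (P (lieT Z f)) =
        -(Distribution.delta (0 : Sl2) : 𝓓'(U, ℝ)) (Q f) := by
      have h2 : (Distribution.delta (0 : Sl2) : 𝓓'(U, ℝ)) (lieT Z (P f)) = 0 := by
        change lieT Z (P f) 0 = 0
        rw [lieT_apply, lie_zero, neg_zero, map_zero]
      rw [hPQ, map_add] at h2
      linarith
    rw [h1, lie_smul, neg_smul, sub_neg_eq_add]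
  | add a b ha hb =>
    rw [lie_add, map_add, map_add]
    change diracMap U V _ f + diracMap U V _ f = ⁅Z, diracMap U V a f + diracMap U V b f⁆ -
      (diracMap U V a (lieT Z f) + diracMap U V b (lieT Z f))
    rw [ha, hb, lie_add]
    abel

end Dirac

/-! ### Powers of the coordinates that kill derivatives of the Dirac function. -/

section PowersKill

variable {U : Opens Sl2}

/-- For j = 0 the truncated exponent is harmless, since its term has the factor j. -/
theorem tder_coordT_pow (Z : Sl2) (i : Fin 3) (j : ℕ) (f : 𝓓(U, ℝ)) :
    tder Z ((coordT i ^ j) f) = (coordT i ^ j) (tder Z f) +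
      ((j : ℝ) * coord i Z) • (coordT i ^ (j - 1)) f := by
  ext W
  change _ = (coordT i ^ j) (tder Z f) W + ((j : ℝ) * coord i Z) * (coordT i ^ (j - 1)) f W
  have h : ((coordT i ^ j) f : Sl2 → ℝ) = fun W => coord i W ^ j * f W :=
    funext fun W => coordT_pow_apply i j f W
  rw [tder_apply, coordT_pow_apply, coordT_pow_apply, tder_apply, h,
    fderiv_fun_mul (by fun_prop) (differentiable_test f W),
    (((coord i).hasFDerivAt (x := W)).pow j).fderiv]
  simp
  ring

/-- A derivative along a basis vector costs one more power of its own coordinate and none of the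
others. -/
theorem der_coordT_pow_eq_zero {T : 𝓓'(U, ℝ)} {i i' : Fin 3} {j : ℕ}
    (hT : ∀ f, T ((coordT i ^ j) f) = 0) (f : 𝓓(U, ℝ)) :
    der U ℝ (bas i') T ((coordT i ^ (j + if i = i' then 1 else 0)) f) = 0 := by
  rw [der_eq, tder_coordT_pow, coord_bas]
  split_ifs with h
  · have : (coordT i ^ (j + 1)) (tder (bas i') f) = (coordT i ^ j) (coordT i (tder (bas i') f)) := by
      rw [pow_succ, Module.End.mul_apply]
    rw [this, map_add, hT, map_smul, Nat.add_sub_cancel, hT]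
    simp
  · rw [add_zero, map_add, hT]
    simp

theorem der_pow_coordT_pow_eq_zero {T : 𝓓'(U, ℝ)} {i i' : Fin 3} {j : ℕ}
    (hT : ∀ f, T ((coordT i ^ j) f) = 0) (k : ℕ) (f : 𝓓(U, ℝ)) :
    (der U ℝ (bas i') ^ k) T ((coordT i ^ (j + if i = i' then k else 0)) f) = 0 := by
  induction k generalizing f with
  | zero => simpa using hT f
  | succ k ih =>
    rw [pow_succ', Module.End.mul_apply]
    have := der_coordT_pow_eq_zero (i' := i') ih f
    convert this using 4
    split_ifs <;> rfl

theorem symmetricAlgebra_basis_apply (s : Fin 3 →₀ ℕ) :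
    sl2Basis.symmetricAlgebra s = inc (bas 0) ^ s 0 * inc (bas 1) ^ s 1 * inc (bas 2) ^ s 2 := by
  rw [Module.Basis.symmetricAlgebra, Module.Basis.map_apply, MvPolynomial.coe_basisMonomials]
  change (SymmetricAlgebra.equivMvPolynomial sl2Basis).symm (MvPolynomial.monomial s 1) = _
  rw [MvPolynomial.monomial_eq, Finsupp.prod_fintype _ _ (by simp), Fin.prod_univ_three]
  simp [sl2Basis_apply]

theorem symDer_delta_coordT_pow_eq_zero (s : Fin 3 →₀ ℕ) (i : Fin 3) {K : ℕ} (hK : s i < K)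
    (f : 𝓓(U, ℝ)) :
    symDer U ℝ (sl2Basis.symmetricAlgebra s) (Distribution.delta 0) ((coordT i ^ K) f) = 0 := by
  have h0 : ∀ f : 𝓓(U, ℝ), (Distribution.delta (0 : Sl2) : 𝓓'(U, ℝ)) ((coordT i ^ 1) f) = 0 := by
    intro f
    change (coordT i ^ 1) f 0 = 0
    rw [coordT_pow_apply]
    simp
  have h1 := fun f => der_pow_coordT_pow_eq_zero (i' := 2) h0 (s 2) f
  have h2 := fun f => der_pow_coordT_pow_eq_zero (i' := 1) h1 (s 1) f
  have h3 := fun f => der_pow_coordT_pow_eq_zero (i' := 0) h2 (s 0) f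
  rw [symmetricAlgebra_basis_apply]
  simp only [map_mul, map_pow, symDer_inc, Module.End.mul_apply]
  have hle : 1 + (if i = 2 then s 2 else 0) + (if i = 1 then s 1 else 0) +
      (if i = 0 then s 0 else 0) ≤ K := by
    fin_cases i <;> simp at * <;> omega
  have := h3 ((coordT i ^ (K - (1 + (if i = 2 then s 2 else 0) + (if i = 1 then s 1 else 0) +
      (if i = 0 then s 0 else 0)))) f)
  rwa [← Module.End.mul_apply (coordT i ^ _) (coordT i ^ _) f, ← pow_add,
    Nat.add_sub_cancel' hle] at this

end PowersKill

/-! ### Generalized functions supported at the origin. -/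

section PointSupportSpace

variable {U : Opens Sl2} {V : Type*} [NormedAddCommGroup V] [NormedSpace ℝ V]

/-- A generalized function supported at the origin is a combination of derivatives of the Dirac
function. -/
theorem exists_diracMap_eq [FiniteDimensional ℝ V] (hU : (0 : Sl2) ∈ U) (φ : 𝓓'(U, V))
    (hφ : ∀ f : 𝓓(U, ℝ), 0 ∉ tsupport f → φ f = 0) : ∃ t, diracMap U V t = φ := by
  obtain ⟨χ, hχ⟩ := exists_test_eventuallyEq hU (g := fun _ => 1) contDiff_const
  obtain ⟨K, hK⟩ : ∃ K, ∀ i f, φ ((coordT i ^ K) f) = 0 := by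
    have h : ∀ i, ∃ N, ∀ f : 𝓓(U, ℝ), tsupport f ⊆ tsupport χ → φ ((coordT i ^ N) f) = 0 := by
      intro i
      refine exists_pow_mul_eq_zero φ (coord i).contDiff (fun f hf => hφ f fun h => ?_)
        χ.hasCompactSupport χ.tsupport_subset
      exact hf 0 h (map_zero _)
    choose N hN using h
    refine ⟨N 0 + N 1 + N 2, fun i f => ?_⟩
    -- The exponent `N i` is only valid for supports inside that of χ; the part with 1 - χ vanishes
    -- near the origin and is killed for that reason.
    have e1 : (coordT i ^ (N 0 + N 1 + N 2)) f =
        (coordT i ^ N i) (mulT χ (contDiff_test χ) ((coordT i ^ (N 0 + N 1 + N 2 - N i)) f)) +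
        mulT (fun Z => 1 - χ Z) (contDiff_const.sub (contDiff_test χ))
          ((coordT i ^ (N 0 + N 1 + N 2)) f) := by
      have hle : N i ≤ N 0 + N 1 + N 2 := by fin_cases i <;> simp <;> omega
      ext Z
      change _ = (coordT i ^ N i) _ Z + (1 - χ Z) * (coordT i ^ (N 0 + N 1 + N 2)) f Z
      simp only [coordT_pow_apply, mulT_apply]
      have : coord i Z ^ (N 0 + N 1 + N 2) =
          coord i Z ^ N i * coord i Z ^ (N 0 + N 1 + N 2 - N i) := by
        rw [← pow_add, Nat.add_sub_cancel' hle]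
      rw [this]
      ring
    rw [e1, map_add, hN, zero_add]
    · refine hφ _ (notMem_tsupport_iff_eventuallyEq.2 ?_)
      filter_upwards [hχ] with Z hZ
      change (1 - χ Z) * _ = 0
      rw [hZ]
      simp
    · exact tsupport_mul_subset_left
  let I := Fin 3 → Fin K
  let s : I → (Fin 3 →₀ ℕ) := fun α => Finsupp.equivFunOnFinite.symm fun i => (α i : ℕ)
  have hs : Function.Injective s := fun α β h => by
    have := Finsupp.equivFunOnFinite.symm.injective h
    funext i
    exact Fin.ext (congrFun this i)
  let B₀ : (I → V) →ₗ[ℝ] V ⊗[ℝ] SymSl2 :=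
    ∑ α, ((TensorProduct.mk ℝ V SymSl2).flip (sl2Basis.symmetricAlgebra (s α))) ∘ₗ
      LinearMap.proj α
  have hB₀ : ∀ c, B₀ c = ∑ α, c α ⊗ₜ[ℝ] sl2Basis.symmetricAlgebra (s α) := fun c => by
    simp [B₀]
  let A : 𝓓'(U, V) →ₗ[ℝ] (I → V) :=
    { toFun := fun ψ α => ψ (monoT (fun i => (α i : ℕ)) χ)
      map_add' := fun _ _ => rfl
      map_smul' := fun _ _ => rfl }
  have hA : ∀ ψ : 𝓓'(U, V), (∀ f : 𝓓(U, ℝ), 0 ∉ tsupport f → ψ f = 0) →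
      (∀ i f, ψ ((coordT i ^ K) f) = 0) → A ψ = 0 → ψ = 0 := by
    intro ψ h1 h2 h3
    have := eq_zero_of_monoT (φ := (ψ : 𝓓(U, ℝ) →ₗ[ℝ] V)) h1 h2 hχ fun α hα =>
      congrFun h3 (fun i => ⟨α i, hα i⟩)
    ext f
    exact DFunLike.congr_fun this f
  have hBk : ∀ c i f, diracMap U V (B₀ c) ((coordT i ^ K) f) = 0 := by
    intro c i f
    let ev : 𝓓'(U, V) →ₗ[ℝ] V :=
      { toFun := fun ψ => ψ ((coordT i ^ K) f), map_add' := fun _ _ => rfl,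
        map_smul' := fun _ _ => rfl }
    change ev (diracMap U V (B₀ c)) = 0
    rw [hB₀, map_sum, map_sum]
    refine Finset.sum_eq_zero fun α _ => ?_
    change diracMap U V (c α ⊗ₜ[ℝ] sl2Basis.symmetricAlgebra (s α)) ((coordT i ^ K) f) = 0
    rw [diracMap_tmul_apply, symDer_delta_coordT_pow_eq_zero (s α) i (α i).2, zero_smul]
  -- An injective endomorphism of the finite-dimensional space `I → V` is surjective. So some
  -- combination of derivatives of δ₀ has the same values as φ on the monomials, and no pairing of
  -- derivatives with monomials has to be computed.
  have hinj : Function.Injective (A ∘ₗ diracMap U V ∘ₗ B₀) := by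
    rw [injective_iff_map_eq_zero]
    intro c hc
    have h1 := hA _ (fun f hf => diracMap_eq_zero_of_notMem (B₀ c) f hf) (hBk c) hc
    have h2 : B₀ c = 0 := diracMap_injective hU (by rw [h1, map_zero])
    rw [hB₀] at h2
    funext α
    have h3 := congrArg (fun t => TensorProduct.equivFinsuppOfBasisRight (M := V)
      (sl2Basis.symmetricAlgebra) t (s α)) h2
    simp only [map_sum, map_zero, Finsupp.coe_finsetSum, Finset.sum_apply,
      TensorProduct.equivFinsuppOfBasisRight_apply_tmul_apply, Module.Basis.repr_self] at h3
    rw [Finset.sum_eq_single α] at h3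
    · simpa using h3
    · intro β _ hβ
      rw [Finsupp.single_eq_of_ne (fun h => hβ (hs h).symm), zero_smul]
    · simp
  obtain ⟨c, hc⟩ := (LinearMap.injective_iff_surjective.1 hinj) (A φ)
  refine ⟨B₀ c, (sub_eq_zero.1 ?_).symm⟩
  refine hA _ (fun f hf => ?_) (fun i f => ?_) ?_
  · change φ f - diracMap U V (B₀ c) f = 0
    rw [hφ f hf, diracMap_eq_zero_of_notMem _ _ hf, sub_zero]
  · change φ _ - diracMap U V (B₀ c) _ = 0
    rw [hK, hBk, sub_zero]
  · rw [map_sub, ← hc]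
    exact sub_self _

variable [LieRingModule Sl2 V] [LieModule ℝ Sl2 V]

theorem isLocallyInvariant_iff (φ : 𝓓'(U, V)) :
    IsLocallyInvariant φ ↔ IsInv (φ : 𝓓(U, ℝ) →ₗ[ℝ] V) := by
  refine forall_congr' fun Z => forall_congr' fun f => ?_
  rw [← sub_eq_add_neg, sub_eq_zero, eq_comm]
  rfl

theorem SZero_eq_bot (h0 : (0 : Sl2) ∉ U) : SZero U V = ⊥ := by
  rw [eq_bot_iff]
  rintro φ ⟨-, hφ⟩
  rw [Submodule.mem_bot]
  ext f
  exact hφ f fun x hx => ⟨f.tsupport_subset hx, fun h => h0 (by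
    rw [Set.mem_singleton_iff] at h
    rw [← h]
    exact f.tsupport_subset hx)⟩

theorem mem_SZero_iff (φ : 𝓓'(U, V)) : φ ∈ SZero U V ↔
    IsInv (φ : 𝓓(U, ℝ) →ₗ[ℝ] V) ∧ ∀ f : 𝓓(U, ℝ), 0 ∉ tsupport f → φ f = 0 := by
  change IsLocallyInvariant φ ∧ _ ↔ _
  rw [isLocallyInvariant_iff]
  refine and_congr_right fun _ => forall_congr' fun f => ?_
  refine imp_congr_left ⟨fun h h0 => (h h0).2 rfl, fun h x hx => ⟨f.tsupport_subset hx, ?_⟩⟩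
  rintro rfl
  exact h hx

/-- Equivariance and injectivity of `diracMap` identify invariance of the distribution with
invariance of the tensor; surjectivity is the structure of distributions supported at a point. -/
theorem exists_equiv_SZero [FiniteDimensional ℝ V] (h0 : (0 : Sl2) ∈ U) :
    ∃ Φ : LieModule.maxTrivSubmodule ℝ Sl2 (V ⊗[ℝ] SymSl2) ≃ₗ[ℝ] SZero U V,
      ∀ t, (Φ t : 𝓓'(U, V)) = diracMap U V t := by
  have hinv : ∀ t : V ⊗[ℝ] SymSl2, IsInv (diracMap U V t : 𝓓(U, ℝ) →ₗ[ℝ] V) ↔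
      t ∈ LieModule.maxTrivSubmodule ℝ Sl2 (V ⊗[ℝ] SymSl2) := by
    intro t
    rw [LieModule.mem_maxTrivSubmodule]
    refine forall_congr' fun Z => ⟨fun h => diracMap_injective h0 ?_, fun h f => ?_⟩
    · rw [map_zero]
      ext f
      rw [diracMap_lie]
      exact sub_eq_zero.2 (h f).symm
    · have := diracMap_lie Z t f
      rw [h, map_zero] at this
      exact (sub_eq_zero.1 this.symm).symm
  let F : LieModule.maxTrivSubmodule ℝ Sl2 (V ⊗[ℝ] SymSl2) →ₗ[ℝ] SZero U V :=
    LinearMap.codRestrict _ (diracMap U V ∘ₗ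
      (LieModule.maxTrivSubmodule ℝ Sl2 (V ⊗[ℝ] SymSl2)).toSubmodule.subtype) fun t =>
        (mem_SZero_iff _).2 ⟨(hinv _).2 t.2, fun f hf => diracMap_eq_zero_of_notMem _ f hf⟩
  refine ⟨LinearEquiv.ofBijective F ⟨fun a b hab => ?_, fun φ => ?_⟩, fun t => rfl⟩
  · exact Subtype.ext (diracMap_injective h0 (congrArg Subtype.val hab))
  · obtain ⟨h1, h2⟩ := (mem_SZero_iff _).1 φ.2
    obtain ⟨t, ht⟩ := exists_diracMap_eq h0 φ.1 h2
    rw [← ht] at h1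
    exact ⟨⟨t, (hinv t).1 h1⟩, Subtype.ext ht⟩

end PointSupportSpace

end SlTwo

end

noncomputable section

namespace SlTwo

open scoped ContDiff

open Filter Topology

/-! ### Coordinates (a, b, q) on the half space σx > 0. -/

section Slice

theorem contDiff_integral_fst {E : Type} [NormedAddCommGroup E] [NormedSpace ℝ E]
    [FiniteDimensional ℝ E] {F : ℝ × E → ℝ} (hF : ContDiff ℝ ∞ F) (hc : HasCompactSupport F) :
    ContDiff ℝ ∞ (fun e => ∫ a, F (a, e)) ∧ HasCompactSupport (fun e => ∫ a, F (a, e)) ∧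
      ∀ e ∈ tsupport (fun e => ∫ a, F (a, e)), ∃ a, (a, e) ∈ tsupport F := by
  obtain ⟨M, hM⟩ : ∃ M : ℝ, ∀ z ∈ tsupport F, |z.1| ≤ M := by
    obtain ⟨C, hC⟩ := hc.isCompact.isBounded.exists_norm_le
    exact ⟨C, fun z hz => (norm_fst_le z).trans (hC z hz)⟩
  have hzero : ∀ a e, M < |a| → F (a, e) = 0 := fun a e h =>
    image_eq_zero_of_notMem_tsupport fun h' => absurd (hM _ h') (not_le.2 h)
  set N : ℝ := |M| + 1 with hN
  have hMN : M < N := by rw [hN]; linarith [le_abs_self M]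
  have hN0 : 0 < N := by positivity
  have heq : (fun e => ∫ a, F (a, e)) = fun e => ∫ a in (-N)..N, F (a, e) := by
    funext e
    rw [intervalIntegral.integral_of_le (by linarith)]
    symm
    apply setIntegral_eq_integral_of_forall_compl_eq_zero
    intro a ha
    refine hzero a e ?_
    by_contra hcon
    push Not at hcon
    have := abs_le.1 (hcon.trans hMN.le)
    rw [Set.mem_Ioc, not_and_or] at ha
    rcases ha with ha | ha
    · have h2 : a = -N := le_antisymm (not_lt.1 ha) this.1
      rw [h2, abs_neg, abs_of_pos hN0] at hcon
      linarith
    · exact ha this.2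
  have hK : IsCompact (Prod.snd '' tsupport F) := hc.isCompact.image continuous_snd
  have hsub : ∀ e ∉ Prod.snd '' tsupport F, ∫ a, F (a, e) = 0 := by
    intro e he
    have : ∀ a, F (a, e) = 0 := fun a => image_eq_zero_of_notMem_tsupport fun h => he ⟨_, h, rfl⟩
    simp [this]
  refine ⟨?_, HasCompactSupport.intro hK hsub, fun e he => ?_⟩
  · rw [heq]
    exact contDiff_intervalIntegral hF _ _
  · have : e ∈ Prod.snd '' tsupport F := by
      refine closure_minimal (fun e he => ?_) hK.isClosed he
      by_contra hcon
      exact he (hsub e hcon)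
    obtain ⟨⟨a, e'⟩, h, rfl⟩ := this
    exact ⟨a, h⟩

/-- The invariant quadratic form `h² + xy`. -/
def quad (Z : Sl2) : ℝ := hL Z ^ 2 + xL Z * yL Z

theorem contDiff_quad : ContDiff ℝ ∞ quad := by
  unfold quad
  fun_prop

/-- Coordinates `(a, b, q)` on the half space `0 < σ x`, in which `q = h² + xy`. -/
def par (σ : ℝ) (z : ℝ × ℝ × ℝ) : Sl2 :=
  ofCoords (σ * (z.1 * Real.exp z.2.1)) (σ * Real.exp z.2.1)
    (σ * (z.2.2 * Real.exp (-z.2.1) - z.1 ^ 2 * Real.exp z.2.1))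

/-- The coordinates `(a, b, q)` of a point. -/
def parInv (σ : ℝ) (Z : Sl2) : ℝ × ℝ × ℝ := (hL Z / xL Z, Real.log (σ * xL Z), quad Z)

variable {σ : ℝ}

theorem contDiff_par : ContDiff ℝ ∞ (par σ) := by
  unfold par
  simp only [ofCoords_eq]
  fun_prop

theorem xL_par_pos (hσ : σ * σ = 1) (z : ℝ × ℝ × ℝ) : 0 < σ * xL (par σ z) := by
  rw [par, xL_ofCoords, ← mul_assoc, hσ, one_mul]
  exact Real.exp_pos _

theorem quad_par (hσ : σ * σ = 1) (z : ℝ × ℝ × ℝ) : quad (par σ z) = z.2.2 := by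
  simp only [quad, par, hL_ofCoords, xL_ofCoords, yL_ofCoords]
  have h : Real.exp z.2.1 * Real.exp (-z.2.1) = 1 := by rw [← Real.exp_add]; simp
  linear_combination (z.2.2 * (Real.exp z.2.1 * Real.exp (-z.2.1))) * hσ + z.2.2 * h

theorem parInv_par (hσ : σ * σ = 1) (z : ℝ × ℝ × ℝ) : parInv σ (par σ z) = z := by
  have hσ0 : σ ≠ 0 := left_ne_zero_of_mul (hσ.trans_ne one_ne_zero)
  refine Prod.ext ?_ (Prod.ext ?_ (quad_par hσ z))
  · simp only [parInv, par, hL_ofCoords, xL_ofCoords]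
    have := Real.exp_ne_zero z.2.1
    field_simp
  · simp only [parInv, par, xL_ofCoords]
    rw [← mul_assoc, hσ, one_mul, Real.log_exp]

theorem par_parInv (hσ : σ * σ = 1) {Z : Sl2} (hZ : 0 < σ * xL Z) : par σ (parInv σ Z) = Z := by
  have hx : xL Z ≠ 0 := right_ne_zero_of_mul hZ.ne'
  have hσ0 : σ ≠ 0 := left_ne_zero_of_mul hZ.ne'
  have hs : σ⁻¹ = σ := inv_eq_of_mul_eq_one_left hσ
  have hs2 : σ ^ 2 = 1 := by rw [sq, hσ]
  apply ext_L
  · simp only [parInv, par, hL_ofCoords, Real.exp_log hZ]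
    field_simp
    linear_combination hL Z * hs2
  · simp only [parInv, par, xL_ofCoords, Real.exp_log hZ]
    linear_combination xL Z * hσ
  · simp only [parInv, par, yL_ofCoords, Real.exp_neg, Real.exp_log hZ, quad]
    field_simp
    linear_combination (-hL Z ^ 2) * hs2

theorem contDiffAt_parInv {Z : Sl2} (hZ : 0 < σ * xL Z) : ContDiffAt ℝ ∞ (parInv σ) Z := by
  have hx : xL Z ≠ 0 := right_ne_zero_of_mul hZ.ne'
  unfold parInv
  exact (hL.contDiff.contDiffAt.div xL.contDiff.contDiffAt hx).prodMk
    (((contDiffAt_const.mul xL.contDiff.contDiffAt).log hZ.ne').prodMk contDiff_quad.contDiffAt)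

theorem isOpen_halfSpace : IsOpen {Z : Sl2 | 0 < σ * xL Z} :=
  isOpen_lt continuous_const (by fun_prop)

variable {U : Opens Sl2}

/-- Points of the half space with the same q are conjugate under explicit lower triangular matrices,
so membership in an invariant set depends on q only. This permits reshaping test functions freely in
a and b. -/
theorem par_mem_iff (hU : IsAdInvariant (U : Set Sl2)) (z : ℝ × ℝ × ℝ) :
    par σ z ∈ U ↔ par σ (0, 0, z.2.2) ∈ U := by
  obtain ⟨a, b, q⟩ := z
  have h2 : Real.exp b = Real.exp (b / 2) ^ 2 := by rw [← Real.exp_nat_mul]; congr 1; ring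
  have h3 : Real.exp (-b) = Real.exp (-(b / 2)) ^ 2 := by
    rw [← Real.exp_nat_mul]; congr 1; push_cast; ring
  have h4 : Real.exp (b / 2) * Real.exp (-(b / 2)) = 1 := by rw [← Real.exp_add]; simp
  have hd1 : Real.exp (b / 2) * Real.exp (-(b / 2)) - 0 * (-a * Real.exp (b / 2)) = 1 := by
    rw [h4]; ring
  have hd2 : Real.exp (-(b / 2)) * Real.exp (b / 2) - 0 * (a * Real.exp (b / 2)) = 1 := by
    rw [mul_comm, h4]; ring
  constructor
  · intro h
    have := hU (sl _ _ _ _ hd2) _ h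
    rw [Ad_sl] at this
    refine Eq.subst (motive := fun W => W ∈ (U : Set Sl2)) ?_ this
    simp only [par, hL_ofCoords, xL_ofCoords, yL_ofCoords, h2, h3]
    generalize Real.exp (b / 2) = s at *
    generalize Real.exp (-(b / 2)) = t at *
    apply ext_L <;> simp only [hL_ofCoords, xL_ofCoords, yL_ofCoords, zero_div, neg_zero,
      Real.exp_zero]
    · ring
    · linear_combination (σ * (s * t + 1)) * h4
    · linear_combination (σ * q * (s * t + 1)) * h4
  · intro h
    have := hU (sl _ _ _ _ hd1) _ h
    rw [Ad_sl] at this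
    refine Eq.subst (motive := fun W => W ∈ (U : Set Sl2)) ?_ this
    simp only [par, hL_ofCoords, xL_ofCoords, yL_ofCoords, h2, h3]
    generalize Real.exp (b / 2) = s at *
    generalize Real.exp (-(b / 2)) = t at *
    apply ext_L <;> simp only [hL_ofCoords, xL_ofCoords, yL_ofCoords, zero_div, neg_zero,
      Real.exp_zero] <;> ring

/-- The purpose of the coordinates: moving a is the flow of -ad Y, so ℒ_Y becomes ∂_a. In the same
way ℒ_H becomes -2∂_b + 2a∂_a in `fderiv_comp_par_snd`. -/
theorem fderiv_comp_par_fst {f : Sl2 → ℝ} (hf : Differentiable ℝ f) (z : ℝ × ℝ × ℝ) :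
    fderiv ℝ (fun z => f (par σ z)) z (1, 0) = fderiv ℝ f (par σ z) (-⁅Y, par σ z⁆) := by
  have hp : HasFDerivAt (par σ) (fderiv ℝ (par σ) z) z :=
    (contDiff_par.differentiable (by simp) z).hasFDerivAt
  have h1 : fderiv ℝ (fun z => f (par σ z)) z = (fderiv ℝ f (par σ z)).comp (fderiv ℝ (par σ) z) :=
    ((hf _).hasFDerivAt.comp z hp).fderiv
  rw [h1, ContinuousLinearMap.comp_apply]
  congr 1
  obtain ⟨a, b, q⟩ := z
  have hline : HasDerivAt (fun t : ℝ => ((t, b, q) : ℝ × ℝ × ℝ)) (1, 0) a :=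
    (hasDerivAt_id' a).prodMk (hasDerivAt_const a (b, q))
  have h2 := hp.comp_hasDerivAt a hline
  refine h2.unique ?_
  have e1 : HasDerivAt (fun t : ℝ => σ * (t * Real.exp b)) (σ * (1 * Real.exp b)) a :=
    ((hasDerivAt_id' a).mul_const _).const_mul _
  have e3 : HasDerivAt (fun t : ℝ => σ * (q * Real.exp (-b) - t ^ 2 * Real.exp b))
      (σ * (-((2 : ℕ) * a ^ (2 - 1) * 1 * Real.exp b))) a :=
    ((((hasDerivAt_id' a).pow 2).mul_const _).const_sub _).const_mul _
  have := ((e1.smul_const H).add ((hasDerivAt_const a (σ * Real.exp b)).smul_const X)).add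
    (e3.smul_const Y)
  have hfun : (par σ ∘ fun t : ℝ => ((t, b, q) : ℝ × ℝ × ℝ)) = fun t : ℝ =>
      (σ * (t * Real.exp b)) • H + (σ * Real.exp b) • X +
        (σ * (q * Real.exp (-b) - t ^ 2 * Real.exp b)) • Y := by
    funext t
    simp only [Function.comp_apply, par, ofCoords_eq]
  rw [hfun]
  refine this.congr_deriv ?_
  apply ext_L <;> simp [hL_lie, xL_lie, yL_lie, par]
  ring

theorem fderiv_comp_par_snd {f : Sl2 → ℝ} (hf : Differentiable ℝ f) (z : ℝ × ℝ × ℝ) :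
    fderiv ℝ f (par σ z) (-⁅H, par σ z⁆) = -2 * fderiv ℝ (fun z => f (par σ z)) z (0, 1, 0) +
      2 * z.1 * fderiv ℝ (fun z => f (par σ z)) z (1, 0) := by
  rw [fderiv_comp_par_fst hf]
  have hp : HasFDerivAt (par σ) (fderiv ℝ (par σ) z) z :=
    (contDiff_par.differentiable (by simp) z).hasFDerivAt
  have h1 : fderiv ℝ (fun z => f (par σ z)) z = (fderiv ℝ f (par σ z)).comp (fderiv ℝ (par σ) z) :=
    ((hf _).hasFDerivAt.comp z hp).fderiv
  rw [h1, ContinuousLinearMap.comp_apply]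
  obtain ⟨a, b, q⟩ := z
  have hline : HasDerivAt (fun t : ℝ => ((a, t, q) : ℝ × ℝ × ℝ)) (0, 1, 0) b :=
    (hasDerivAt_const b a).prodMk ((hasDerivAt_id' b).prodMk (hasDerivAt_const b q))
  have h2 := hp.comp_hasDerivAt b hline
  have e0 := Real.hasDerivAt_exp b
  have e0' : HasDerivAt (fun t : ℝ => Real.exp (-t)) (Real.exp (-b) * -1) b :=
    (hasDerivAt_neg b).exp
  have := (((((e0.const_mul a).const_mul σ).smul_const H).add ((e0.const_mul σ).smul_const X)).add
    ((((e0'.const_mul q).sub (e0.const_mul (a ^ 2))).const_mul σ).smul_const Y))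
  have hfun : (par σ ∘ fun t : ℝ => ((a, t, q) : ℝ × ℝ × ℝ)) = fun t : ℝ =>
      (σ * (a * Real.exp t)) • H + (σ * Real.exp t) • X +
        (σ * (q * Real.exp (-t) - a ^ 2 * Real.exp t)) • Y := by
    funext t
    simp only [Function.comp_apply, par, ofCoords_eq]
  rw [hfun] at h2
  rw [h2.unique this, ← smul_eq_mul, ← smul_eq_mul (2 * a), ← map_smul, ← map_smul, ← map_add]
  congr 1
  apply ext_L <;> simp [hL_lie, xL_lie, yL_lie, par] <;> ring

variable (σ U) in
/-- Smooth compactly supported functions of the coordinates `(a, b, q)` that correspond to test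
functions on `U`. -/
structure IsSliceTest (F : ℝ × ℝ × ℝ → ℝ) : Prop where
  contDiff : ContDiff ℝ ∞ F
  hasCompactSupport : HasCompactSupport F
  mem : ∀ z ∈ tsupport F, par σ z ∈ U

/-- The test function with a given expression in the coordinates `(a, b, q)`. -/
def pull (hσ : σ * σ = 1) {F : ℝ × ℝ × ℝ → ℝ} (hF : IsSliceTest σ U F) : 𝓓(U, ℝ) :=
  have hK : IsCompact (par σ '' tsupport F) :=
    hF.hasCompactSupport.isCompact.image contDiff_par.continuous
  have h0 : ∀ Z ∉ par σ '' tsupport F, (if 0 < σ * xL Z then F (parInv σ Z) else 0) = 0 := by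
    intro Z hZ
    split_ifs with h
    · exact image_eq_zero_of_notMem_tsupport fun h' => hZ ⟨_, h', par_parInv hσ h⟩
    · rfl
  mkTest (fun Z => if 0 < σ * xL Z then F (parInv σ Z) else 0)
    (by
      rw [contDiff_iff_contDiffAt]
      intro Z
      by_cases hZ : 0 < σ * xL Z
      · refine (hF.contDiff.contDiffAt.comp Z (contDiffAt_parInv hZ)).congr_of_eventuallyEq ?_
        filter_upwards [isOpen_halfSpace.mem_nhds hZ] with W hW
        exact if_pos hW
      -- The image of the support is compact and inside the open half space, so the extension by
      -- zero vanishes near every point outside it.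
      · have hZK : Z ∉ par σ '' tsupport F := by
          rintro ⟨z, -, rfl⟩
          exact hZ (xL_par_pos hσ z)
        refine (contDiffAt_const (c := (0 : ℝ))).congr_of_eventuallyEq ?_
        filter_upwards [hK.isClosed.isOpen_compl.mem_nhds hZK] with W hW
        exact h0 W hW)
    hK (by
      rintro _ ⟨z, hz, rfl⟩
      exact hF.mem z hz) h0

theorem pull_par (hσ : σ * σ = 1) {F : ℝ × ℝ × ℝ → ℝ} (hF : IsSliceTest σ U F) (z : ℝ × ℝ × ℝ) :
    pull hσ hF (par σ z) = F z := by
  change (if 0 < σ * xL (par σ z) then F (parInv σ (par σ z)) else 0) = F z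
  rw [if_pos (xL_par_pos hσ z), parInv_par hσ]

theorem tsupport_pull_subset (hσ : σ * σ = 1) {F : ℝ × ℝ × ℝ → ℝ} (hF : IsSliceTest σ U F) :
    tsupport (pull hσ hF) ⊆ par σ '' tsupport F := by
  refine closure_minimal (fun Z hZ => ?_)
    (hF.hasCompactSupport.isCompact.image contDiff_par.continuous).isClosed
  by_contra h
  refine hZ ?_
  change (if 0 < σ * xL Z then F (parInv σ Z) else 0) = 0
  split_ifs with h'
  · exact image_eq_zero_of_notMem_tsupport fun h'' => h ⟨_, h'', par_parInv hσ h'⟩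
  · rfl

theorem tsupport_pull_subset_halfSpace (hσ : σ * σ = 1) {F : ℝ × ℝ × ℝ → ℝ}
    (hF : IsSliceTest σ U F) : tsupport (pull hσ hF) ⊆ {Z | 0 < σ * xL Z} := by
  refine (tsupport_pull_subset hσ hF).trans ?_
  rintro _ ⟨z, -, rfl⟩
  exact xL_par_pos hσ z

theorem isSliceTest_comp_par (hσ : σ * σ = 1) (f : 𝓓(U, ℝ))
    (hf : tsupport f ⊆ {Z | 0 < σ * xL Z}) : IsSliceTest σ U fun z => f (par σ z) where
  contDiff := (contDiff_test f).comp contDiff_par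
  hasCompactSupport := by
    refine HasCompactSupport.intro (K := parInv σ '' tsupport f) (f.hasCompactSupport.isCompact.image_of_continuousOn
      fun Z hZ => (contDiffAt_parInv (hf hZ)).continuousAt.continuousWithinAt) fun z hz => ?_
    exact image_eq_zero_of_notMem_tsupport fun h => hz ⟨_, h, parInv_par hσ z⟩
  mem z hz := f.tsupport_subset
    (tsupport_comp_subset_preimage f contDiff_par.continuous hz)

theorem isSliceTest_mul (hU : IsAdInvariant (U : Set Sl2)) {α : ℝ → ℝ} {K : ℝ × ℝ → ℝ}
    (hα : ContDiff ℝ ∞ α) (hαc : HasCompactSupport α) (hK : ContDiff ℝ ∞ K)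
    (hKc : HasCompactSupport K) (hKU : ∀ e ∈ tsupport K, par σ (0, 0, e.2) ∈ U) :
    IsSliceTest σ U fun z => α z.1 * K z.2 := by
  have h0 : ∀ z ∉ tsupport α ×ˢ tsupport K, α z.1 * K z.2 = 0 := by
    intro z hz
    rw [Set.mem_prod, not_and_or] at hz
    rcases hz with h | h
    · rw [image_eq_zero_of_notMem_tsupport h, zero_mul]
    · rw [image_eq_zero_of_notMem_tsupport h, mul_zero]
  refine ⟨(hα.comp contDiff_fst).mul (hK.comp contDiff_snd),
    HasCompactSupport.intro (hαc.isCompact.prod hKc.isCompact) h0, fun z hz => ?_⟩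
  have : z ∈ tsupport α ×ˢ tsupport K := by
    refine closure_minimal (fun z hz => ?_)
      ((isClosed_tsupport α).prod (isClosed_tsupport K)) hz
    by_contra h
    exact hz (h0 z h)
  rw [par_mem_iff hU]
  exact hKU _ this.2

theorem lieT_Y_par (f : 𝓓(U, ℝ)) (z : ℝ × ℝ × ℝ) :
    lieT Y f (par σ z) = fderiv ℝ (fun z => f (par σ z)) z (1, 0) := by
  rw [lieT_apply, fderiv_comp_par_fst (differentiable_test f)]

theorem lieT_H_par (f : 𝓓(U, ℝ)) (z : ℝ × ℝ × ℝ) :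
    lieT H f (par σ z) = -2 * fderiv ℝ (fun z => f (par σ z)) z (0, 1, 0) +
      2 * z.1 * fderiv ℝ (fun z => f (par σ z)) z (1, 0) := by
  rw [lieT_apply, fderiv_comp_par_snd (differentiable_test f)]

end Slice

end SlTwo

end

noncomputable section

namespace SlTwo

open scoped ContDiff

open Filter Topology

/-! ### Reduction of highest weight functionals to the single variable q. -/

section Reduction

theorem exists_bump : ∃ ρ : ℝ → ℝ, ContDiff ℝ ∞ ρ ∧ HasCompactSupport ρ ∧ ∫ t, ρ t = 1 := by
  let b : ContDiffBump (0 : ℝ) := ⟨1, 2, one_pos, one_lt_two⟩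
  exact ⟨b.normed volume, b.contDiff_normed, b.hasCompactSupport_normed, b.integral_normed⟩

/-- A bump function of integral one. -/
def bump : ℝ → ℝ := exists_bump.choose

theorem contDiff_bump : ContDiff ℝ ∞ bump := exists_bump.choose_spec.1

theorem hasCompactSupport_bump : HasCompactSupport bump := exists_bump.choose_spec.2.1

theorem integrable_bump : Integrable bump :=
  contDiff_bump.continuous.integrable_of_hasCompactSupport hasCompactSupport_bump

theorem integral_bump : ∫ t, bump t = 1 := exists_bump.choose_spec.2.2

variable {σ : ℝ} {U : Opens Sl2} {m : ℕ}

variable (σ U) in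
/-- Test functions of the coordinate `q`. -/
structure IsRadialTest (g : ℝ → ℝ) : Prop where
  contDiff : ContDiff ℝ ∞ g
  hasCompactSupport : HasCompactSupport g
  mem : ∀ q ∈ tsupport g, par σ (0, 0, q) ∈ U

/-- The lift of a function of `q` to a function of `(a, b, q)`, normalized by the weight
`exp ((m + 1) b)`. -/
def lift (m : ℕ) (g : ℝ → ℝ) (z : ℝ × ℝ × ℝ) : ℝ :=
  bump z.1 * (Real.exp (-(m + 1) * z.2.1) * bump z.2.1 * g z.2.2)

theorem tsupport_lift_subset (g : ℝ → ℝ) :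
    tsupport (lift m g) ⊆ tsupport bump ×ˢ tsupport bump ×ˢ tsupport g := by
  refine closure_minimal (fun z hz => ?_) ((isClosed_tsupport _).prod
    ((isClosed_tsupport _).prod (isClosed_tsupport _)))
  rw [Function.mem_support, lift] at hz
  have h1 := left_ne_zero_of_mul hz
  have h2 := right_ne_zero_of_mul hz
  exact ⟨subset_closure h1, subset_closure (right_ne_zero_of_mul (left_ne_zero_of_mul h2)),
    subset_closure (right_ne_zero_of_mul h2)⟩

theorem isSliceTest_lift (hU : IsAdInvariant (U : Set Sl2)) {g : ℝ → ℝ}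
    (hg : IsRadialTest σ U g) : IsSliceTest σ U (lift m g) where
  contDiff := by
    have h1 := contDiff_bump
    have h2 := hg.contDiff
    unfold lift
    fun_prop
  hasCompactSupport := (hasCompactSupport_bump.isCompact.prod
    (hasCompactSupport_bump.isCompact.prod hg.hasCompactSupport.isCompact)).of_isClosed_subset
      isClosed_closure (tsupport_lift_subset g)
  mem z hz := by
    rw [par_mem_iff hU]
    exact hg.mem _ (tsupport_lift_subset g hz).2.2

theorem ext_par_of_notMem (hσ : σ * σ = 1) {f g : 𝓓(U, ℝ)}
    (h0 : ∀ Z, ¬ 0 < σ * xL Z → f Z = g Z) (h : ∀ z, f (par σ z) = g (par σ z)) : f = g := by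
  ext Z
  by_cases hZ : 0 < σ * xL Z
  · rw [← par_parInv hσ hZ, h]
  · exact h0 Z hZ

theorem pull_eq_zero (hσ : σ * σ = 1) {F : ℝ × ℝ × ℝ → ℝ} (hF : IsSliceTest σ U F) {Z : Sl2}
    (hZ : ¬ 0 < σ * xL Z) : pull hσ hF Z = 0 := if_neg hZ

theorem lieT_pull_eq_zero (hσ : σ * σ = 1) {F : ℝ × ℝ × ℝ → ℝ} (hF : IsSliceTest σ U F) (W : Sl2)
    {Z : Sl2} (hZ : ¬ 0 < σ * xL Z) : lieT W (pull hσ hF) Z = 0 :=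
  image_eq_zero_of_notMem_tsupport fun h =>
    hZ (tsupport_pull_subset_halfSpace hσ hF (tsupport_lieT_subset _ _ h))

theorem IsSliceTest.sub {F G : ℝ × ℝ × ℝ → ℝ} (hF : IsSliceTest σ U F) (hG : IsSliceTest σ U G) :
    IsSliceTest σ U (fun z => F z - G z) where
  contDiff := hF.contDiff.sub hG.contDiff
  hasCompactSupport := hF.hasCompactSupport.sub hG.hasCompactSupport
  mem z hz := (tsupport_sub F G hz).elim (hF.mem z) (hG.mem z)

theorem fderiv_mul_fst {α : ℝ → ℝ} {k : ℝ × ℝ → ℝ} (hα : ContDiff ℝ ∞ α) (hk : ContDiff ℝ ∞ k)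
    (z : ℝ × ℝ × ℝ) :
    fderiv ℝ (fun z : ℝ × ℝ × ℝ => α z.1 * k z.2) z (1, 0) = deriv α z.1 * k z.2 ∧
    fderiv ℝ (fun z : ℝ × ℝ × ℝ => α z.1 * k z.2) z (0, 1, 0) =
      α z.1 * fderiv ℝ k z.2 (1, 0) := by
  have h1 : HasFDerivAt (fun z : ℝ × ℝ × ℝ => α z.1) _ z :=
    (hα.differentiable (by simp) z.1).hasDerivAt.hasFDerivAt.comp z hasFDerivAt_fst
  have h2 : HasFDerivAt (fun z : ℝ × ℝ × ℝ => k z.2) _ z :=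
    (hk.differentiable (by simp) z.2).hasFDerivAt.comp z hasFDerivAt_snd
  rw [(h1.fun_mul h2).fderiv]
  constructor
  · simp
    ring
  · simp

theorem fderiv_exp_mul (c : ℝ) {G : ℝ × ℝ → ℝ} (hG : ContDiff ℝ ∞ G) (e : ℝ × ℝ) :
    fderiv ℝ (fun e : ℝ × ℝ => Real.exp (c * e.1) * G e) e (1, 0) =
      Real.exp (c * e.1) * (c * G e + fderiv ℝ G e (1, 0)) := by
  have h1 : HasFDerivAt (fun e : ℝ × ℝ => Real.exp (c * e.1)) _ e :=
    ((hasFDerivAt_fst (𝕜 := ℝ) (p := e)).const_mul c).exp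
  rw [(h1.fun_mul (hG.differentiable (by simp) e).hasFDerivAt).fderiv]
  simp
  ring

variable (σ m) in
/-- The weighted integral of a function over the fibres of `q`. -/
def hat (f : Sl2 → ℝ) (q : ℝ) : ℝ :=
  ∫ b : ℝ, Real.exp ((m + 1) * b) * ∫ a : ℝ, f (par σ (a, b, q))

theorem contDiff_hat_aux (hU : IsAdInvariant (U : Set Sl2)) (hσ : σ * σ = 1) {f : 𝓓(U, ℝ)}
    (hf : tsupport f ⊆ {Z | 0 < σ * xL Z}) :
    (ContDiff ℝ ∞ (fun e : ℝ × ℝ => ∫ a, f (par σ (a, e)))) ∧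
    (HasCompactSupport (fun e : ℝ × ℝ => ∫ a, f (par σ (a, e)))) ∧
    (∀ e ∈ tsupport (fun e : ℝ × ℝ => ∫ a, f (par σ (a, e))), par σ (0, 0, e.2) ∈ U) := by
  have hF := isSliceTest_comp_par hσ f hf
  obtain ⟨h1, h2, h3⟩ := contDiff_integral_fst hF.contDiff hF.hasCompactSupport
  refine ⟨h1, h2, fun e he => ?_⟩
  obtain ⟨a, ha⟩ := h3 e he
  exact (par_mem_iff hU (a, e)).1 (hF.mem (a, e) ha)

theorem contDiff_hat_aux₂ (hU : IsAdInvariant (U : Set Sl2)) (hσ : σ * σ = 1) {f : 𝓓(U, ℝ)}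
    (hf : tsupport f ⊆ {Z | 0 < σ * xL Z}) :
    ContDiff ℝ ∞ (fun e : ℝ × ℝ => Real.exp ((m + 1) * e.1) * ∫ a, f (par σ (a, e))) ∧
    HasCompactSupport (fun e : ℝ × ℝ => Real.exp ((m + 1) * e.1) * ∫ a, f (par σ (a, e))) := by
  obtain ⟨h1, h2, -⟩ := contDiff_hat_aux hU hσ hf
  refine ⟨ContDiff.mul ?_ h1, h2.mul_left⟩
  fun_prop

theorem isRadialTest_hat (hU : IsAdInvariant (U : Set Sl2)) (hσ : σ * σ = 1) {f : 𝓓(U, ℝ)}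
    (hf : tsupport f ⊆ {Z | 0 < σ * xL Z}) : IsRadialTest σ U (hat σ m f) := by
  obtain ⟨-, -, h3⟩ := contDiff_hat_aux hU hσ hf
  obtain ⟨h1, h2⟩ := contDiff_hat_aux₂ (m := m) hU hσ hf
  obtain ⟨k1, k2, k3⟩ := contDiff_integral_fst h1 h2
  refine ⟨k1, k2, fun q hq => ?_⟩
  obtain ⟨b, hb⟩ := k3 q hq
  exact h3 (b, q) (tsupport_mul_subset_right hb)

theorem hat_sub_smul (hU : IsAdInvariant (U : Set Sl2)) (hσ : σ * σ = 1) {f g : 𝓓(U, ℝ)}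
    (hf : tsupport f ⊆ {Z | 0 < σ * xL Z}) (hg : tsupport g ⊆ {Z | 0 < σ * xL Z}) (c q : ℝ) :
    hat σ m (f - c • g : 𝓓(U, ℝ)) q = hat σ m f q - c * hat σ m g q := by
  have hF := isSliceTest_comp_par hσ f hf
  have hG := isSliceTest_comp_par hσ g hg
  have hsec : ∀ {E : Type} [NormedAddCommGroup E] {F : ℝ × E → ℝ}, Continuous F →
      HasCompactSupport F → ∀ e, Integrable fun a => F (a, e) := by
    intro E _ F h1 h2 e
    refine Continuous.integrable_of_hasCompactSupport (by fun_prop) ?_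
    refine HasCompactSupport.intro (h2.isCompact.image continuous_fst) fun a ha => ?_
    exact image_eq_zero_of_notMem_tsupport fun h => ha ⟨_, h, rfl⟩
  have e1 : ∀ b : ℝ, ∫ a, (f - c • g : 𝓓(U, ℝ)) (par σ (a, b, q)) =
      (∫ a, f (par σ (a, b, q))) - c * ∫ a, g (par σ (a, b, q)) := by
    intro b
    rw [← integral_const_mul, ← integral_sub (hsec hF.contDiff.continuous hF.hasCompactSupport _)
      ((hsec hG.contDiff.continuous hG.hasCompactSupport _).const_mul c)]
    rfl
  unfold hat
  obtain ⟨h1, h2⟩ := contDiff_hat_aux₂ (m := m) hU hσ hf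
  obtain ⟨k1, k2⟩ := contDiff_hat_aux₂ (m := m) hU hσ hg
  rw [← integral_const_mul, ← integral_sub (hsec h1.continuous h2 q)
      ((hsec k1.continuous k2 q).const_mul c)]
  refine integral_congr_ae (Eventually.of_forall fun b => ?_)
  simp only [e1]
  ring

/-- A functional that satisfies the equations of a highest weight component depends on the test
function only through its weighted integrals over the fibres of `q`. -/
theorem apply_eq_apply_lift_hat (hU : IsAdInvariant (U : Set Sl2)) (hσ : σ * σ = 1) {f : 𝓓(U, ℝ)}
    (hf : tsupport f ⊆ {Z | 0 < σ * xL Z}) (ξ : 𝓓(U, ℝ) →ₗ[ℝ] ℝ) (hY : ∀ f, ξ (lieT Y f) = 0)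
    (hH : ∀ f, ξ (lieT H f) = 2 * m * ξ f) :
    ξ f = ξ (pull hσ (isSliceTest_lift (m := m) hU (isRadialTest_hat (m := m) hU hσ hf))) := by
  have hF := isSliceTest_comp_par hσ f hf
  obtain ⟨h1, h2, h3⟩ := contDiff_hat_aux hU hσ hf
  obtain ⟨k1, k2⟩ := contDiff_hat_aux₂ (m := m) hU hσ hf
  have hg := isRadialTest_hat (m := m) hU hσ hf
  set F₁ : ℝ × ℝ → ℝ := fun e => ∫ a, f (par σ (a, e)) with hF₁
  have hS := isSliceTest_mul (σ := σ) hU contDiff_bump hasCompactSupport_bump h1 h2 h3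
  have hD := hF.sub hS
  -- Replacing f by bump(a) ∫ f da does not change the integrals over a, so the difference is ∂_a G,
  -- which ξ kills.
  obtain ⟨G, hG1, hG2, hG3, hG4⟩ := exists_primitive_fst hD.contDiff hD.hasCompactSupport (by
    intro e
    rw [integral_sub]
    · change _ - ∫ a, bump a * F₁ e = 0
      rw [integral_mul_const, integral_bump, one_mul, sub_self]
    · refine Continuous.integrable_of_hasCompactSupport
        (hF.contDiff.continuous.comp (by fun_prop : Continuous fun a : ℝ => (a, e))) ?_
      refine HasCompactSupport.intro (hF.hasCompactSupport.isCompact.image continuous_fst)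
        fun a ha => ?_
      exact image_eq_zero_of_notMem_tsupport (f := fun z => f (par σ z)) fun h => ha ⟨_, h, rfl⟩
    · exact integrable_bump.mul_const (F₁ e))
  have hG : IsSliceTest σ U G := by
    refine ⟨hG1, hG2, fun z hz => ?_⟩
    obtain ⟨z', hz', he⟩ := hG4 hz
    have := hD.mem z' hz'
    rwa [par_mem_iff hU, he, ← par_mem_iff hU] at this
  have hA : f = pull hσ hS + lieT Y (pull hσ hG) := by
    refine ext_par_of_notMem hσ (fun Z hZ => ?_) fun z => ?_
    · change f Z = pull hσ hS Z + lieT Y (pull hσ hG) Z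
      rw [pull_eq_zero hσ hS hZ, lieT_pull_eq_zero hσ hG _ hZ,
        image_eq_zero_of_notMem_tsupport fun h => hZ (hf h), add_zero]
    · change f (par σ z) = pull hσ hS (par σ z) + lieT Y (pull hσ hG) (par σ z)
      rw [pull_par, lieT_Y_par, show (fun z => pull hσ hG (par σ z)) = G from
        funext (pull_par hσ hG), hG3]
      ring
  have hD2s : ContDiff ℝ ∞ fun e : ℝ × ℝ => bump e.1 * hat σ m f e.2 :=
    (contDiff_bump.comp contDiff_fst).mul (hg.contDiff.comp contDiff_snd)
  have hD2c : HasCompactSupport fun e : ℝ × ℝ => bump e.1 * hat σ m f e.2 := by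
    refine HasCompactSupport.intro (hasCompactSupport_bump.isCompact.prod
      hg.hasCompactSupport.isCompact) fun e he => ?_
    rw [Set.mem_prod, not_and_or] at he
    rcases he with h | h
    · rw [image_eq_zero_of_notMem_tsupport h, zero_mul]
    · rw [image_eq_zero_of_notMem_tsupport h, mul_zero]
  -- The same in b: e^((m+1)b) ∫ f da and bump(b) `hat` have equal integrals over b, so they differ
  -- by a derivative in b.
  obtain ⟨G₁, hg1, hg2, hg3, hg4⟩ := exists_primitive_fst (k1.sub hD2s) (k2.sub hD2c) (by
    intro q
    rw [integral_sub]
    · change _ - ∫ b, bump b * hat σ m f q = 0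
      rw [integral_mul_const, integral_bump, one_mul]
      exact sub_self _
    · refine Continuous.integrable_of_hasCompactSupport
        (k1.continuous.comp (by fun_prop : Continuous fun b : ℝ => (b, q))) ?_
      refine HasCompactSupport.intro (k2.isCompact.image continuous_fst) fun a ha => ?_
      exact image_eq_zero_of_notMem_tsupport
        (f := fun e : ℝ × ℝ => Real.exp ((m + 1) * e.1) * F₁ e) fun h => ha ⟨_, h, rfl⟩
    · exact integrable_bump.mul_const (hat σ m f q))
  have hmem : ∀ e ∈ tsupport G₁, par σ (0, 0, e.2) ∈ U := by
    intro e he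
    obtain ⟨e', he', hee⟩ := hg4 he
    rw [← hee]
    rcases tsupport_sub _ _ he' with h | h
    · exact h3 _ (tsupport_mul_subset_right h)
    · exact hg.mem _ (tsupport_comp_subset_preimage (hat σ m f) continuous_snd
        (tsupport_mul_subset_right h))
  set k : ℝ × ℝ → ℝ := fun e => Real.exp (-(m + 1) * e.1) * G₁ e with hk
  have hks : ContDiff ℝ ∞ k := ContDiff.mul (by fun_prop) hg1
  have hkc : HasCompactSupport k := hg2.mul_left
  have hkU : ∀ e ∈ tsupport k, par σ (0, 0, e.2) ∈ U := fun e he =>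
    hmem e (tsupport_mul_subset_right he)
  have hL := isSliceTest_mul (σ := σ) hU contDiff_bump hasCompactSupport_bump hks hkc hkU
  have hids : ContDiff ℝ ∞ fun a : ℝ => a * bump a := contDiff_id.mul contDiff_bump
  have hM := isSliceTest_mul (σ := σ) hU hids hasCompactSupport_bump.mul_left hks hkc hkU
  -- With L = bump(a) k and M = aL, one has 2ℒ_Y M - ℒ_H L + 2mL = 2∂_b L + 2(m+1)L, the
  -- a-derivatives cancelling. This equals 2e^(-(m+1)b) ∂_b(e^((m+1)b) L), which explains the weight
  -- in `hat`; and ξ kills it by the two equations.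
  have hB : (2 : ℝ) • pull hσ hS - (2 : ℝ) • pull hσ (isSliceTest_lift (m := m) hU hg) =
      (2 : ℝ) • lieT Y (pull hσ hM) - lieT H (pull hσ hL) + (2 * m : ℝ) • pull hσ hL := by
    refine ext_par_of_notMem hσ (fun Z hZ => ?_) fun z => ?_
    · change 2 * pull hσ hS Z - 2 * pull hσ (isSliceTest_lift (m := m) hU hg) Z =
        2 * lieT Y (pull hσ hM) Z - lieT H (pull hσ hL) Z + 2 * m * pull hσ hL Z
      simp only [pull_eq_zero hσ _ hZ, lieT_pull_eq_zero hσ _ _ hZ]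
      simp
    · change 2 * pull hσ hS (par σ z) - 2 * pull hσ (isSliceTest_lift (m := m) hU hg) (par σ z) =
        2 * lieT Y (pull hσ hM) (par σ z) - lieT H (pull hσ hL) (par σ z) +
          2 * m * pull hσ hL (par σ z)
      have hder : deriv (fun a => a * bump a) z.1 = bump z.1 + z.1 * deriv bump z.1 := by
        have := (hasDerivAt_id' z.1).fun_mul
          (contDiff_bump.differentiable (by simp) z.1).hasDerivAt
        rw [HasDerivAt.deriv this]
        ring
      rw [lieT_Y_par, lieT_H_par, show (fun z => pull hσ hM (par σ z)) = _ from
        funext (pull_par hσ hM), show (fun z => pull hσ hL (par σ z)) = _ from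
        funext (pull_par hσ hL), (fderiv_mul_fst hids hks z).1,
        (fderiv_mul_fst contDiff_bump hks z).1, (fderiv_mul_fst contDiff_bump hks z).2,
        pull_par, pull_par, pull_par, hder, hk, fderiv_exp_mul _ hg1, hg3, lift]
      have hexp : Real.exp (-(m + 1) * z.2.1) * Real.exp ((m + 1) * z.2.1) = 1 := by
        rw [← Real.exp_add, show -(m + 1 : ℝ) * z.2.1 + (m + 1) * z.2.1 = 0 by ring, Real.exp_zero]
      linear_combination (-2 * bump z.1 * F₁ z.2) * hexp
  have hBξ := congrArg ξ hB
  rw [map_add, map_sub, map_sub, map_smul, map_smul, map_smul, map_smul, hY, hH] at hBξ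
  simp only [smul_eq_mul] at hBξ
  have hAξ := congrArg ξ hA
  rw [map_add, hY] at hAξ
  linarith

end Reduction

end SlTwo

end

noncomputable section

namespace SlTwo

open scoped ContDiff

open Filter Topology

/-! ### Functionals killed by powers of q, and the passage from σx > 0 to σy < 0. -/

section Uniqueness

variable {σ : ℝ} {U : Opens Sl2} {m : ℕ}

/-- Multiplication of test functions by the invariant quadratic form. -/
def quadT : Module.End ℝ 𝓓(U, ℝ) := mulT quad contDiff_quad

theorem quadT_apply (f : 𝓓(U, ℝ)) (Z : Sl2) : quadT f Z = quad Z * f Z := rfl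

theorem tsupport_quadT_pow_subset (N : ℕ) (f : 𝓓(U, ℝ)) :
    tsupport ((quadT ^ N) f) ⊆ tsupport f := tsupport_mulT_pow_subset _ _ _ _

theorem hasFDerivAt_quad (Z : Sl2) :
    HasFDerivAt quad ((2 * hL Z) • hL + (xL Z • yL + yL Z • xL)) Z := by
  have := ((hL.hasFDerivAt (x := Z)).pow 2).fun_add
    ((xL.hasFDerivAt (x := Z)).fun_mul (yL.hasFDerivAt (x := Z)))
  refine this.congr_fderiv ?_
  ext W
  simp

theorem lieT_quadT (Z : Sl2) (f : 𝓓(U, ℝ)) : lieT Z (quadT f) = quadT (lieT Z f) := by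
  ext W
  have h := ((hasFDerivAt_quad W).fun_mul (differentiable_test f W).hasFDerivAt).fderiv
  change fderiv ℝ (fun W => quad W * f W) W (-⁅Z, W⁆) = quad W * fderiv ℝ f W (-⁅Z, W⁆)
  rw [h]
  simp [hL_lie, xL_lie, yL_lie]
  ring

theorem lieT_quadT_pow (Z : Sl2) (N : ℕ) (f : 𝓓(U, ℝ)) :
    lieT Z ((quadT ^ N) f) = (quadT ^ N) (lieT Z f) := by
  induction N with
  | zero => rfl
  | succ N ih => rw [pow_succ', Module.End.mul_apply, lieT_quadT, ih, Module.End.mul_apply]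

theorem IsInv.comp_quadT_pow {V : Type*} [AddCommGroup V] [Module ℝ V] [LieRingModule Sl2 V]
    [LieModule ℝ Sl2 V] {φ : 𝓓(U, ℝ) →ₗ[ℝ] V} (hφ : IsInv φ) (N : ℕ) :
    IsInv (φ ∘ₗ quadT ^ N) := fun Z f => by
  rw [LinearMap.comp_apply, ← lieT_quadT_pow, hφ]
  rfl

theorem exists_eq_mul_of_eq_zero {g : ℝ → ℝ} (hg : ContDiff ℝ ∞ g) (h0 : g 0 = 0) :
    ∃ k : ℝ → ℝ, ContDiff ℝ ∞ k ∧ (∀ q, g q = q * k q) ∧ tsupport k ⊆ tsupport g := by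
  obtain ⟨k, hk, hgk, hs⟩ := exists_eq_fst_mul (E := Unit) (k := fun z : ℝ × Unit => g z.1)
    (hg.comp contDiff_fst) fun _ => h0
  have hc : Continuous fun q : ℝ => ((q, ()) : ℝ × Unit) := by fun_prop
  refine ⟨fun q => k (q, ()), hk.comp (contDiff_id.prodMk contDiff_const), fun q => hgk (q, ()),
    fun q hq => ?_⟩
  exact tsupport_comp_subset_preimage g continuous_fst (hs (tsupport_comp_subset_preimage k hc hq))

/-- If `hat` vanishes at q = 0 it is divisible by q, so its lift is q times a test function. -/
theorem apply_eq_zero_of_hat (hU : IsAdInvariant (U : Set Sl2)) (hσ : σ * σ = 1)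
    {ξ : 𝓓(U, ℝ) →ₗ[ℝ] ℝ} (hY : ∀ f, ξ (lieT Y f) = 0)
    (hH : ∀ f, ξ (lieT H f) = 2 * m * ξ f)
    (hq : ∀ f : 𝓓(U, ℝ), tsupport f ⊆ {Z | 0 < σ * xL Z} → ξ (quadT f) = 0)
    {f : 𝓓(U, ℝ)} (hf : tsupport f ⊆ {Z | 0 < σ * xL Z}) (h0 : hat σ m f 0 = 0) : ξ f = 0 := by
  rw [apply_eq_apply_lift_hat hU hσ hf ξ hY hH]
  have hg := isRadialTest_hat (m := m) hU hσ hf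
  obtain ⟨k, hk, hgk, hks⟩ := exists_eq_mul_of_eq_zero hg.contDiff h0
  have hkr : IsRadialTest σ U k := ⟨hk, hg.hasCompactSupport.of_isClosed_subset isClosed_closure hks,
    fun q hq => hg.mem q (hks hq)⟩
  have : pull hσ (isSliceTest_lift (m := m) hU hg) =
      quadT (pull hσ (isSliceTest_lift (m := m) hU hkr)) := by
    refine ext_par_of_notMem hσ (fun Z hZ => ?_) fun z => ?_
    · rw [quadT_apply, pull_eq_zero hσ _ hZ, pull_eq_zero hσ _ hZ, mul_zero]
    · rw [quadT_apply, pull_par, pull_par, quad_par hσ, lift, lift, hgk]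
      ring
  rw [this]
  exact hq _ (tsupport_pull_subset_halfSpace hσ _)

/-- When the half cone misses U, 0 lies outside the support of `hat`. -/
theorem apply_eq_zero_of_par_notMem (hU : IsAdInvariant (U : Set Sl2)) (hσ : σ * σ = 1)
    {ξ : 𝓓(U, ℝ) →ₗ[ℝ] ℝ} (hY : ∀ f, ξ (lieT Y f) = 0)
    (hH : ∀ f, ξ (lieT H f) = 2 * m * ξ f)
    (hq : ∀ f : 𝓓(U, ℝ), tsupport f ⊆ {Z | 0 < σ * xL Z} → ξ (quadT f) = 0)
    (h0 : par σ (0, 0, 0) ∉ U)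
    {f : 𝓓(U, ℝ)} (hf : tsupport f ⊆ {Z | 0 < σ * xL Z}) : ξ f = 0 :=
  apply_eq_zero_of_hat hU hσ hY hH hq hf (image_eq_zero_of_notMem_tsupport fun h =>
    h0 ((isRadialTest_hat (m := m) hU hσ hf).mem 0 h))

/-- Two functionals killed by `q` that satisfy the equations of a highest weight component are
proportional on the half space. -/
theorem apply_eq_mul (hU : IsAdInvariant (U : Set Sl2)) (hσ : σ * σ = 1)
    {ξ₁ ξ₂ : 𝓓(U, ℝ) →ₗ[ℝ] ℝ} (hY₁ : ∀ f, ξ₁ (lieT Y f) = 0)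
    (hH₁ : ∀ f, ξ₁ (lieT H f) = 2 * m * ξ₁ f)
    (hq₁ : ∀ f : 𝓓(U, ℝ), tsupport f ⊆ {Z | 0 < σ * xL Z} → ξ₁ (quadT f) = 0)
    (hY₂ : ∀ f, ξ₂ (lieT Y f) = 0) (hH₂ : ∀ f, ξ₂ (lieT H f) = 2 * m * ξ₂ f)
    (hq₂ : ∀ f : 𝓓(U, ℝ), tsupport f ⊆ {Z | 0 < σ * xL Z} → ξ₂ (quadT f) = 0)
    {f₁ : 𝓓(U, ℝ)} (hf₁ : tsupport f₁ ⊆ {Z | 0 < σ * xL Z}) (h1 : ξ₂ f₁ ≠ 0)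
    {f : 𝓓(U, ℝ)} (hf : tsupport f ⊆ {Z | 0 < σ * xL Z}) :
    ξ₁ f = ξ₁ f₁ / ξ₂ f₁ * ξ₂ f := by
  have hne : hat σ m f₁ 0 ≠ 0 := fun h => h1 (apply_eq_zero_of_hat hU hσ hY₂ hH₂ hq₂ hf₁ h)
  set c := hat σ m f 0 / hat σ m f₁ 0 with hc
  have hs : tsupport (f - c • f₁ : 𝓓(U, ℝ)) ⊆ {Z | 0 < σ * xL Z} := by
    refine (tsupport_sub (f : Sl2 → ℝ) (fun Z => c * f₁ Z)).trans (Set.union_subset hf ?_)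
    exact (tsupport_mul_subset_right (f := fun _ => c)).trans hf₁
  have h0 : hat σ m (f - c • f₁ : 𝓓(U, ℝ)) 0 = 0 := by
    rw [hat_sub_smul hU hσ hf hf₁, hc]
    field_simp
    ring
  have e1 := apply_eq_zero_of_hat hU hσ hY₁ hH₁ hq₁ hs h0
  have e2 := apply_eq_zero_of_hat hU hσ hY₂ hH₂ hq₂ hs h0
  rw [map_sub, map_smul, smul_eq_mul, sub_eq_zero] at e1 e2
  rw [e1, e2]
  field_simp

variable {V : Type*} [NormedAddCommGroup V] [NormedSpace ℝ V] [LieRingModule Sl2 V]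
  [LieModule ℝ Sl2 V]

theorem IsInv.top_lieT_Y {φ : 𝓓(U, ℝ) →ₗ[ℝ] V} (hφ : IsInv φ) {n : ℕ} {v : V}
    (hv : IsHighestWeightGenerator n v) (f : 𝓓(U, ℝ)) : (hv.top ∘ₗ φ) (lieT Y f) = 0 := by
  rw [LinearMap.comp_apply, hφ, hv.top_lie_Y]

theorem IsInv.top_lieT_H {φ : 𝓓(U, ℝ) →ₗ[ℝ] V} (hφ : IsInv φ) {v : V}
    (hv : IsHighestWeightGenerator (2 * m) v) (f : 𝓓(U, ℝ)) :
    (hv.top ∘ₗ φ) (lieT H f) = 2 * m * (hv.top ∘ₗ φ) f := by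
  rw [LinearMap.comp_apply, hφ, hv.top_lie_H]
  push_cast
  rfl

/-- On the half space, an invariant generalized function supported on the nilpotent cone is killed
by a power of `q`. -/
theorem exists_quadT_pow_eq_zero (hU : IsAdInvariant (U : Set Sl2)) (hσ : σ * σ = 1)
    {φ : 𝓓'(U, V)} (hφ : IsInv (φ : 𝓓(U, ℝ) →ₗ[ℝ] V))
    (hvan : ∀ f : 𝓓(U, ℝ), (∀ Z ∈ tsupport f, quad Z ≠ 0) → φ f = 0)
    {v : V} (hv : IsHighestWeightGenerator (2 * m) v) :
    ∃ N, ∀ f : 𝓓(U, ℝ), tsupport f ⊆ {Z | 0 < σ * xL Z} → hv.top (φ ((quadT ^ N) f)) = 0 := by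
  -- A power of q is available only on compact sets, but one exponent must serve all f. Replacing f
  -- by the lift of its `hat` confines a and b to the supports of the bumps, and η confines q to a
  -- compact set near 0; the part with 1 - η avoids q = 0 and is killed. If U misses the half cone,
  -- η = 0 will do.
  obtain ⟨η, hη, hηc, hηU, hη1⟩ : ∃ η : ℝ → ℝ, ContDiff ℝ ∞ η ∧ HasCompactSupport η ∧
      (∀ q ∈ tsupport η, par σ (0, 0, q) ∈ U) ∧
      (par σ (0, 0, 0) ∈ U → ∀ᶠ q in 𝓝 0, η q = 1) := by
    by_cases h : par σ (0, 0, 0) ∈ U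
    · have hO : IsOpen {q : ℝ | par σ (0, 0, q) ∈ U} :=
        U.isOpen.preimage (contDiff_par.continuous.comp (by fun_prop))
      obtain ⟨η, h1, h2, h3, h4, -⟩ := exists_cutoff (isCompact_singleton (x := (0 : ℝ))) hO
        (Set.singleton_subset_iff.2 h)
      rw [nhdsSet_singleton] at h4
      exact ⟨η, h1, h2, h3, fun _ => h4⟩
    · exact ⟨0, contDiff_const, HasCompactSupport.zero, by simp, fun h' => absurd h' h⟩
  have hηr : IsRadialTest σ U η := ⟨hη, hηc, hηU⟩
  have hK := isSliceTest_lift (m := m) hU hηr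
  obtain ⟨N, hN⟩ := exists_pow_mul_eq_zero φ contDiff_quad hvan
    ((hasCompactSupport_bump.isCompact.prod (hasCompactSupport_bump.isCompact.prod
      hηc.isCompact)).image (contDiff_par (σ := σ)).continuous) (by
    rintro _ ⟨z, hz, rfl⟩
    have := hηU _ hz.2.2
    exact (par_mem_iff hU z).2 this)
  refine ⟨N, fun f hf => ?_⟩
  have hinv := hφ.comp_quadT_pow N
  have key := apply_eq_apply_lift_hat hU hσ hf (hv.top ∘ₗ ((φ : 𝓓(U, ℝ) →ₗ[ℝ] V) ∘ₗ quadT ^ N))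
    (hinv.top_lieT_Y hv) (hinv.top_lieT_H hv)
  change _ = hv.top (φ ((quadT ^ N) _)) at key
  change hv.top (φ ((quadT ^ N) f)) = _ at key
  rw [key]
  have hg := isRadialTest_hat (m := m) hU hσ hf
  set g := hat σ m f
  have hg1 : IsRadialTest σ U fun q => η q * g q := ⟨hη.mul hg.contDiff,
    hηc.mul_right, fun q hq => hηU q (tsupport_mul_subset_left hq)⟩
  have hg2 : IsRadialTest σ U fun q => (1 - η q) * g q := ⟨(contDiff_const.sub hη).mul hg.contDiff,
    hg.hasCompactSupport.mul_left, fun q hq => hg.mem q (tsupport_mul_subset_right hq)⟩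
  have hsplit : pull hσ (isSliceTest_lift (m := m) hU hg) =
      pull hσ (isSliceTest_lift (m := m) hU hg1) + pull hσ (isSliceTest_lift (m := m) hU hg2) := by
    refine ext_par_of_notMem hσ (fun Z hZ => ?_) fun z => ?_
    · change _ = pull hσ _ Z + pull hσ _ Z
      simp only [pull_eq_zero hσ _ hZ, add_zero]
    · change _ = pull hσ _ (par σ z) + pull hσ _ (par σ z)
      simp only [pull_par, lift]
      ring
  have h2 : 0 ∉ tsupport fun q => (1 - η q) * g q := by
    intro h
    have := hη1 (hg2.mem 0 h)
    refine notMem_tsupport_iff_eventuallyEq.2 ?_ h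
    filter_upwards [this] with q hq
    simp [hq]
  rw [hsplit, map_add, map_add]
  have e1 : φ ((quadT ^ N) (pull hσ (isSliceTest_lift (m := m) hU hg1))) = 0 := by
    refine hN _ ((tsupport_pull_subset hσ _).trans (Set.image_mono ?_))
    exact (tsupport_lift_subset _).trans (Set.prod_mono le_rfl (Set.prod_mono le_rfl
      tsupport_mul_subset_left))
  have e2 : φ ((quadT ^ N) (pull hσ (isSliceTest_lift (m := m) hU hg2))) = 0 := by
    refine hvan _ fun Z hZ => ?_
    obtain ⟨z, hz, rfl⟩ := tsupport_pull_subset hσ _ (tsupport_quadT_pow_subset _ _ hZ)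
    rw [quad_par hσ]
    intro h0
    have := (tsupport_lift_subset _ hz).2.2
    rw [h0] at this
    exact h2 this
  rw [e1, e2, add_zero, map_zero]

/-- An invariant map that vanishes where `σ x > 0` vanishes where `σ y < 0`. -/
theorem IsInv.isVanishingOn_of_halfSpace {φ : 𝓓(U, ℝ) →ₗ[ℝ] V} (hφ : IsInv φ)
    (hU : IsAdInvariant (U : Set Sl2)) {n : ℕ} {v : V} (hv : IsHighestWeightGenerator n v)
    (h : Distribution.IsVanishingOn φ {Z | 0 < σ * xL Z}) :
    Distribution.IsVanishingOn φ {Z | σ * yL Z < 0} := by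
  refine hφ.isVanishingOn_of_bot hv fun f hf => ?_
  -- Conjugation by exp(-TX) sends x to x + 2Th - T²y. On the compact support -σy is bounded below
  -- by δ > 0, so for T large the new σx is positive throughout.
  obtain ⟨T, hT⟩ : ∃ T : ℝ, ∀ Z ∈ tsupport f, 0 < σ * xL (conj 1 (-T) 0 1 Z) := by
    obtain ⟨C, hC⟩ := f.hasCompactSupport.isCompact.exists_bound_of_continuousOn
      (f := fun Z : Sl2 => ((σ * xL Z, σ * hL Z) : ℝ × ℝ)) (by fun_prop)
    obtain ⟨δ, hδ, hδf⟩ : ∃ δ > 0, ∀ Z ∈ tsupport f, δ ≤ -(σ * yL Z) := by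
      by_cases hne : (tsupport f).Nonempty
      · obtain ⟨Z₀, hZ₀, hmin⟩ := f.hasCompactSupport.isCompact.exists_isMinOn hne
          (f := fun Z : Sl2 => -(σ * yL Z)) (by fun_prop)
        refine ⟨-(σ * yL Z₀), ?_, fun Z hZ => hmin hZ⟩
        have := hf hZ₀
        change σ * yL Z₀ < 0 at this
        linarith
      · exact ⟨1, one_pos, fun Z hZ => absurd ⟨Z, hZ⟩ hne⟩
    refine ⟨(3 * |C| + 1) / δ + 1, fun Z hZ => ?_⟩
    set T := (3 * |C| + 1) / δ + 1 with hT
    have hT1 : 1 ≤ T := by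
      have : 0 ≤ (3 * |C| + 1) / δ := by positivity
      linarith
    have hTδ : 3 * |C| + 1 ≤ T * δ := by
      rw [hT, add_mul, div_mul_cancel₀ _ hδ.ne']
      linarith
    have hb := (hC Z hZ).trans (le_abs_self C)
    have hx := abs_le.1 ((norm_fst_le _).trans hb)
    have hh := abs_le.1 ((norm_snd_le _).trans hb)
    have hy := hδf Z hZ
    rw [conj_apply, xL_ofCoords]
    simp only at hx hh
    have hC0 : 0 ≤ |C| := abs_nonneg C
    have e1 : T * (T * δ) ≤ T * (T * -(σ * yL Z)) := by gcongr
    have e2 : T * (3 * |C| + 1) ≤ T * (T * δ) := by gcongr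
    have e3 : T * (-|C|) ≤ T * (σ * hL Z) := by
      have := hh.1
      gcongr
    have e4 : |C| ≤ T * |C| := le_mul_of_one_le_left hC0 hT1
    nlinarith [hx.1]
  -- With constant weight, ℒ_X of the average is f minus its translate. Since `bot` kills the image
  -- of X, it does not distinguish φ on f from φ on the translate, which is supported in the half
  -- space.
  have h1 := lieT_flowAvg isAdFlow_X hU T (fun _ => 1) contDiff_const
    (by simpa using contDiff_const) f
  have h2 : flowAvg isAdFlow_X hU T (deriv fun _ : ℝ => (1 : ℝ)) (by simpa using contDiff_const) f =
      0 := by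
    ext W
    rw [flowAvg_apply]
    simp
  rw [h2, one_smul, one_smul, add_zero] at h1
  have h3 := congrArg (fun g => hv.bot (φ g)) h1
  simp only [hφ X, hv.bot_lie_X, map_sub] at h3
  rw [h (flowComp isAdFlow_X hU T f), map_zero, sub_zero] at h3
  · exact h3.symm
  · refine fun Z hZ => ?_
    have hcont : Continuous fun W : Sl2 => conj 1 T 0 1 W :=
      (conj 1 T 0 1).continuous_of_finiteDimensional
    have := hT _ (tsupport_comp_subset_preimage f hcont hZ)
    have hinv := isAdFlow_X.neg_apply T Z
    rw [hinv] at this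
    exact this

end Uniqueness

end SlTwo

end

noncomputable section

namespace SlTwo

open scoped ContDiff

open Filter Topology

/-! ### Commutation of the Casimir operator with the quadratic form. -/

section Casimir

variable {U : Opens Sl2}

/-- The transpose of `□` on test functions. -/
def boxT : Module.End ℝ 𝓓(U, ℝ) := (1 / 2 : ℝ) • (tder H * tder H) + (2 : ℝ) • (tder X * tder Y)

/-- The Euler operator on test functions. -/
def eulT : Module.End ℝ 𝓓(U, ℝ) := coordT 0 * tder H + coordT 1 * tder X + coordT 2 * tder Y

theorem boxT_apply (f : 𝓓(U, ℝ)) :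
    boxT f = (1 / 2 : ℝ) • tder H (tder H f) + (2 : ℝ) • tder X (tder Y f) := rfl

theorem eulT_def (f : 𝓓(U, ℝ)) :
    eulT f = coordT 0 (tder H f) + coordT 1 (tder X f) + coordT 2 (tder Y f) := rfl

theorem eulT_apply (f : 𝓓(U, ℝ)) (Z : Sl2) : eulT f Z = fderiv ℝ f Z Z := by
  change hL Z * tder H f Z + xL Z * tder X f Z + yL Z * tder Y f Z = _
  rw [tder_apply, tder_apply, tder_apply]
  generalize fderiv ℝ f Z = L
  conv_rhs => rw [eq_comb_L Z]
  simp

theorem box_pow_apply {V : Type*} [NormedAddCommGroup V] [NormedSpace ℝ V] (φ : 𝓓'(U, V)) (k : ℕ)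
    (f : 𝓓(U, ℝ)) : (box U V ^ k) φ f = φ ((boxT ^ k) f) := by
  induction k generalizing f with
  | zero => rfl
  | succ k ih =>
    rw [pow_succ', pow_succ, Module.End.mul_apply, Module.End.mul_apply, ← ih, boxT_apply, map_add,
      map_smul, map_smul]
    change (1 / 2 : ℝ) • (- -((box U V ^ k) φ (tder H (tder H f)))) +
      (2 : ℝ) • (- -((box U V ^ k) φ (tder X (tder Y f)))) = _
    rw [neg_neg, neg_neg]

theorem tsupport_boxT_pow_subset (k : ℕ) (f : 𝓓(U, ℝ)) :
    tsupport ((boxT ^ k) f) ⊆ tsupport f := by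
  induction k with
  | zero => exact le_rfl
  | succ k ih =>
    rw [pow_succ', Module.End.mul_apply]
    refine (le_trans ?_ (?_ : tsupport (boxT ((boxT ^ k) f)) ⊆ tsupport ((boxT ^ k) f))).trans ih
    · exact le_rfl
    · generalize (boxT ^ k) f = g
      refine (tsupport_add (fun Z => (1 / 2 : ℝ) * tder H (tder H g) Z)
        (fun Z => (2 : ℝ) * tder X (tder Y g) Z)).trans (Set.union_subset ?_ ?_)
      · exact (tsupport_mul_subset_right (f := fun _ => (1 / 2 : ℝ))).trans
          ((tsupport_tder_subset _ _).trans (tsupport_tder_subset _ _))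
      · exact (tsupport_mul_subset_right (f := fun _ => (2 : ℝ))).trans
          ((tsupport_tder_subset _ _).trans (tsupport_tder_subset _ _))

theorem coe_tder {U' : Opens Sl2} {f : 𝓓(U, ℝ)} {g : 𝓓(U', ℝ)} (h : (g : Sl2 → ℝ) = f) (Z : Sl2) :
    (tder Z g : Sl2 → ℝ) = tder Z f := by
  funext W
  rw [tder_apply, tder_apply, h]

theorem coe_boxT_pow {U' : Opens Sl2} {f : 𝓓(U, ℝ)} {g : 𝓓(U', ℝ)} (h : (g : Sl2 → ℝ) = f) (k : ℕ) :
    ((boxT ^ k) g : Sl2 → ℝ) = (boxT ^ k) f := by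
  induction k with
  | zero => exact h
  | succ k ih =>
    rw [pow_succ', pow_succ', Module.End.mul_apply, Module.End.mul_apply]
    funext W
    change (1 / 2 : ℝ) * tder H (tder H ((boxT ^ k) g)) W +
      (2 : ℝ) * tder X (tder Y ((boxT ^ k) g)) W = (1 / 2 : ℝ) * tder H (tder H ((boxT ^ k) f)) W +
      (2 : ℝ) * tder X (tder Y ((boxT ^ k) f)) W
    rw [coe_tder (coe_tder ih H) H, coe_tder (coe_tder ih Y) X]

theorem restr_box_pow_apply {V : Type*} [NormedAddCommGroup V] [NormedSpace ℝ V]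
    (φ : 𝓓'((⊤ : Opens Sl2), V)) (k : ℕ) (f : 𝓓(U, ℝ)) :
    restr U V ((box ⊤ V ^ k) φ) f = restr U V φ ((boxT ^ k) f) := by
  have hK : ∀ x ∉ tsupport f, f x = 0 := fun x hx => image_eq_zero_of_notMem_tsupport hx
  set g : 𝓓((⊤ : Opens Sl2), ℝ) := mkTest f (contDiff_test f) f.hasCompactSupport
    (Set.subset_univ _) hK
  rw [restr_apply _ f g rfl, box_pow_apply,
    restr_apply (U := U) φ ((boxT ^ k) f) ((boxT ^ k) g)
      (coe_boxT_pow (f := f) (g := g) rfl k)]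

theorem tder_coordT (Z : Sl2) (i : Fin 3) (f : 𝓓(U, ℝ)) :
    tder Z (coordT i f) = coordT i (tder Z f) + coord i Z • f := by
  have := tder_coordT_pow Z i 1 f
  simpa using this

theorem tder_quadT (Z : Sl2) (f : 𝓓(U, ℝ)) : tder Z (quadT f) = quadT (tder Z f) +
    ((2 * hL Z) • coordT 0 f + yL Z • coordT 1 f + xL Z • coordT 2 f) := by
  ext W
  have h := ((hasFDerivAt_quad W).fun_mul (differentiable_test f W).hasFDerivAt).fderiv
  rw [tder_apply]
  change fderiv ℝ (fun W => quad W * f W) W Z = quad W * tder Z f W +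
    (2 * hL Z * (hL W * f W) + yL Z * (xL W * f W) + xL Z * (yL W * f W))
  rw [h, tder_apply]
  simp
  ring

/-- The operators q, □ and the shifted Euler operator span an 𝔰𝔩₂ up to normalization; the constant
3 is □q. -/
theorem boxT_quadT (f : 𝓓(U, ℝ)) :
    boxT (quadT f) = quadT (boxT f) + ((2 : ℝ) • eulT f + (3 : ℝ) • f) := by
  rw [boxT_apply, boxT_apply, eulT_def]
  simp only [tder_quadT, tder_coordT, map_add, map_smul, hL_H, xL_H, yL_H, hL_X, xL_X, yL_X, hL_Y,
    xL_Y, yL_Y, show coord 0 = hL from rfl, show coord 1 = xL from rfl, show coord 2 = yL from rfl]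
  module

theorem tder_eulT (Z : Sl2) (f : 𝓓(U, ℝ)) : tder Z (eulT f) = eulT (tder Z f) + tder Z f := by
  rw [eulT_def, eulT_def]
  have hZ : tder Z f = hL Z • tder H f + xL Z • tder X f + yL Z • tder Y f := by
    conv_lhs => rw [eq_comb_L Z]
    simp only [tder_add, tder_smul]
  simp only [map_add, tder_coordT, show coord 0 = hL from rfl, show coord 1 = xL from rfl,
    show coord 2 = yL from rfl]
  rw [tder_comm Z H, tder_comm Z X, tder_comm Z Y]
  have h : ∀ A B C : 𝓓(U, ℝ), A + hL Z • tder H f + (B + xL Z • tder X f) + (C + yL Z • tder Y f) =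
      A + B + C + (hL Z • tder H f + xL Z • tder X f + yL Z • tder Y f) := fun A B C => by abel
  rw [h, ← hZ]

theorem boxT_eulT (f : 𝓓(U, ℝ)) : boxT (eulT f) = eulT (boxT f) + (2 : ℝ) • boxT f := by
  rw [boxT_apply, boxT_apply]
  simp only [tder_eulT, map_add, map_smul]
  module

theorem boxT_pow_quadT (k : ℕ) (f : 𝓓(U, ℝ)) : (boxT ^ (k + 1)) (quadT f) =
    quadT ((boxT ^ (k + 1)) f) +
      ((k : ℝ) + 1) • ((2 : ℝ) • eulT ((boxT ^ k) f) + (2 * (k : ℝ) + 3) • (boxT ^ k) f) := by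
  induction k with
  | zero =>
    simp only [zero_add, pow_one, pow_zero, Module.End.one_apply, boxT_quadT]
    module
  | succ k ih =>
    have hs : ∀ g : 𝓓(U, ℝ), (boxT ^ (k + 1)) g = boxT ((boxT ^ k) g) := fun g => by
      rw [pow_succ', Module.End.mul_apply]
    have hs2 : ∀ g : 𝓓(U, ℝ), (boxT ^ (k + 1 + 1)) g = boxT ((boxT ^ (k + 1)) g) := fun g => by
      rw [pow_succ', Module.End.mul_apply]
    rw [hs2, hs2, ih]
    simp only [map_add, map_smul, boxT_quadT, boxT_eulT, ← hs]
    push_cast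
    module

theorem lieT_boxT (Z : Sl2) (f : 𝓓(U, ℝ)) : lieT Z (boxT f) = boxT (lieT Z f) := by
  have hW : ∀ (W : Sl2) (f : 𝓓(U, ℝ)),
      tder W f = hL W • tder H f + xL W • tder X f + yL W • tder Y f := by
    intro W f
    conv_lhs => rw [eq_comb_L W]
    simp only [tder_add, tder_smul]
  have h1 := fun f : 𝓓(U, ℝ) => hW ⁅Z, H⁆ f
  have h2 := fun f : 𝓓(U, ℝ) => hW ⁅Z, X⁆ f
  have h3 := fun f : 𝓓(U, ℝ) => hW ⁅Z, Y⁆ f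
  simp only [hL_lie, xL_lie, yL_lie, hL_H, xL_H, yL_H, hL_X, xL_X, yL_X, hL_Y, xL_Y, yL_Y]
    at h1 h2 h3
  rw [boxT_apply, boxT_apply]
  simp only [map_add, map_smul, lieT_tder, h1, h2, h3]
  rw [tder_comm X H, tder_comm Y H]
  module

theorem lieT_boxT_pow (Z : Sl2) (N : ℕ) (f : 𝓓(U, ℝ)) :
    lieT Z ((boxT ^ N) f) = (boxT ^ N) (lieT Z f) := by
  induction N with
  | zero => rfl
  | succ N ih => rw [pow_succ', Module.End.mul_apply, lieT_boxT, ih, Module.End.mul_apply]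

variable {V : Type*} [AddCommGroup V] [Module ℝ V] {m : ℕ} {ψ : 𝓓(U, ℝ) →ₗ[ℝ] V}

theorem IsInv.comp_boxT_pow [LieRingModule Sl2 V] [LieModule ℝ Sl2 V] (hψ : IsInv ψ) (N : ℕ) :
    IsInv (ψ ∘ₗ boxT ^ N) := fun Z f => by
  rw [LinearMap.comp_apply, ← lieT_boxT_pow, hψ]
  rfl

/-- The cone integrals satisfy both hypotheses, `hE` being homogeneity. The factor comes from
-2(m+1) + 2k + 3. -/
theorem apply_boxT_pow_quadT (hE : ∀ f, ψ (eulT f) = -((m : ℝ) + 1) • ψ f)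
    (hq : ∀ f, ψ (quadT f) = 0) (k : ℕ) (f : 𝓓(U, ℝ)) :
    ψ ((boxT ^ (k + 1)) (quadT f)) =
      (((k : ℝ) + 1) * (2 * (k : ℝ) + 1 - 2 * m)) • ψ ((boxT ^ k) f) := by
  rw [boxT_pow_quadT, map_add, hq, zero_add, map_smul, map_add, map_smul, map_smul, hE]
  module

/-- The constant is a product of factors (k+1)(2k+1-2m), nonzero because 2k+1-2m is an odd integer.
-/
theorem apply_boxT_pow_quadT_pow (hE : ∀ f, ψ (eulT f) = -((m : ℝ) + 1) • ψ f)
    (hq : ∀ f, ψ (quadT f) = 0) (K : ℕ) :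
    ∃ d : ℝ, d ≠ 0 ∧ ∀ f, ψ ((boxT ^ K) ((quadT ^ K) f)) = d • ψ f := by
  induction K with
  | zero => exact ⟨1, one_ne_zero, fun f => by simp⟩
  | succ K ih =>
    obtain ⟨d, hd, h⟩ := ih
    refine ⟨(((K : ℝ) + 1) * (2 * (K : ℝ) + 1 - 2 * m)) * d, mul_ne_zero (mul_ne_zero
      (by positivity) ?_) hd, fun f => ?_⟩
    · have : (2 * (K : ℤ) + 1 - 2 * m) ≠ 0 := by omega
      exact_mod_cast this
    · rw [pow_succ' quadT, Module.End.mul_apply, apply_boxT_pow_quadT hE hq, h, smul_smul]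

theorem apply_boxT_pow_quadT_pow_of_lt (hE : ∀ f, ψ (eulT f) = -((m : ℝ) + 1) • ψ f)
    (hq : ∀ f, ψ (quadT f) = 0) {k K : ℕ} (hk : k < K) (f : 𝓓(U, ℝ)) :
    ψ ((boxT ^ k) ((quadT ^ K) f)) = 0 := by
  induction k generalizing K with
  | zero =>
    obtain ⟨K, rfl⟩ := Nat.exists_eq_add_of_lt hk
    rw [pow_succ' quadT, Module.End.mul_apply]
    exact hq _
  | succ k ih =>
    obtain ⟨K, rfl⟩ := Nat.exists_eq_succ_of_ne_zero (Nat.ne_zero_of_lt hk)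
    rw [pow_succ' quadT, Module.End.mul_apply, apply_boxT_pow_quadT hE hq, ih (by omega), smul_zero]

end Casimir

end SlTwo

end

noncomputable section

namespace SlTwo

open scoped ContDiff

open Filter Topology

/-! ### Parametrization of the half cones, and smoothness of s_n along it. -/

section ConeIntegral

variable {V : Type*} [NormedAddCommGroup V] [NormedSpace ℝ V]

theorem inc_eq (W : Sl2) : inc W = hL W • inc H + xL W • inc X + yL W • inc Y := by
  conv_lhs => rw [eq_comb_L W]
  simp only [map_add, map_smul]

/-- Expanding one factor in the basis allows induction on m over all linear maps `q` at once; thus W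
↦ W^m is only differentiated after composition with a map to V, and no norm on the symmetric algebra
is needed. -/
theorem apply_inc_pow_succ (m : ℕ) (q : SymSl2 →ₗ[ℝ] V) (W : Sl2) : q (inc W ^ (m + 1)) =
    hL W • (q ∘ₗ LinearMap.mulLeft ℝ (inc H)) (inc W ^ m) +
      xL W • (q ∘ₗ LinearMap.mulLeft ℝ (inc X)) (inc W ^ m) +
      yL W • (q ∘ₗ LinearMap.mulLeft ℝ (inc Y)) (inc W ^ m) := by
  simp only [LinearMap.comp_apply, LinearMap.mulLeft_apply, ← map_smul, ← map_add]
  congr 1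
  rw [pow_succ', ← smul_mul_assoc, ← smul_mul_assoc, ← smul_mul_assoc, ← add_mul, ← add_mul,
    ← inc_eq]

theorem contDiff_apply_inc_pow (m : ℕ) (q : SymSl2 →ₗ[ℝ] V) :
    ContDiff ℝ ∞ fun W : Sl2 => q (inc W ^ m) := by
  induction m generalizing q with
  | zero => simpa using contDiff_const
  | succ m ih =>
    simp only [apply_inc_pow_succ]
    exact ((hL.contDiff.smul (ih _)).add (xL.contDiff.smul (ih _))).add (yL.contDiff.smul (ih _))

theorem hasDerivAt_apply_inc_pow (m : ℕ) (q : SymSl2 →ₗ[ℝ] V) {W : ℝ → Sl2} {W' : Sl2} {t : ℝ}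
    (hW : HasDerivAt W W' t) : HasDerivAt (fun t => q (inc (W t) ^ m))
      (q ((m : ℝ) • (inc (W t) ^ (m - 1) * inc W'))) t := by
  induction m generalizing q with
  | zero => simpa using hasDerivAt_const t (q 1)
  | succ m ih =>
    simp only [apply_inc_pow_succ]
    have hc : ∀ L : Sl2 →L[ℝ] ℝ, HasDerivAt (fun t => L (W t)) (L W') t := fun L =>
      L.hasFDerivAt.comp_hasDerivAt t hW
    refine ((((hc hL).smul (ih _)).add ((hc xL).smul (ih _))).add
      ((hc yL).smul (ih _))).congr_deriv ?_
    simp only [LinearMap.comp_apply, LinearMap.mulLeft_apply, ← map_smul, ← map_add]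
    congr 1
    have hm : (m : ℝ) • (inc (W t) * (inc (W t) ^ (m - 1) * inc W')) =
        (m : ℝ) • (inc (W t) ^ m * inc W') := by
      cases m with
      | zero => simp
      | succ m => rw [← mul_assoc, ← pow_succ', Nat.add_sub_cancel]
    rw [Nat.add_sub_cancel, Nat.cast_succ, add_smul, one_smul, ← hm]
    generalize inc (W t) ^ (m - 1) * inc W' = A
    generalize inc (W t) ^ m = Q
    rw [inc_eq (W t), inc_eq W']
    simp only [add_mul, mul_add, smul_mul_assoc, mul_smul_comm, smul_add, mul_comm _ Q]
    module

theorem lie_inc_pow (Z W : Sl2) (m : ℕ) :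
    ⁅Z, inc W ^ m⁆ = (m : ℝ) • (inc W ^ (m - 1) * inc ⁅Z, W⁆) := by
  rw [lie_sym_def, Derivation.leibniz_pow, adSym_inc, smul_eq_mul, ← Nat.cast_smul_eq_nsmul ℝ]

/-- The parametrization of the half cone of sign `σ`. -/
def cone (σ : ℝ) (v : V1) : Sl2 := σ • moment v

variable {σ : ℝ}

theorem hL_moment (v : V1) : hL (moment v) = -(v 0 * v 1) / 2 := rfl
theorem xL_moment (v : V1) : xL (moment v) = v 0 ^ 2 / 2 := rfl
theorem yL_moment (v : V1) : yL (moment v) = -(v 1 ^ 2) / 2 := rfl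

theorem hL_cone (v : V1) : hL (cone σ v) = σ * (-(v 0 * v 1) / 2) := by
  rw [cone, map_smul, hL_moment, smul_eq_mul]

theorem xL_cone (v : V1) : xL (cone σ v) = σ * (v 0 ^ 2 / 2) := by
  rw [cone, map_smul, xL_moment, smul_eq_mul]

theorem yL_cone (v : V1) : yL (cone σ v) = σ * (-(v 1 ^ 2) / 2) := by
  rw [cone, map_smul, yL_moment, smul_eq_mul]

theorem quad_cone (v : V1) : quad (cone σ v) = 0 := by
  rw [quad, hL_cone, xL_cone, yL_cone]
  ring

theorem cone_mem_nilCone (σ : ℝ) (v : V1) : cone σ v ∈ nilCone :=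
  (mem_nilCone_iff _).2 (quad_cone v)

theorem contDiff_cone : ContDiff ℝ ∞ (cone σ) := by
  have h : cone σ = fun v => (σ * (-(v 0 * v 1) / 2)) • H + (σ * (v 0 ^ 2 / 2)) • X +
      (σ * (-(v 1 ^ 2) / 2)) • Y := by
    funext v
    rw [eq_comb_L (cone σ v), hL_cone, xL_cone, yL_cone]
  rw [h]
  fun_prop

theorem isCompact_preimage_cone (hσ : σ * σ = 1) {K : Set Sl2} (hK : IsCompact K) :
    IsCompact (cone σ ⁻¹' K) := by
  have : cone σ ⁻¹' K = moment ⁻¹' ((fun Z => σ • Z) '' K) := by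
    ext v
    constructor
    · intro hv
      exact ⟨_, hv, by simp only [cone]; rw [smul_smul, hσ, one_smul]⟩
    · rintro ⟨Z, hZ, hv⟩
      change σ • moment v ∈ K
      rw [← hv]
      simp only
      rwa [smul_smul, hσ, one_smul]
  rw [this]
  exact isCompact_preimage_moment _ (hK.image (continuous_const_smul σ))

theorem hasDerivAt_cone (v w : V1) (t : ℝ) : HasDerivAt (fun t : ℝ => cone σ (v + t • w))
    (ofCoords (-(σ * ((v + t • w) 0 * w 1 + (v + t • w) 1 * w 0)) / 2) (σ * ((v + t • w) 0 * w 0))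
      (-(σ * ((v + t • w) 1 * w 1)))) t := by
  have h : ∀ i, HasDerivAt (fun t : ℝ => (v + t • w) i) (w i) t := fun i => by
    simpa using ((hasDerivAt_id t).mul_const (w i)).const_add (v i)
  have e1 := (((h 0).fun_mul (h 1)).fun_neg.div_const 2).const_mul σ
  have e2 := (((h 0).fun_pow 2).div_const 2).const_mul σ
  have e3 := (((h 1).fun_pow 2).fun_neg.div_const 2).const_mul σ
  have := ((e1.smul_const H).add (e2.smul_const X)).add (e3.smul_const Y)
  have hfun : (fun t : ℝ => cone σ (v + t • w)) = fun t : ℝ =>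
      (σ * (-((v + t • w) 0 * (v + t • w) 1) / 2)) • H + (σ * ((v + t • w) 0 ^ 2 / 2)) • X +
      (σ * (-((v + t • w) 1 ^ 2) / 2)) • Y := by
    funext t
    rw [eq_comb_L (cone σ (v + t • w)), hL_cone, xL_cone, yL_cone]
  rw [hfun]
  refine this.congr_deriv ?_
  rw [ofCoords_eq]
  congr 1
  · congr 1
    · congr 1
      ring
    · congr 1
      simp only [Nat.cast_ofNat, Nat.add_one_sub_one, pow_one]
      ring
  · congr 1
    simp only [Nat.cast_ofNat, Nat.add_one_sub_one, pow_one]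
    ring

/-- The action of `𝔰𝔩(2, ℝ)` on the standard representation. -/
def act (Z : Sl2) (v : V1) : V1 := (Z : Matrix (Fin 2) (Fin 2) ℝ).mulVec v

theorem act_zero (Z : Sl2) (v : V1) : act Z v 0 = hL Z * v 0 + xL Z * v 1 := by
  simp [act, Matrix.mulVec, dotProduct, Fin.sum_univ_two]
  rfl

theorem act_one (Z : Sl2) (v : V1) : act Z v 1 = yL Z * v 0 - hL Z * v 1 := by
  have h : (Z : Matrix (Fin 2) (Fin 2) ℝ) 1 1 = -hL Z := by
    conv_lhs => rw [← ofCoords_coords Z]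
    rfl
  simp [act, Matrix.mulVec, dotProduct, Fin.sum_univ_two, h]
  rw [← sub_eq_add_neg]
  rfl

/-- Infinitesimal equivariance of the moment map. -/
theorem hasDerivAt_cone_act (Z : Sl2) (v : V1) :
    HasDerivAt (fun t : ℝ => cone σ (v + t • act Z v)) ⁅Z, cone σ v⁆ 0 := by
  refine (hasDerivAt_cone v (act Z v) 0).congr_deriv ?_
  rw [zero_smul, add_zero]
  apply ext_L
  · simp [hL_lie, hL_cone, xL_cone, yL_cone, act_zero, act_one]
    ring
  · simp [xL_lie, hL_cone, xL_cone, yL_cone, act_zero, act_one]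
    ring
  · simp [yL_lie, hL_cone, xL_cone, yL_cone, act_zero, act_one]
    ring

theorem hasDerivAt_cone_self (v : V1) :
    HasDerivAt (fun t : ℝ => cone σ (v + t • v)) ((2 : ℝ) • cone σ v) 0 := by
  refine (hasDerivAt_cone v v 0).congr_deriv ?_
  rw [zero_smul, add_zero]
  apply ext_L
  · simp [hL_cone]
    ring
  · simp [xL_cone]
    ring
  · simp [yL_cone]
    ring

end ConeIntegral

/-! ### Integration by parts for linear vector fields on the plane. -/

section Divergence

variable {V : Type*} [NormedAddCommGroup V] [NormedSpace ℝ V]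

theorem integral_coord_smul_fderiv {g : V1 → V} (hg : ContDiff ℝ ∞ g) (hc : HasCompactSupport g)
    (i j : Fin 2) : ∫ v : V1, v i • fderiv ℝ g v (Pi.single j 1) =
      -((if i = j then (1 : ℝ) else 0) • ∫ v, g v) := by
  have hd : Continuous fun v => fderiv ℝ g v (Pi.single j 1) :=
    (hg.continuous_fderiv (by simp)).clm_apply continuous_const
  have hdc : HasCompactSupport fun v => fderiv ℝ g v (Pi.single j 1) :=
    hc.fderiv_apply ℝ (Pi.single j 1)
  have hf : ∀ v : V1, fderiv ℝ (fun v : V1 => v i) v (Pi.single j 1) = if i = j then 1 else 0 := by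
    intro v
    have : HasFDerivAt (fun v : V1 => v i) (ContinuousLinearMap.proj i : V1 →L[ℝ] ℝ) v :=
      (ContinuousLinearMap.proj i : V1 →L[ℝ] ℝ).hasFDerivAt
    rw [this.fderiv]
    simp [Pi.single_apply]
  rw [integral_smul_fderiv_eq_neg_fderiv_smul_of_integrable]
  · simp only [hf, integral_smul]
  · simp only [hf]
    exact (hg.continuous.integrable_of_hasCompactSupport hc).smul _
  · exact ((continuous_apply i).smul hd).integrable_of_hasCompactSupport hdc.smul_left
  · exact ((continuous_apply i).smul hg.continuous).integrable_of_hasCompactSupport hc.smul_left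
  · exact fun v _ => differentiableAt_apply i v
  · exact fun v _ => hg.differentiable (by simp) v

/-- The divergence theorem for a linear vector field on the plane. -/
theorem integral_fderiv_linear {g : V1 → V} (hg : ContDiff ℝ ∞ g) (hc : HasCompactSupport g)
    (A : V1 → V1) (a b c d : ℝ) (hA0 : ∀ v, A v 0 = a * v 0 + b * v 1)
    (hA1 : ∀ v, A v 1 = c * v 0 + d * v 1) :
    ∫ v : V1, fderiv ℝ g v (A v) = -((a + d) • ∫ v, g v) := by
  have hd : ∀ j, Continuous fun v => fderiv ℝ g v (Pi.single j 1) := fun j =>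
    (hg.continuous_fderiv (by simp)).clm_apply continuous_const
  have hdc : ∀ j, HasCompactSupport fun v => fderiv ℝ g v (Pi.single j 1) := fun j =>
    hc.fderiv_apply ℝ (Pi.single j 1)
  have hint : ∀ i j (r : ℝ), Integrable fun v : V1 => r • v i • fderiv ℝ g v (Pi.single j 1) :=
    fun i j r => (((continuous_apply i).smul (hd j)).integrable_of_hasCompactSupport
      (hdc j).smul_left).smul r
  have hexp : ∀ v : V1, fderiv ℝ g v (A v) =
      (a • v 0 • fderiv ℝ g v (Pi.single 0 1) + b • v 1 • fderiv ℝ g v (Pi.single 0 1)) +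
      (c • v 0 • fderiv ℝ g v (Pi.single 1 1) + d • v 1 • fderiv ℝ g v (Pi.single 1 1)) := by
    intro v
    have h : A v = (a * v 0 + b * v 1) • (Pi.single 0 1 : V1) +
        (c * v 0 + d * v 1) • (Pi.single 1 1 : V1) := by
      ext i
      fin_cases i <;> simp [hA0, hA1]
    rw [h, map_add, map_smul, map_smul]
    module
  simp only [hexp]
  have h1 : Integrable fun v : V1 => a • v 0 • fderiv ℝ g v (Pi.single 0 1) +
      b • v 1 • fderiv ℝ g v (Pi.single 0 1) := (hint 0 0 a).add (hint 1 0 b)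
  have h2 : Integrable fun v : V1 => c • v 0 • fderiv ℝ g v (Pi.single 1 1) +
      d • v 1 • fderiv ℝ g v (Pi.single 1 1) := (hint 0 1 c).add (hint 1 1 d)
  rw [integral_add h1 h2, integral_add (hint _ _ _) (hint _ _ _), integral_add (hint _ _ _) (hint _ _ _)]
  simp only [integral_smul, integral_coord_smul_fderiv hg hc]
  simp
  module

end Divergence

end SlTwo

end

noncomputable section

namespace SlTwo

open scoped ContDiff

open Filter Topology

/-! ### The cone integral: invariance, homogeneity and nonvanishing. -/

section ConeFunctional

variable {V : Type*} [NormedAddCommGroup V] [NormedSpace ℝ V] [LieRingModule Sl2 V]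
  [LieModule ℝ Sl2 V] {m : ℕ} {σ : ℝ} {U : Opens Sl2}

/-- The value of `s_n` along the parametrization of a half cone. -/
def sVal (e : V ≃ₗ⁅ℝ, Sl2⁆ powComp m) (σ : ℝ) (v : V1) : V :=
  sMap e ⟨cone σ v, cone_mem_nilCone σ v⟩

theorem map_lie_symm (e : V ≃ₗ⁅ℝ, Sl2⁆ powComp m) (Z : Sl2) (w : powComp m) :
    e.symm ⁅Z, w⁆ = ⁅Z, e.symm w⁆ := e.symm.toLieModuleHom.map_lie Z w

theorem exists_extend_symm (e : V ≃ₗ⁅ℝ, Sl2⁆ powComp m) :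
    ∃ q : SymSl2 →ₗ[ℝ] V, ∀ w : powComp m, q w = e.symm w := by
  obtain ⟨q, hq⟩ := LinearMap.exists_extend
    (p := (powComp m).toSubmodule) (e.symm : powComp m →ₗ[ℝ] V)
  exact ⟨q, fun w => DFunLike.congr_fun hq w⟩

theorem sVal_eq {e : V ≃ₗ⁅ℝ, Sl2⁆ powComp m} {q : SymSl2 →ₗ[ℝ] V}
    (hq : ∀ w : powComp m, q w = e.symm w) (σ : ℝ) (v : V1) :
    sVal e σ v = q (inc (cone σ v) ^ m) :=
  (hq (nilPow m ⟨cone σ v, cone_mem_nilCone σ v⟩)).symm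

theorem contDiff_sVal (e : V ≃ₗ⁅ℝ, Sl2⁆ powComp m) : ContDiff ℝ ∞ (sVal e σ) := by
  obtain ⟨q, hq⟩ := exists_extend_symm e
  rw [funext (sVal_eq hq σ)]
  exact (contDiff_apply_inc_pow m q).comp contDiff_cone

theorem hasDerivAt_sVal_act (e : V ≃ₗ⁅ℝ, Sl2⁆ powComp m) (Z : Sl2) (v : V1) :
    HasDerivAt (fun t : ℝ => sVal e σ (v + t • act Z v)) ⁅Z, sVal e σ v⁆ 0 := by
  obtain ⟨q, hq⟩ := exists_extend_symm e
  simp only [sVal_eq hq]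
  refine (hasDerivAt_apply_inc_pow m q (hasDerivAt_cone_act (σ := σ) Z v)).congr_deriv ?_
  rw [zero_smul, add_zero, ← lie_inc_pow, ← sVal_eq hq]
  have := hq ⁅Z, nilPow m ⟨cone σ v, cone_mem_nilCone σ v⟩⁆
  rw [map_lie_symm] at this
  exact this

theorem hasDerivAt_sVal_self (e : V ≃ₗ⁅ℝ, Sl2⁆ powComp m) (v : V1) :
    HasDerivAt (fun t : ℝ => sVal e σ (v + t • v)) ((2 * m : ℝ) • sVal e σ v) 0 := by
  obtain ⟨q, hq⟩ := exists_extend_symm e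
  simp only [sVal_eq hq]
  refine (hasDerivAt_apply_inc_pow m q (hasDerivAt_cone_self (σ := σ) v)).congr_deriv ?_
  rw [zero_smul, add_zero, ← map_smul, map_smul inc, mul_smul_comm]
  congr 1
  cases m with
  | zero => simp
  | succ m =>
    rw [Nat.add_sub_cancel, ← pow_succ]
    module

/-- `ψ` is the integral of test functions against `s_n` over the half cone of sign `σ`. -/
def IsConeInt (e : V ≃ₗ⁅ℝ, Sl2⁆ powComp m) (σ : ℝ) (ψ : 𝓓(U, ℝ) →ₗ[ℝ] V) : Prop :=
  ∀ f : 𝓓(U, ℝ), ψ f = (2 : ℝ) • ∫ v : V1, f (cone σ v) • sVal e σ v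

theorem hasCompactSupport_comp_cone (hσ : σ * σ = 1) (f : 𝓓(U, ℝ)) :
    HasCompactSupport fun v => f (cone σ v) :=
  HasCompactSupport.intro (isCompact_preimage_cone hσ f.hasCompactSupport.isCompact)
    fun _ hv => image_eq_zero_of_notMem_tsupport hv

theorem integrable_cone {W : Type*} [NormedAddCommGroup W] [NormedSpace ℝ W] (hσ : σ * σ = 1)
    (f : 𝓓(U, ℝ)) {r : V1 → W} (hr : Continuous r) :
    Integrable fun v => f (cone σ v) • r v :=
  ((f.continuous.comp contDiff_cone.continuous).smul hr).integrable_of_hasCompactSupport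
    (hasCompactSupport_comp_cone hσ f).smul_right

theorem fderiv_cone_smul (e : V ≃ₗ⁅ℝ, Sl2⁆ powComp m) (f : 𝓓(U, ℝ)) {v w : V1} {c : Sl2} {s' : V}
    (hc : HasDerivAt (fun t : ℝ => cone σ (v + t • w)) c 0)
    (hs : HasDerivAt (fun t : ℝ => sVal e σ (v + t • w)) s' 0) :
    fderiv ℝ (fun v => f (cone σ v) • sVal e σ v) v w =
      fderiv ℝ f (cone σ v) c • sVal e σ v + f (cone σ v) • s' := by
  have hg : ContDiff ℝ ∞ fun v => f (cone σ v) • sVal e σ v :=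
    ((contDiff_test f).comp contDiff_cone).smul (contDiff_sVal e)
  have hline : HasDerivAt (fun t : ℝ => v + t • w) w 0 := by
    simpa using ((hasDerivAt_id (0 : ℝ)).smul_const w).const_add v
  have h0 : v + (0 : ℝ) • w = v := by simp
  have h1 : HasDerivAt (fun t : ℝ => f (cone σ (v + t • w)) • sVal e σ (v + t • w))
      (fderiv ℝ (fun v => f (cone σ v) • sVal e σ v) v w) 0 :=
    (hg.differentiable (by simp) v).hasFDerivAt.comp_hasDerivAt_of_eq 0 hline h0.symm
  have h2 : HasDerivAt (fun t : ℝ => f (cone σ (v + t • w))) (fderiv ℝ f (cone σ v) c) 0 :=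
    (differentiable_test f _).hasFDerivAt.comp_hasDerivAt_of_eq 0 hc (by rw [h0])
  rw [h1.unique (h2.fun_smul hs), h0, add_comm]

theorem integral_fderiv_cone_smul (hσ : σ * σ = 1) (e : V ≃ₗ⁅ℝ, Sl2⁆ powComp m) (f : 𝓓(U, ℝ))
    (A : V1 → V1) (a b c d : ℝ) (hA0 : ∀ v, A v 0 = a * v 0 + b * v 1)
    (hA1 : ∀ v, A v 1 = c * v 0 + d * v 1) :
    Integrable (fun v : V1 => fderiv ℝ (fun v => f (cone σ v) • sVal e σ v) v (A v)) ∧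
    ∫ v : V1, fderiv ℝ (fun v => f (cone σ v) • sVal e σ v) v (A v) =
      -((a + d) • ∫ v, f (cone σ v) • sVal e σ v) := by
  have hg : ContDiff ℝ ∞ fun v => f (cone σ v) • sVal e σ v :=
    ((contDiff_test f).comp contDiff_cone).smul (contDiff_sVal e)
  have hc : HasCompactSupport fun v => f (cone σ v) • sVal e σ v :=
    (hasCompactSupport_comp_cone hσ f).smul_right
  refine ⟨?_, integral_fderiv_linear hg hc A a b c d hA0 hA1⟩
  have hA : Continuous A := by
    refine continuous_pi fun i => ?_
    fin_cases i
    · simp only [Fin.zero_eta, hA0]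
      fun_prop
    · simp only [Fin.mk_one, hA1]
      fun_prop
  refine ((hg.continuous_fderiv (by simp)).clm_apply hA).integrable_of_hasCompactSupport ?_
  refine (hc.fderiv ℝ).mono fun v hv hv' => hv ?_
  change fderiv ℝ (fun v => f (cone σ v) • sVal e σ v) v (A v) = 0
  rw [hv']
  rfl

variable {e : V ≃ₗ⁅ℝ, Sl2⁆ powComp m} {ψ : 𝓓(U, ℝ) →ₗ[ℝ] V}

/-- The field v ↦ Zv has trace zero, so the integral of a derivative along it vanishes; by the
product rule this derivative combines -ℒ_Z f and the action of Z on s_n. -/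
theorem IsConeInt.isInv [FiniteDimensional ℝ V] (hψ : IsConeInt e σ ψ) (hσ : σ * σ = 1) :
    IsInv ψ := by
  intro Z f
  let L : V →L[ℝ] V := LinearMap.toContinuousLinearMap (LieModule.toEnd ℝ Sl2 V Z)
  have hL : ∀ w, ⁅Z, w⁆ = L w := fun w => rfl
  obtain ⟨h1, h2⟩ := integral_fderiv_cone_smul hσ e f (act Z) _ _ _ _
    (fun v => act_zero Z v) (fun v => (act_one Z v).trans (by rw [sub_eq_add_neg, ← neg_mul]))
  have h3 : ∀ v, lieT Z f (cone σ v) • sVal e σ v = f (cone σ v) • L (sVal e σ v) -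
      fderiv ℝ (fun v => f (cone σ v) • sVal e σ v) v (act Z v) := by
    intro v
    rw [fderiv_cone_smul e f (hasDerivAt_cone_act Z v) (hasDerivAt_sVal_act e Z v), lieT_apply,
      map_neg, hL]
    module
  rw [hψ, hψ, lie_smul, hL, ← L.integral_comp_comm (integrable_cone hσ f
    (contDiff_sVal e).continuous)]
  congr 1
  have h4 : Integrable fun v => f (cone σ v) • L (sVal e σ v) :=
    integrable_cone hσ f (L.continuous.comp (contDiff_sVal e).continuous)
  simp only [h3]
  rw [integral_sub h4 h1, h2]
  simp

/-- Along the radial field of the plane, of divergence 2, f pulled back to the plane is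
differentiated by 2E and s_n, of degree 2m in v, is multiplied by 2m. Hence -(2 + 2m)/2. -/
theorem IsConeInt.apply_eulT (hψ : IsConeInt e σ ψ) (hσ : σ * σ = 1) (f : 𝓓(U, ℝ)) :
    ψ (eulT f) = -((m : ℝ) + 1) • ψ f := by
  obtain ⟨h1, h2⟩ := integral_fderiv_cone_smul hσ e f id 1 0 0 1 (by simp) (by simp)
  have h3 : ∀ v, eulT f (cone σ v) • sVal e σ v = (1 / 2 : ℝ) •
      (fderiv ℝ (fun v => f (cone σ v) • sVal e σ v) v (id v) -
        (2 * m : ℝ) • f (cone σ v) • sVal e σ v) := by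
    intro v
    rw [id, fderiv_cone_smul e f (hasDerivAt_cone_self v) (hasDerivAt_sVal_self e v), eulT_apply,
      map_smul]
    module
  have h4 : Integrable fun v => (2 * m : ℝ) • f (cone σ v) • sVal e σ v :=
    (integrable_cone hσ f (contDiff_sVal e).continuous).smul _
  rw [hψ, hψ]
  simp only [h3]
  rw [integral_smul, integral_sub h1 h4, h2, integral_smul]
  module

theorem IsConeInt.apply_eq_zero (hψ : IsConeInt e σ ψ) {f : 𝓓(U, ℝ)}
    (hf : ∀ v, f (cone σ v) = 0) : ψ f = 0 := by
  rw [hψ]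
  simp [hf]

theorem IsConeInt.apply_quadT (hψ : IsConeInt e σ ψ) (f : 𝓓(U, ℝ)) : ψ (quadT f) = 0 :=
  hψ.apply_eq_zero fun v => by rw [quadT_apply, quad_cone, zero_mul]

/-- Points of the half cone with v 0 ≠ 0 are conjugate to σX, so they are not in U; the line v 0 = 0
is negligible. -/
theorem IsConeInt.eq_zero (hψ : IsConeInt e σ ψ) (hσ : σ * σ = 1)
    (hU : IsAdInvariant (U : Set Sl2)) (h0 : par σ (0, 0, 0) ∉ U) : ψ = 0 := by
  ext f
  rw [hψ]
  have hae : ∀ᵐ v : V1, v 0 ≠ 0 := by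
    rw [ae_iff]
    simp only [ne_eq, not_not]
    exact Measure.pi_hyperplane (fun _ : Fin 2 => (volume : Measure ℝ)) 0 0
  rw [integral_eq_zero_of_ae, smul_zero]
  · rfl
  filter_upwards [hae] with v hv
  have hpos : 0 < σ * xL (cone σ v) := by
    rw [xL_cone, ← mul_assoc, hσ, one_mul]
    positivity
  have : f (cone σ v) = 0 := by
    refine image_eq_zero_of_notMem_tsupport fun h => h0 ?_
    have h1 : cone σ v ∈ U := f.tsupport_subset h
    rw [← par_parInv hσ hpos, par_mem_iff hU] at h1
    have h2 : (parInv σ (cone σ v)).2.2 = 0 := quad_cone v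
    rwa [h2] at h1
  rw [this, zero_smul]
  rfl

variable {v₀ : V}

/-- As `top` kills the image of Y, its value on s_n is constant along v + tYv. The time t = -v₁/v₀
reaches (v₀, 0), where the cone point is a multiple of X. -/
theorem top_sVal (hv : IsHighestWeightGenerator (2 * m) v₀) (e : V ≃ₗ⁅ℝ, Sl2⁆ powComp m)
    {v : V1} (h0 : v 0 ≠ 0) : hv.top (sVal e σ v) =
      (σ * (v 0 ^ 2 / 2)) ^ m * hv.top (e.symm (orbitCoeff m 0)) := by
  have : FiniteDimensional ℝ V := hv.basis.finiteDimensional_of_finite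
  let L : V →L[ℝ] ℝ := LinearMap.toContinuousLinearMap hv.top
  have hact : ∀ w : V1, act Y w 0 = 0 ∧ act Y w 1 = w 0 := fun w => by
    simp [act_zero, act_one]
  have hd : ∀ t : ℝ, HasDerivAt (fun t : ℝ => L (sVal e σ (v + t • act Y v))) 0 t := by
    intro t
    set w := v + t • act Y v with hw
    -- Y has square zero on V₁, so the straight line is the orbit and the derivative at any time
    -- reduces to the derivative at 0.
    have hww : act Y w = act Y v := by
      ext i
      fin_cases i
      · simp [hact]
      · simp [hact, hw]
    have h1 := L.hasFDerivAt.comp_hasDerivAt (0 : ℝ) (hasDerivAt_sVal_act (σ := σ) e Y w)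
    have h2 : L ⁅Y, sVal e σ w⁆ = 0 := hv.top_lie_Y _
    rw [h2, hww] at h1
    have h3 : HasDerivAt (fun s : ℝ => s - t) 1 t := (hasDerivAt_id' t).sub_const t
    have h4 := HasDerivAt.comp_of_eq t h1 h3 (sub_self t).symm
    rw [zero_mul] at h4
    refine h4.congr_of_eventuallyEq (Eventually.of_forall fun s => ?_)
    simp only [Function.comp_apply, hw]
    congr 2
    module
  have hconst := is_const_of_deriv_eq_zero (fun t => (hd t).differentiableAt)
    (fun t => (hd t).deriv) 0 (-v 1 / v 0)
  rw [zero_smul, add_zero] at hconst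
  change L (sVal e σ v) = _
  rw [hconst]
  obtain ⟨q, hq⟩ := exists_extend_symm e
  have hX : cone σ (v + (-v 1 / v 0) • act Y v) = (σ * (v 0 ^ 2 / 2)) • X := by
    apply ext_L
    · rw [hL_cone]
      simp [hact]
      field_simp
      simp
    · rw [xL_cone]
      simp [hact]
    · rw [yL_cone]
      simp [hact]
      field_simp
      simp
  have hcoe : ((orbitCoeff m 0 : powComp m) : SymSl2) = inc X ^ m := orbitPoly_pow_coeff_zero m
  rw [sVal_eq hq, hX, map_smul inc, smul_pow, map_smul, ← hcoe, hq, map_smul]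
  rfl

/-- X kills X^m, so if `top` also vanished on it, all covectors top ∘ X^k would. -/
theorem top_symm_orbitCoeff_ne_zero (hv : IsHighestWeightGenerator (2 * m) v₀)
    (e : V ≃ₗ⁅ℝ, Sl2⁆ powComp m) : hv.top (e.symm (orbitCoeff m 0)) ≠ 0 := by
  have hg := isHighestWeightGenerator_powComp m
  intro h
  have h1 : ⁅X, e.symm (orbitCoeff m 0)⁆ = 0 := by
    rw [← map_lie_symm, hg.lie_X, map_zero]
  have h2 : e.symm (orbitCoeff m 0) = 0 := by
    refine hv.eq_zero_of_top_pow fun k => ?_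
    cases k with
    | zero => simpa using h
    | succ k =>
      rw [pow_succ, Module.End.mul_apply, LieModule.toEnd_apply_apply, h1, map_zero, map_zero]
  exact hg.ne_zero (e.symm.injective (h2.trans (map_zero _).symm))

/-- Take a nonnegative bump near σX: by `top_sVal` the top component of the integrand is a nonzero
constant times a nonnegative function. -/
theorem IsConeInt.exists_top_ne_zero (hψ : IsConeInt e σ ψ) (hσ : σ * σ = 1)
    (hv : IsHighestWeightGenerator (2 * m) v₀) (h0 : par σ (0, 0, 0) ∈ U) :
    ∃ f : 𝓓(U, ℝ), tsupport f ⊆ {Z | 0 < σ * xL Z} ∧ hv.top (ψ f) ≠ 0 := by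
  have : FiniteDimensional ℝ V := hv.basis.finiteDimensional_of_finite
  have hmem : {par σ (0, 0, 0)} ⊆ (U : Set Sl2) ∩ {Z | 0 < σ * xL Z} :=
    Set.singleton_subset_iff.2 ⟨h0, xL_par_pos hσ _⟩
  obtain ⟨χ, h1, h2, h3, h4, h5⟩ := exists_cutoff isCompact_singleton
    (U.isOpen.inter (isOpen_halfSpace (σ := σ))) hmem
  let f : 𝓓(U, ℝ) := ⟨χ, h1, h2, h3.trans Set.inter_subset_left⟩
  have hfs : tsupport f ⊆ {Z | 0 < σ * xL Z} := h3.trans Set.inter_subset_right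
  refine ⟨f, hfs, ?_⟩
  set κ := hv.top (e.symm (orbitCoeff m 0)) with hκ
  let L : V →L[ℝ] ℝ := LinearMap.toContinuousLinearMap hv.top
  have hpt : ∀ v : V1, L (f (cone σ v) • sVal e σ v) =
      (σ ^ m * κ) * (f (cone σ v) * (v 0 ^ 2 / 2) ^ m) := by
    intro v
    rw [map_smul, smul_eq_mul]
    by_cases hv0 : v 0 = 0
    · have : f (cone σ v) = 0 := by
        refine image_eq_zero_of_notMem_tsupport fun h => ?_
        have : 0 < σ * xL (cone σ v) := hfs h
        rw [xL_cone, hv0] at this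
        simp at this
      rw [this]
      ring
    · change f (cone σ v) * hv.top (sVal e σ v) = _
      rw [top_sVal hv e hv0, mul_pow]
      ring
  have hval : hv.top (ψ f) = 2 * ((σ ^ m * κ) * ∫ v : V1, f (cone σ v) * (v 0 ^ 2 / 2) ^ m) := by
    rw [hψ, map_smul, smul_eq_mul]
    change 2 * L _ = _
    rw [← L.integral_comp_comm (integrable_cone hσ f (contDiff_sVal e).continuous)]
    simp only [hpt]
    rw [integral_const_mul]
  rw [hval]
  have hσ0 : σ ≠ 0 := left_ne_zero_of_mul (hσ.trans_ne one_ne_zero)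
  refine mul_ne_zero two_ne_zero (mul_ne_zero (mul_ne_zero (pow_ne_zero _ hσ0)
    (top_symm_orbitCoeff_ne_zero hv e)) (ne_of_gt ?_))
  -- Since x = σ v₀²/2 on the cone, the vector (√2, 0) is sent to σX.
  refine Continuous.integral_pos_of_hasCompactSupport_nonneg_nonzero (x := ![√2, 0]) ?_ ?_ ?_ ?_
  · exact (f.continuous.comp contDiff_cone.continuous).mul (by fun_prop)
  · exact (hasCompactSupport_comp_cone hσ f).mul_right
  · intro v
    have := h5 (cone σ v)
    exact mul_nonneg this (by positivity)
  · have hc : cone σ ![√2, 0] = par σ (0, 0, 0) := by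
      apply ext_L
      · simp [hL_cone, par]
      · simp [xL_cone, par]
      · simp [yL_cone, par]
    have h6 : f (cone σ ![√2, 0]) = 1 := by
      rw [hc]
      exact h4.self_of_nhdsSet _ rfl
    rw [h6]
    simp

end ConeFunctional

end SlTwo

end

noncomputable section

namespace SlTwo

open scoped ContDiff

variable {U : Opens Sl2} {V : Type*} [NormedAddCommGroup V] [NormedSpace ℝ V]
  [LieRingModule Sl2 V] [LieModule ℝ Sl2 V] {m : ℕ} {σ : ℝ}

/-! ### Comparison of 𝒮 with the cone family on each half space. -/

theorem mem_invVanishingOff_iff {C : Set Sl2} (φ : 𝓓'(U, V)) :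
    φ ∈ invVanishingOff U V C ↔ IsInv (φ : 𝓓(U, ℝ) →ₗ[ℝ] V) ∧
      ∀ f : 𝓓(U, ℝ), (∀ Z ∈ tsupport f, Z ∉ C) → φ f = 0 := by
  rw [← isLocallyInvariant_iff]
  exact and_congr_right fun _ => forall_congr' fun f =>
    ⟨fun h hf => h fun Z hZ => ⟨f.tsupport_subset hZ, hf Z hZ⟩, fun h hf => h fun Z hZ => (hf hZ).2⟩

theorem invVanishingOff_mono {C C' : Set Sl2} (h : C ⊆ C') :
    invVanishingOff U V C ≤ invVanishingOff U V C' := by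
  intro φ hφ
  rw [mem_invVanishingOff_iff] at hφ ⊢
  exact ⟨hφ.1, fun f hf => hφ.2 f fun Z hZ hC => hf Z hZ (h hC)⟩

theorem mem_nilCone_iff_quad {Z : Sl2} : Z ∈ nilCone ↔ quad Z = 0 := mem_nilCone_iff Z

theorem nilConePos_union_subset : nilConePos ∪ {0} ⊆ nilCone := by
  rintro Z (hZ | rfl)
  · exact (mem_nilCone_iff Z).2 hZ.1
  · rw [mem_nilCone_iff_quad]
    simp [quad]

theorem nilConeNeg_union_subset : nilConeNeg ∪ {0} ⊆ nilCone := by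
  rintro Z (hZ | rfl)
  · exact (mem_nilCone_iff Z).2 hZ.1
  · rw [mem_nilCone_iff_quad]
    simp [quad]

theorem cone_one (v : V1) : cone 1 v = moment v := one_smul ℝ _

theorem cone_neg_one (v : V1) : cone (-1) v = -moment v := neg_one_smul ℝ _

theorem cone_one_mem (v : V1) : cone 1 v ∈ nilConePos ∪ {0} := by
  by_cases hv : v 0 ^ 2 + v 1 ^ 2 = 0
  · right
    have h0 : v 0 = 0 := by nlinarith [sq_nonneg (v 0), sq_nonneg (v 1)]
    have h1 : v 1 = 0 := by nlinarith [sq_nonneg (v 0), sq_nonneg (v 1)]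
    refine ext_L ?_ ?_ ?_ <;> simp [hL_cone, xL_cone, yL_cone, h0, h1]
  · left
    refine ⟨quad_cone v, ?_⟩
    rw [← xL_apply, ← yL_apply, xL_cone, yL_cone]
    have := lt_of_le_of_ne (by positivity) (Ne.symm hv)
    linarith

theorem cone_neg_one_mem (v : V1) : cone (-1) v ∈ nilConeNeg ∪ {0} := by
  by_cases hv : v 0 ^ 2 + v 1 ^ 2 = 0
  · right
    have h0 : v 0 = 0 := by nlinarith [sq_nonneg (v 0), sq_nonneg (v 1)]
    have h1 : v 1 = 0 := by nlinarith [sq_nonneg (v 0), sq_nonneg (v 1)]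
    refine ext_L ?_ ?_ ?_ <;> simp [hL_cone, xL_cone, yL_cone, h0, h1]
  · left
    refine ⟨quad_cone v, ?_⟩
    rw [← xL_apply, ← yL_apply, xL_cone, yL_cone]
    have := lt_of_le_of_ne (by positivity) (Ne.symm hv)
    linarith

theorem notMem_halfSpace_of_mem_nilConePos {Z : Sl2} (hZ : Z ∈ nilConePos ∪ {0}) :
    ¬ 0 < -1 * xL Z := by
  rintro h
  rcases hZ with ⟨h1, h2⟩ | rfl
  · rw [xL_apply] at h
    nlinarith [sq_nonneg (hCoord Z)]
  · simp at h

theorem notMem_halfSpace_of_mem_nilConeNeg {Z : Sl2} (hZ : Z ∈ nilConeNeg ∪ {0}) :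
    ¬ 0 < 1 * xL Z := by
  rintro h
  rcases hZ with ⟨h1, h2⟩ | rfl
  · rw [xL_apply] at h
    nlinarith [sq_nonneg (hCoord Z)]
  · simp at h

theorem isConeInt_sDeltaPos (e : V ≃ₗ⁅ℝ, Sl2⁆ powComp m) :
    IsConeInt e 1 (restr U V (sDeltaPos e) : 𝓓(U, ℝ) →ₗ[ℝ] V) := by
  intro f
  set g : 𝓓((⊤ : Opens Sl2), ℝ) := mkTest f (contDiff_test f) f.hasCompactSupport
    (Set.subset_univ _) fun x hx => image_eq_zero_of_notMem_tsupport hx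
  change restr U V (sDeltaPos e) f = _
  rw [restr_apply _ f g rfl, sDeltaPos_apply]
  simp only [cone_one, sVal]
  rfl

theorem isConeInt_sDeltaNeg (e : V ≃ₗ⁅ℝ, Sl2⁆ powComp m) :
    IsConeInt e (-1) (restr U V (sDeltaNeg e) : 𝓓(U, ℝ) →ₗ[ℝ] V) := by
  intro f
  set g : 𝓓((⊤ : Opens Sl2), ℝ) := mkTest f (contDiff_test f) f.hasCompactSupport
    (Set.subset_univ _) fun x hx => image_eq_zero_of_notMem_tsupport hx
  change restr U V (sDeltaNeg e) f = _
  rw [restr_apply _ f g rfl, sDeltaNeg_apply]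
  simp only [cone_neg_one, sVal]
  rfl

section Family

variable {e : V ≃ₗ⁅ℝ, Sl2⁆ powComp m} {ψ : 𝓓(U, ℝ) →ₗ[ℝ] V} {T : ℕ → 𝓓'(U, V)} {v₀ : V}

theorem span_le_invVanishingOff [FiniteDimensional ℝ V] (hψ : IsConeInt e σ ψ) (hσ : σ * σ = 1)
    (hT : ∀ k f, T k f = ψ ((boxT ^ k) f)) {C : Set Sl2} (hC : ∀ v, cone σ v ∈ C) :
    Submodule.span ℝ (Set.range T) ≤ invVanishingOff U V C := by
  rw [Submodule.span_le]
  rintro _ ⟨k, rfl⟩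
  rw [SetLike.mem_coe, mem_invVanishingOff_iff]
  have h : (T k : 𝓓(U, ℝ) →ₗ[ℝ] V) = ψ ∘ₗ boxT ^ k := LinearMap.ext (hT k)
  refine ⟨h ▸ (hψ.isInv hσ).comp_boxT_pow k, fun f hf => ?_⟩
  rw [hT]
  exact hψ.apply_eq_zero fun v => image_eq_zero_of_notMem_tsupport fun hv =>
    hf _ (tsupport_boxT_pow_subset k f hv) (hC v)

/-- Testing a combination on q^K f, with K its largest index, kills all lower terms and leaves a
nonzero multiple of ψ(f); this contradicts vanishing on the half space. If U misses the half cone,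
the whole span is zero. -/
theorem eq_zero_of_mem_span (hψ : IsConeInt e σ ψ) (hσ : σ * σ = 1)
    (hU : IsAdInvariant (U : Set Sl2)) (hv : IsHighestWeightGenerator (2 * m) v₀)
    (hT : ∀ k f, T k f = ψ ((boxT ^ k) f)) {p : 𝓓'(U, V)}
    (hp : p ∈ Submodule.span ℝ (Set.range T))
    (h : ∀ f : 𝓓(U, ℝ), tsupport f ⊆ {Z | 0 < σ * xL Z} → p f = 0) : p = 0 := by
  by_cases h0 : par σ (0, 0, 0) ∈ U
  · obtain ⟨f₁, hf₁, h1⟩ := hψ.exists_top_ne_zero hσ hv h0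
    obtain ⟨c, rfl⟩ := (Finsupp.mem_span_range_iff_exists_finsupp).1 hp
    by_contra hne
    have hc : c.support.Nonempty := by
      rw [Finsupp.support_nonempty_iff]
      rintro rfl
      simp at hne
    obtain ⟨K, hK, hmax⟩ : ∃ K ∈ c.support, ∀ k ∈ c.support, k ≤ K :=
      ⟨c.support.max' hc, c.support.max'_mem hc, fun k hk => c.support.le_max' k hk⟩
    obtain ⟨d, hd, hd1⟩ := apply_boxT_pow_quadT_pow (hψ.apply_eulT hσ) hψ.apply_quadT K
    have h2 := h ((quadT ^ K) f₁) ((tsupport_quadT_pow_subset K f₁).trans hf₁)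
    have hev : ∀ (s : Finset ℕ) (f : 𝓓(U, ℝ)),
        (∑ k ∈ s, c k • T k) f = ∑ k ∈ s, c k • T k f := by
      intro s f
      induction s using Finset.induction_on with
      | empty => rfl
      | insert a s ha ih =>
        rw [Finset.sum_insert ha, Finset.sum_insert ha, ← ih]
        rfl
    rw [Finsupp.sum, hev, Finset.sum_eq_single_of_mem K hK, hT, hd1] at h2
    · refine h1 ?_
      have : ψ f₁ = 0 := by
        rw [smul_smul] at h2
        exact (smul_eq_zero.1 h2).resolve_left (mul_ne_zero (Finsupp.mem_support_iff.1 hK) hd)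
      rw [this, map_zero]
    · intro k hk hkK
      rw [hT, apply_boxT_pow_quadT_pow_of_lt (hψ.apply_eulT hσ) hψ.apply_quadT
        (lt_of_le_of_ne (hmax k hk) hkK), smul_zero]
  · have hz := hψ.eq_zero hσ hU h0
    have hT0 : ∀ k, T k = 0 := fun k => by
      ext f
      rw [hT, hz]
      rfl
    have : Submodule.span ℝ (Set.range T) = ⊥ := by
      rw [Submodule.span_eq_bot]
      rintro _ ⟨k, rfl⟩
      exact hT0 k
    rwa [this, Submodule.mem_bot] at hp

theorem exists_mem_span [FiniteDimensional ℝ V] (hψ : IsConeInt e σ ψ) (hσ : σ * σ = 1)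
    (hU : IsAdInvariant (U : Set Sl2)) (hv : IsHighestWeightGenerator (2 * m) v₀)
    (hT : ∀ k f, T k f = ψ ((boxT ^ k) f)) {φ : 𝓓'(U, V)} (hφ : φ ∈ S U V) :
    ∃ p ∈ Submodule.span ℝ (Set.range T),
      ∀ f : 𝓓(U, ℝ), tsupport f ⊆ {Z | 0 < σ * xL Z} → φ f = p f := by
  have hTS : ∀ k, T k ∈ S U V := fun k => span_le_invVanishingOff hψ hσ hT
    (fun v => cone_mem_nilCone σ v) (Submodule.subset_span ⟨k, rfl⟩)
  -- Induction on the power of q that kills the top component. At N + 1 the functional f ↦ top φ(q^N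
  -- f) is killed by q, hence equals c · top ψ; since ψ(□^N q^N f) = d ψ(f), subtracting (c/d) □^N ψ
  -- lowers the power.
  have key : ∀ N, ∀ φ ∈ S U V,
      (∀ f : 𝓓(U, ℝ), tsupport f ⊆ {Z | 0 < σ * xL Z} → hv.top (φ ((quadT ^ N) f)) = 0) →
      ∃ p ∈ Submodule.span ℝ (Set.range T),
        ∀ f : 𝓓(U, ℝ), tsupport f ⊆ {Z | 0 < σ * xL Z} → φ f = p f := by
    intro N
    induction N with
    | zero =>
      intro φ hφ h
      exact ⟨0, zero_mem _, ((mem_invVanishingOff_iff φ).1 hφ).1.isVanishingOn_of_top hv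
        (O := {Z | 0 < σ * xL Z}) h⟩
    | succ N ih =>
      intro φ hφ h
      have hinv := ((mem_invVanishingOff_iff φ).1 hφ).1
      have hi₁ := hinv.comp_quadT_pow N
      have hi₂ := hψ.isInv hσ
      have hq₁ : ∀ f : 𝓓(U, ℝ), tsupport f ⊆ {Z | 0 < σ * xL Z} →
          (hv.top ∘ₗ ((φ : 𝓓(U, ℝ) →ₗ[ℝ] V) ∘ₗ quadT ^ N)) (quadT f) = 0 := fun f hf => by
        have := h f hf
        rwa [pow_succ] at this
      have hq₂ : ∀ f : 𝓓(U, ℝ), tsupport f ⊆ {Z | 0 < σ * xL Z} →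
          (hv.top ∘ₗ ψ) (quadT f) = 0 := fun f _ => by
        rw [LinearMap.comp_apply, hψ.apply_quadT, map_zero]
      obtain ⟨c, hc⟩ : ∃ c : ℝ, ∀ f : 𝓓(U, ℝ), tsupport f ⊆ {Z | 0 < σ * xL Z} →
          hv.top (φ ((quadT ^ N) f)) = c * hv.top (ψ f) := by
        by_cases h0 : par σ (0, 0, 0) ∈ U
        · obtain ⟨f₁, hf₁, h1⟩ := hψ.exists_top_ne_zero hσ hv h0
          exact ⟨_, fun f hf => apply_eq_mul hU hσ (hi₁.top_lieT_Y hv) (hi₁.top_lieT_H hv) hq₁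
            (hi₂.top_lieT_Y hv) (hi₂.top_lieT_H hv) hq₂ hf₁ h1 hf⟩
        · refine ⟨0, fun f hf => ?_⟩
          rw [zero_mul]
          exact apply_eq_zero_of_par_notMem hU hσ (hi₁.top_lieT_Y hv) (hi₁.top_lieT_H hv) hq₁ h0 hf
      obtain ⟨d, hd, hd1⟩ := apply_boxT_pow_quadT_pow (hψ.apply_eulT hσ) hψ.apply_quadT N
      obtain ⟨p, hp, hp1⟩ := ih (φ - (c / d) • T N) (sub_mem hφ (Submodule.smul_mem _ _ (hTS N)))
        fun f hf => by
          change hv.top (φ ((quadT ^ N) f) - (c / d) • T N ((quadT ^ N) f)) = 0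
          rw [hT, hd1, map_sub, hc f hf, map_smul, map_smul, smul_smul, smul_eq_mul,
            div_mul_cancel₀ _ hd, sub_self]
      refine ⟨p + (c / d) • T N, add_mem hp (Submodule.smul_mem _ _
        (Submodule.subset_span ⟨N, rfl⟩)), fun f hf => ?_⟩
      have := hp1 f hf
      change φ f - (c / d) • T N f = p f at this
      exact sub_eq_iff_eq_add.1 this
  obtain ⟨hinv, hvan⟩ := (mem_invVanishingOff_iff φ).1 hφ
  obtain ⟨N, hN⟩ := exists_quadT_pow_eq_zero hU hσ hinv
    (fun f hf => hvan f fun Z hZ hC => hf Z hZ (mem_nilCone_iff_quad.1 hC)) hv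
  exact key N φ hφ hN

end Family

/-- The regions ±x > 0, the regions ±y < 0 obtained from them by conjugation, and the complement of
the cone cover everything but the origin. -/
theorem mem_SZero_of_halfSpaces {n : ℕ} {v₀ : V} (hv : IsHighestWeightGenerator n v₀)
    (hU : IsAdInvariant (U : Set Sl2)) {φ : 𝓓'(U, V)} (hφ : φ ∈ S U V)
    (h1 : ∀ f : 𝓓(U, ℝ), tsupport f ⊆ {Z | 0 < 1 * xL Z} → φ f = 0)
    (h2 : ∀ f : 𝓓(U, ℝ), tsupport f ⊆ {Z | 0 < -1 * xL Z} → φ f = 0) : φ ∈ SZero U V := by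
  obtain ⟨hinv, hvan⟩ := (mem_invVanishingOff_iff φ).1 hφ
  refine (mem_SZero_iff φ).2 ⟨hinv, ?_⟩
  have h3 := hinv.isVanishingOn_of_halfSpace hU hv h1
  have h4 := hinv.isVanishingOn_of_halfSpace hU hv h2
  have h5 : Distribution.IsVanishingOn (φ : 𝓓(U, ℝ) →ₗ[ℝ] V) {Z | quad Z ≠ 0} :=
    fun f hf => hvan f fun Z hZ hC => hf hZ (mem_nilCone_iff_quad.1 hC)
  have o3 : ∀ τ : ℝ, IsOpen {Z : Sl2 | τ * yL Z < 0} := fun τ =>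
    isOpen_lt (by fun_prop) continuous_const
  have o5 : IsOpen {Z | quad Z ≠ 0} := isOpen_ne_fun contDiff_quad.continuous continuous_const
  have h12 := isVanishingOn_union _ isOpen_halfSpace isOpen_halfSpace h1 h2
  have h34 := isVanishingOn_union _ (o3 1) (o3 (-1)) h3 h4
  have h14 := isVanishingOn_union _ (isOpen_halfSpace.union isOpen_halfSpace)
    ((o3 1).union (o3 (-1))) h12 h34
  have h15 := isVanishingOn_union _ ((isOpen_halfSpace.union isOpen_halfSpace).union
    ((o3 1).union (o3 (-1)))) o5 h14 h5
  intro f hf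
  refine h15 f fun Z hZ => ?_
  by_contra hcon
  simp only [Set.mem_union, Set.mem_ofPred_eq, not_or, not_lt, not_not] at hcon
  obtain ⟨⟨⟨hx1, hx2⟩, hy1, hy2⟩, hq⟩ := hcon
  have hx : xL Z = 0 := by linarith
  have hy : yL Z = 0 := by linarith
  have hh : hL Z = 0 := by simpa [quad, hx] using hq
  exact hf (by rwa [show Z = 0 from ext_L (by simpa using hh) (by simpa using hx)
    (by simpa using hy)] at hZ)

theorem iSupIndep_of_add_eq_zero {R M : Type*} [Ring R] [AddCommGroup M] [Module R M]
    {A B C : Submodule R M}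
    (h : ∀ a ∈ A, ∀ b ∈ B, ∀ c ∈ C, a + b + c = 0 → a = 0 ∧ b = 0 ∧ c = 0) :
    iSupIndep ![A, B, C] := by
  rw [iSupIndep_iff_finsetSum_eq_zero_imp_eq_zero]
  intro s v hv h0 i hi
  set w : Fin 3 → M := fun i => if i ∈ s then v i else 0 with hw
  have hmem : ∀ i, w i ∈ ![A, B, C] i := fun i => by
    by_cases hi : i ∈ s
    · simpa [hw, hi] using hv i hi
    · simp [hw, hi]
  have hsum : w 0 + w 1 + w 2 = 0 := by
    rw [← Fin.sum_univ_three, ← h0, hw, Finset.sum_ite_mem, Finset.univ_inter]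
  have hwi : w i = v i := if_pos hi
  obtain ⟨ha, hb, hc⟩ := h _ (hmem 0) _ (hmem 1) _ (hmem 2) hsum
  rw [← hwi]
  fin_cases i
  exacts [ha, hb, hc]

end SlTwo
end

noncomputable section

namespace SlTwo

open scoped ContDiff

variable {U : Opens Sl2} {V : Type*} [NormedAddCommGroup V] [NormedSpace ℝ V]
  [FiniteDimensional ℝ V] [LieRingModule Sl2 V] [LieModule ℝ Sl2 V] {m : ℕ}
  {e : V ≃ₗ⁅ℝ, Sl2⁆ powComp m} {v₀ : V}

/-! ### The decompositions of 𝒮, 𝒮⁺ and 𝒮⁻. -/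

theorem SZero_le_S : SZero U V ≤ S U V :=
  invVanishingOff_mono (Set.subset_union_right.trans nilConePos_union_subset)

theorem spanPos_le_SPos (e : V ≃ₗ⁅ℝ, Sl2⁆ powComp m) : spanPos U e ≤ SPos U V :=
  span_le_invVanishingOff (isConeInt_sDeltaPos e) (mul_one 1)
    (restr_box_pow_apply (sDeltaPos e)) cone_one_mem

theorem spanNeg_le_SNeg (e : V ≃ₗ⁅ℝ, Sl2⁆ powComp m) : spanNeg U e ≤ SNeg U V :=
  span_le_invVanishingOff (isConeInt_sDeltaNeg e) (by norm_num)
    (restr_box_pow_apply (sDeltaNeg e)) cone_neg_one_mem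

theorem SPos_le_S : SPos U V ≤ S U V := invVanishingOff_mono nilConePos_union_subset

theorem SNeg_le_S : SNeg U V ≤ S U V := invVanishingOff_mono nilConeNeg_union_subset

theorem SZero_le_SPos : SZero U V ≤ SPos U V := invVanishingOff_mono Set.subset_union_right

theorem SZero_le_SNeg : SZero U V ≤ SNeg U V := invVanishingOff_mono Set.subset_union_right

theorem apply_eq_zero_of_mem_SPos {φ : 𝓓'(U, V)} (hφ : φ ∈ SPos U V) (f : 𝓓(U, ℝ))
    (hf : tsupport f ⊆ {Z | 0 < -1 * xL Z}) : φ f = 0 :=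
  ((mem_invVanishingOff_iff φ).1 hφ).2 f fun _ hZ hC =>
    notMem_halfSpace_of_mem_nilConePos hC (hf hZ)

theorem apply_eq_zero_of_mem_SNeg {φ : 𝓓'(U, V)} (hφ : φ ∈ SNeg U V) (f : 𝓓(U, ℝ))
    (hf : tsupport f ⊆ {Z | 0 < 1 * xL Z}) : φ f = 0 :=
  ((mem_invVanishingOff_iff φ).1 hφ).2 f fun _ hZ hC =>
    notMem_halfSpace_of_mem_nilConeNeg hC (hf hZ)

theorem exists_mem_spanPos (hU : IsAdInvariant (U : Set Sl2))
    (hv : IsHighestWeightGenerator (2 * m) v₀) (e : V ≃ₗ⁅ℝ, Sl2⁆ powComp m) {φ : 𝓓'(U, V)}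
    (hφ : φ ∈ S U V) :
    ∃ p ∈ spanPos U e, ∀ f : 𝓓(U, ℝ), tsupport f ⊆ {Z | 0 < 1 * xL Z} → φ f = p f :=
  exists_mem_span (isConeInt_sDeltaPos e) (mul_one 1) hU hv (restr_box_pow_apply (sDeltaPos e)) hφ

theorem exists_mem_spanNeg (hU : IsAdInvariant (U : Set Sl2))
    (hv : IsHighestWeightGenerator (2 * m) v₀) (e : V ≃ₗ⁅ℝ, Sl2⁆ powComp m) {φ : 𝓓'(U, V)}
    (hφ : φ ∈ S U V) :
    ∃ p ∈ spanNeg U e, ∀ f : 𝓓(U, ℝ), tsupport f ⊆ {Z | 0 < -1 * xL Z} → φ f = p f :=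
  exists_mem_span (isConeInt_sDeltaNeg e) (by norm_num) hU hv
    (restr_box_pow_apply (sDeltaNeg e)) hφ

theorem eq_zero_of_mem_spanPos (hU : IsAdInvariant (U : Set Sl2))
    (hv : IsHighestWeightGenerator (2 * m) v₀) {p : 𝓓'(U, V)} (hp : p ∈ spanPos U e)
    (h : ∀ f : 𝓓(U, ℝ), tsupport f ⊆ {Z | 0 < 1 * xL Z} → p f = 0) : p = 0 :=
  eq_zero_of_mem_span (isConeInt_sDeltaPos e) (mul_one 1) hU hv
    (restr_box_pow_apply (sDeltaPos e)) hp h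

theorem eq_zero_of_mem_spanNeg (hU : IsAdInvariant (U : Set Sl2))
    (hv : IsHighestWeightGenerator (2 * m) v₀) {p : 𝓓'(U, V)} (hp : p ∈ spanNeg U e)
    (h : ∀ f : 𝓓(U, ℝ), tsupport f ⊆ {Z | 0 < -1 * xL Z} → p f = 0) : p = 0 :=
  eq_zero_of_mem_span (isConeInt_sDeltaNeg e) (by norm_num) hU hv
    (restr_box_pow_apply (sDeltaNeg e)) hp h

/-- The positive family vanishes where x < 0 and the negative one where x > 0, so the two
corrections do not interfere and can be subtracted together. -/
theorem S_eq_sup (hU : IsAdInvariant (U : Set Sl2)) (hv : IsHighestWeightGenerator (2 * m) v₀)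
    (e : V ≃ₗ⁅ℝ, Sl2⁆ powComp m) : S U V = SZero U V ⊔ spanPos U e ⊔ spanNeg U e := by
  refine le_antisymm (fun φ hφ => ?_) (sup_le (sup_le SZero_le_S
    ((spanPos_le_SPos e).trans SPos_le_S)) ((spanNeg_le_SNeg e).trans SNeg_le_S))
  obtain ⟨p, hp, hpf⟩ := exists_mem_spanPos hU hv e hφ
  obtain ⟨q, hq, hqf⟩ := exists_mem_spanNeg hU hv e hφ
  have hpP := spanPos_le_SPos e hp
  have hqN := spanNeg_le_SNeg e hq
  have hz : φ - p - q ∈ SZero U V := by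
    refine mem_SZero_of_halfSpaces hv hU
      (sub_mem (sub_mem hφ (SPos_le_S hpP)) (SNeg_le_S hqN)) (fun f hf => ?_) fun f hf => ?_
    · change φ f - p f - q f = 0
      rw [hpf f hf, apply_eq_zero_of_mem_SNeg hqN f hf, sub_self, sub_zero]
    · change φ f - p f - q f = 0
      rw [hqf f hf, apply_eq_zero_of_mem_SPos hpP f hf, sub_zero, sub_self]
  rw [show φ = φ - p - q + p + q by abel]
  exact Submodule.add_mem_sup (Submodule.add_mem_sup hz hp) hq

theorem SPos_eq_sup (hU : IsAdInvariant (U : Set Sl2)) (hv : IsHighestWeightGenerator (2 * m) v₀)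
    (e : V ≃ₗ⁅ℝ, Sl2⁆ powComp m) : SPos U V = SZero U V ⊔ spanPos U e := by
  refine le_antisymm (fun φ hφ => ?_) (sup_le SZero_le_SPos (spanPos_le_SPos e))
  obtain ⟨p, hp, hpf⟩ := exists_mem_spanPos hU hv e (SPos_le_S hφ)
  have hd := sub_mem hφ (spanPos_le_SPos e hp)
  have hz : φ - p ∈ SZero U V := mem_SZero_of_halfSpaces hv hU (SPos_le_S hd)
    (fun f hf => sub_eq_zero.2 (hpf f hf)) (apply_eq_zero_of_mem_SPos hd)
  rw [← sub_add_cancel φ p]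
  exact Submodule.add_mem_sup hz hp

theorem SNeg_eq_sup (hU : IsAdInvariant (U : Set Sl2)) (hv : IsHighestWeightGenerator (2 * m) v₀)
    (e : V ≃ₗ⁅ℝ, Sl2⁆ powComp m) : SNeg U V = SZero U V ⊔ spanNeg U e := by
  refine le_antisymm (fun φ hφ => ?_) (sup_le SZero_le_SNeg (spanNeg_le_SNeg e))
  obtain ⟨p, hp, hpf⟩ := exists_mem_spanNeg hU hv e (SNeg_le_S hφ)
  have hd := sub_mem hφ (spanNeg_le_SNeg e hp)
  have hz : φ - p ∈ SZero U V := mem_SZero_of_halfSpaces hv hU (SNeg_le_S hd)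
    (apply_eq_zero_of_mem_SNeg hd) (fun f hf => sub_eq_zero.2 (hpf f hf))
  rw [← sub_add_cancel φ p]
  exact Submodule.add_mem_sup hz hp

/-- Restricted to either half space, only one of the three terms can be nonzero, and a member of a
cone span is determined by its restriction. -/
theorem eq_zero_of_add_eq_zero (hU : IsAdInvariant (U : Set Sl2))
    (hv : IsHighestWeightGenerator (2 * m) v₀) {z p q : 𝓓'(U, V)} (hz : z ∈ SZero U V)
    (hp : p ∈ spanPos U e) (hq : q ∈ spanNeg U e) (h : z + p + q = 0) :
    z = 0 ∧ p = 0 ∧ q = 0 := by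
  have hf : ∀ f, z f + p f + q f = 0 := fun f => DFunLike.congr_fun h f
  have hp0 : p = 0 := eq_zero_of_mem_spanPos hU hv hp fun f hs => by
    have := hf f
    rwa [apply_eq_zero_of_mem_SNeg (SZero_le_SNeg hz) f hs,
      apply_eq_zero_of_mem_SNeg (spanNeg_le_SNeg e hq) f hs, zero_add, add_zero] at this
  have hq0 : q = 0 := eq_zero_of_mem_spanNeg hU hv hq fun f hs => by
    have := hf f
    rwa [apply_eq_zero_of_mem_SPos (SZero_le_SPos hz) f hs,
      apply_eq_zero_of_mem_SPos (spanPos_le_SPos e hp) f hs, zero_add, zero_add] at this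
  refine ⟨?_, hp0, hq0⟩
  rwa [hp0, hq0, add_zero, add_zero] at h

theorem iSupIndep_SZero_spanPos_spanNeg (hU : IsAdInvariant (U : Set Sl2))
    (hv : IsHighestWeightGenerator (2 * m) v₀) (e : V ≃ₗ⁅ℝ, Sl2⁆ powComp m) :
    iSupIndep ![SZero U V, spanPos U e, spanNeg U e] :=
  iSupIndep_of_add_eq_zero fun _ hz _ hp _ hq => eq_zero_of_add_eq_zero hU hv hz hp hq

theorem invVanishingOff_eq_bot_of_odd {n : ℕ} (hn : Odd n) (hU : IsAdInvariant (U : Set Sl2))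
    (hv : IsHighestWeightGenerator n v₀) (C : Set Sl2) : invVanishingOff U V C = ⊥ := by
  refine (Submodule.eq_bot_iff _).2 fun φ hφ => ?_
  have := ((mem_invVanishingOff_iff φ).1 hφ).1.eq_zero_of_odd hv hn hU
  ext f
  exact LinearMap.congr_fun this f

end SlTwo
end

theorem mainTheorem3 (n : ℕ) (V : Type*) [NormedAddCommGroup V] [NormedSpace ℝ V]
    [FiniteDimensional ℝ V] [LieRingModule SlTwo.Sl2 V] [LieModule ℝ SlTwo.Sl2 V]
    (hV : SlTwo.IsIrrepOfHighestWeight n V)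
    (U : Opens SlTwo.Sl2) (hU : SlTwo.IsAdInvariant (U : Set SlTwo.Sl2)) :
    ((0 : SlTwo.Sl2) ∉ U → SlTwo.SZero U V = ⊥) ∧
    ((0 : SlTwo.Sl2) ∈ U →
      ∃ Φ : LieModule.maxTrivSubmodule ℝ SlTwo.Sl2 (V ⊗[ℝ] SlTwo.SymSl2) ≃ₗ[ℝ] SlTwo.SZero U V,
        ∀ t, (Φ t : 𝓓'(U, V)) = SlTwo.diracMap U V t) ∧
    (∀ m : ℕ, n = 2 * m →
      Nonempty (V ≃ₗ⁅ℝ, SlTwo.Sl2⁆ SlTwo.powComp m) ∧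
      ∀ e : V ≃ₗ⁅ℝ, SlTwo.Sl2⁆ SlTwo.powComp m,
        (SlTwo.S U V = SlTwo.SZero U V ⊔ SlTwo.spanPos U e ⊔ SlTwo.spanNeg U e ∧
          iSupIndep ![SlTwo.SZero U V, SlTwo.spanPos U e, SlTwo.spanNeg U e]) ∧
        (SlTwo.SPos U V = SlTwo.SZero U V ⊔ SlTwo.spanPos U e ∧
          Disjoint (SlTwo.SZero U V) (SlTwo.spanPos U e)) ∧
        (SlTwo.SNeg U V = SlTwo.SZero U V ⊔ SlTwo.spanNeg U e ∧
          Disjoint (SlTwo.SZero U V) (SlTwo.spanNeg U e))) ∧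
    (Odd n →
      SlTwo.S U V = SlTwo.SZero U V ∧ SlTwo.SPos U V = SlTwo.SZero U V ∧
        SlTwo.SNeg U V = SlTwo.SZero U V ∧
        ¬ ∃ s : SlTwo.nilConePos → SlTwo.V1, Continuous s ∧
          ∀ Z : SlTwo.nilConePos, SlTwo.moment (s Z) = Z) := by
  obtain ⟨v₀, hv⟩ := hV.exists_generator
  refine ⟨SlTwo.SZero_eq_bot, SlTwo.exists_equiv_SZero, ?_, fun hn => ?_⟩
  · rintro m rfl
    refine ⟨hv.exists_lieEquiv (SlTwo.isHighestWeightGenerator_powComp m), fun e => ?_⟩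
    have hind := SlTwo.iSupIndep_SZero_spanPos_spanNeg hU hv e
    exact ⟨⟨SlTwo.S_eq_sup hU hv e, hind⟩,
      ⟨SlTwo.SPos_eq_sup hU hv e, hind.pairwiseDisjoint (i := 0) (j := 1) (by decide)⟩,
      ⟨SlTwo.SNeg_eq_sup hU hv e, hind.pairwiseDisjoint (i := 0) (j := 2) (by decide)⟩⟩
  -- The four spaces coincide because each of them is zero.
  · have hbot := SlTwo.invVanishingOff_eq_bot_of_odd hn hU hv
    exact ⟨(hbot _).trans (hbot _).symm, (hbot _).trans (hbot _).symm,
      (hbot _).trans (hbot _).symm, SlTwo.not_exists_moment_section⟩
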